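/- For an arithmetic function $f:\mathbb{N}\to\mathbb{C}$ and real $x\ge 1$ let \[ S_f(x)=\sum_{n\le x} f\left(\left\lfloor \frac{x}{n}\right\rfloor\right),\qquad C_f=\sum_{n=1}^\infty \frac{f(n)}{n(n+1)} . \] Let $r\ge 2$ be an integer and $\alpha\ge 0$ a real number, and let $f$ be supported on $r$-th powers: $f(d^r)=h(d)$ for $d\ge 1$, and $f(n)=0$ if $n$ is not an $r$-th power, where $h:\mathbb{N}\to\mathbb{C}$ satisfies $|h(d)|\ll d^\alpha$. Put $L_\alpha(x)=\log x$ if $\alpha=0$ and $L_\alpha(x)=1$ if $\alpha>0$. In each of the following cases the series $C_f$ converges absolutely and, as $x\to\infty$, with implied constants that may depend on $f$ and $\alpha$: 1. if $r=2$ and $\alpha\in[0,\frac13]$, then $S_f(x)=C_f\,x+O\left(x^{\frac{\alpha}{3}+\frac29}L_\alpha(x)+x^{\frac{1+\alpha}{4}}\right)$; 2. if $r=3$ and $\alpha\in[0,\frac15]$, then $S_f(x)=C_f\,x+O\left(x^{\frac{\alpha}{4}+\frac{11}{64}}L_\alpha(x)\right)$; 3. if $r=4$ and $\alpha\in[0,\frac17]$,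 then $S_f(x)=C_f\,x+O\left(x^{\frac{\alpha}{5}+\frac17}L_\alpha(x)\right)$. In particular, if $r=2$ and $\alpha\in[0,\frac13]$, then $S_f(x)=C_f\,x+O\left(x^{\frac{1+\alpha}{4}}\right)$; that is, the case $r=2$ holds of the conjecture that $S_f(x)=C_f\,x+O\left(x^{\frac{1+\alpha}{2r}}\right)$ whenever $r\ge2$ and $\alpha\in[0,\frac{1}{2r-1}]$. -/

import Mathlib

open Filter Asymptotics

namespace FloorSum

/-- The sum of `f(⌊x/n⌋)` over the integers `1 ≤ n ≤ x`. -/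
noncomputable def S (f : ℕ → ℂ) (x : ℝ) : ℂ :=
  ∑ n ∈ Finset.Icc 1 ⌊x⌋₊, f ⌊x / (n : ℝ)⌋₊

/-- The `n`-th term `f(n) / (n (n + 1))`, with `n = m + 1`, of the series defining `C_f`. -/
noncomputable def CTerm (f : ℕ → ℂ) (m : ℕ) : ℂ :=
  f (m + 1) / (((m : ℂ) + 1) * ((m : ℂ) + 2))

/-- The constant `C_f`, the sum over `n ≥ 1` of `f(n) / (n (n + 1))`. -/
noncomputable def C (f : ℕ → ℂ) : ℂ := ∑' m : ℕ, CTerm f m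

/-- The arithmetic function `f` (on the positive integers) is supported on `r`-th powers,
with `f(d ^ r) = h(d)`. -/
def IsPowerSupported (r : ℕ) (h f : ℕ → ℂ) : Prop :=
  (∀ d : ℕ, 1 ≤ d → f (d ^ r) = h d) ∧
    ∀ n : ℕ, 1 ≤ n → (¬ ∃ d : ℕ, n = d ^ r) → f n = 0

/-- `S_f(x) = C_f x + O(E(x))` as `x → ∞`, where the series `C_f` converges (absolutely). -/
def HasAsymptotic (f : ℕ → ℂ) (E : ℝ → ℝ) : Prop :=
  Summable (CTerm f) ∧ (fun x : ℝ => S f x - C f * (x : ℂ)) =O[atTop] E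

/-- The factor `log x`, present only when `α = 0`. -/
noncomputable def logFactor (α x : ℝ) : ℝ := if α = 0 then Real.log x else 1

/-- The conjectured estimate, for a given `r`: if `h(d) ≪ d ^ α` with `0 ≤ α ≤ 1 / (2 r - 1)`,
then `S_f(x) = C_f x + O(x ^ ((1 + α) / (2 r)))`. -/
def PowerConjecture (r : ℕ) : Prop :=
  ∀ (α : ℝ) (h f : ℕ → ℂ), 0 ≤ α → α ≤ 1 / (2 * (r : ℝ) - 1) →
    IsPowerSupported r h f → (h =O[atTop] fun d : ℕ => (d : ℝ) ^ α) →
    HasAsymptotic f fun x => x ^ ((1 + α) / (2 * (r : ℝ)))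

end FloorSum

namespace FloorSum

/-! Grouping the sum by the value d^r of ⌊x/n⌋, each d contributes h(d) times the number of integers
in an interval of length x/(d^r(d^r+1)). For d ≤ x^θ with 2rθ ≥ 1 this count is its length up to
O(1), which gives C_f x with error x^(θ(1+α)). For larger d the count is 0 or 1, so what remains is
to bound the sum of d^α over the `hits`, the d for which some n has ⌊x/n⌋ = d^r. For such d, x/d^r
lies just above the integer n; dually, (x/n)^(1/r) lies just above the integer d. Either way one
counts integer points very close to the graph of a power function.

Two general counts are used. With k+1 points close together, the divided difference of the nearby
integers, multiplied by the Vandermonde product, is a nonzero integer, and this forces the points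
apart (`card_le_of_deriv_bounds`). With consecutive points, the chord (gap q, increment b) nearly
fixes the derivative and hence, by convexity, the position; so few points share a chord, and there
are few short chords (`card_pow_near_int_of_chords`). For r = 3 and r = 4 these counts, with the
trivial bound x/D^r on d in [D, 2D], suffice.

For r = 2 and α = 1/3 the classical bound x^((1-u)/3) on d in [x^u, 2x^u] contributes x^(1/3) at
every dyadic scale, so a power gain is needed to sum without a logarithm. Take a curve over [M, κM]
with first derivative of order K and second of order K/M, and put G = (M/K)^(1/3). The classical
count is KG² = M/G, with typical gap G. Only gaps between G/w and Gw can prevent a gain of a factor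
w. A chord is parallel to the tangent at its midpoint up to third-order terms, so (q, b) determines
the midpoint through the inverse of the derivative. Twice the midpoint is the integer 2s+q. Hence an
explicit function of b/q must be close to an integer (`exists_stepPairs`), and pairs with that
property are again counted by the two methods: over q for fixed b if K ≤ G, over b for fixed q if G
≤ K.

The gain degenerates only where K, G or K/G is of order 1, that is near a few fixed powers of x, and
it grows geometrically away from them. The dyadic sum is therefore O(x^(1/3)), and smaller α follow
from this critical weight by comparison. -/

/-! ### Counting points in intervals -/

/-- A finite set of naturals with gaps at least `q` in an interval of length `L` has at most
`L / q + 1` elements. -/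
theorem card_le_of_separated {T : Finset ℕ} {u L q : ℝ} (hq : 0 < q) (hL : 0 ≤ L)
    (hT : ∀ s ∈ T, u ≤ s ∧ (s : ℝ) ≤ u + L)
    (hsep : ∀ s ∈ T, ∀ t ∈ T, s < t → (s : ℝ) + q ≤ t) : (T.card : ℝ) ≤ L / q + 1 := by
  have h : T.card ≤ (Finset.range (⌊L / q⌋₊ + 1)).card := by
    refine Finset.card_le_card_of_injOn (fun s => ⌊((s : ℝ) - u) / q⌋₊) ?_ ?_
    · intro s hs
      have h1 := hT s hs
      simp only [Finset.coe_range, Set.mem_Iio]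
      refine Nat.lt_succ_of_le (Nat.floor_le_floor ?_)
      gcongr
      linarith
    · intro s hs t ht hst
      simp only at hst
      have key : ∀ s ∈ T, ∀ t ∈ T, s < t → ⌊((s : ℝ) - u) / q⌋₊ ≠ ⌊((t : ℝ) - u) / q⌋₊ := by
        intro s hs t ht hlt
        have h1 := hsep s hs t ht hlt
        have h0 := (hT s hs).1
        have h2 : ((s : ℝ) - u) / q + 1 ≤ ((t : ℝ) - u) / q := by
          rw [div_add_one hq.ne']
          gcongr
          linarith
        have h3 : 0 ≤ ((s : ℝ) - u) / q := div_nonneg (by linarith) hq.le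
        have h4 := Nat.floor_le_floor h2
        rw [Nat.floor_add_one h3] at h4
        omega
      rcases lt_trichotomy s t with h | h | h
      · exact absurd hst (key s hs t ht h)
      · exact h
      · exact absurd hst.symm (key t ht s hs h)
  rw [Finset.card_range] at h
  calc (T.card : ℝ) ≤ ((⌊L / q⌋₊ + 1 : ℕ) : ℝ) := by exact_mod_cast h
    _ ≤ L / q + 1 := by
      push_cast
      gcongr
      exact Nat.floor_le (by positivity)

/-- The same bound for a finite set of integers. -/
theorem card_int_le_of_mem_interval {T : Finset ℤ} {u L : ℝ} (hL : 0 ≤ L)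
    (hT : ∀ s ∈ T, u ≤ s ∧ (s : ℝ) ≤ u + L) : (T.card : ℝ) ≤ L + 1 := by
  have h1 : T ⊆ Finset.Icc ⌈u⌉ ⌊u + L⌋ := by
    intro s hs
    obtain ⟨a, b⟩ := hT s hs
    exact Finset.mem_Icc.2 ⟨Int.ceil_le.2 a, Int.le_floor.2 b⟩
  have h2 := Finset.card_le_card h1
  rw [Int.card_Icc] at h2
  have h3 : ((⌊u + L⌋ + 1 - ⌈u⌉ : ℤ) : ℝ) ≤ L + 1 := by
    push_cast
    have := Int.floor_le (u + L)
    have := Int.le_ceil u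
    linarith
  have h4 : ((⌊u + L⌋ + 1 - ⌈u⌉).toNat : ℝ) ≤ L + 1 := by
    rcases le_or_gt 0 (⌊u + L⌋ + 1 - ⌈u⌉) with h | h
    · have : (((⌊u + L⌋ + 1 - ⌈u⌉).toNat : ℤ) : ℝ) = ((⌊u + L⌋ + 1 - ⌈u⌉ : ℤ) : ℝ) := by
        rw [Int.toNat_of_nonneg h]
      rw [← this] at h3
      exact_mod_cast h3
    · rw [Int.toNat_of_nonpos h.le]
      simp; linarith
  exact le_trans (by exact_mod_cast h2) h4

/-! ### Divided differences and integer points near a curve -/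

/-- Iterated Rolle theorem: `k + 1` zeros of `g 0` give a zero of the `k`-th derivative `g k`. -/
theorem exists_zero_of_iterated_deriv (k : ℕ) (g : ℕ → ℝ → ℝ) (t : ℕ → ℝ)
    (ht : ∀ i < k, t i < t (i + 1))
    (hg : ∀ j < k, ∀ z ∈ Set.Icc (t 0) (t k), HasDerivAt (g j) (g (j + 1) z) z)
    (h0 : ∀ i ≤ k, g 0 (t i) = 0) : ∃ z ∈ Set.Icc (t 0) (t k), g k z = 0 := by
  induction k generalizing g t with
  | zero => exact ⟨t 0, by simp, h0 0 le_rfl⟩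
  | succ k ih =>
    have hmono : ∀ i ≤ k + 1, ∀ j ≤ i, t j ≤ t i := by
      intro i
      induction i with
      | zero => intro _ j hj; simp at hj; simp [hj]
      | succ i ihi =>
        intro hi j hj
        rcases Nat.lt_or_ge i j with h | h
        · have : j = i + 1 := by omega
          rw [this]
        · exact (ihi (by omega) j h).trans (ht i (by omega)).le
    have hex : ∀ i, ∃ z, i ≤ k → (z ∈ Set.Ioo (t i) (t (i + 1)) ∧ g 1 z = 0) := by
      intro i
      by_cases hi : i ≤ k
      · have hsub : ∀ z ∈ Set.Icc (t i) (t (i + 1)), z ∈ Set.Icc (t 0) (t (k + 1)) := fun z hz =>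
          ⟨(hmono i (by omega) 0 (by omega)).trans hz.1,
            hz.2.trans (hmono (k + 1) le_rfl (i + 1) (by omega))⟩
        obtain ⟨z, hz, hz'⟩ := exists_hasDerivAt_eq_zero (f := g 0) (f' := g 1) (ht i (by omega))
          (fun z hz => (hg 0 (by omega) z (hsub z hz)).continuousAt.continuousWithinAt)
          (by rw [h0 i (by omega), h0 (i + 1) (by omega)])
          (fun z hz => hg 0 (by omega) z (hsub z ⟨hz.1.le, hz.2.le⟩))
        exact ⟨z, fun _ => ⟨hz, hz'⟩⟩
      · exact ⟨0, fun h => absurd h hi⟩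
    choose z hz using hex
    have hz0 := (hz 0 (by omega)).1.1
    have hzk := (hz k le_rfl).1.2
    obtain ⟨w, hw, hw'⟩ := ih (fun j => g (j + 1)) z
      (fun i hi => ((hz i (by omega)).1.2).trans ((hz (i + 1) (by omega)).1.1))
      (fun j hj y hy => hg (j + 1) (by omega) y ⟨hz0.le.trans hy.1, hy.2.trans hzk.le⟩)
      (fun i hi => (hz i hi).2)
    exact ⟨w, ⟨hz0.le.trans hw.1, hw.2.trans hzk.le⟩, hw'⟩

/-- The divided difference of the values `y i` at the nodes `v i`, for `i ≤ k`. -/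
noncomputable def divDiff (k : ℕ) (v y : ℕ → ℝ) : ℝ :=
  ∑ i ∈ Finset.range (k + 1), y i / ∏ j ∈ (Finset.range (k + 1)).erase i, (v i - v j)

theorem divDiff_sub (k : ℕ) (v y z : ℕ → ℝ) :
    divDiff k v (fun i => y i - z i) = divDiff k v y - divDiff k v z := by
  simp only [divDiff, sub_div, Finset.sum_sub_distrib]

/-- Mean value theorem for divided differences. -/
theorem exists_divDiff_eq (k : ℕ) (g : ℕ → ℝ → ℝ) (v : ℕ → ℝ) (hv : StrictMono v)
    (hg : ∀ j < k, ∀ z ∈ Set.Icc (v 0) (v k), HasDerivAt (g j) (g (j + 1) z) z) :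
    ∃ z ∈ Set.Icc (v 0) (v k), g k z = k.factorial * divDiff k v (fun i => g 0 (v i)) := by
  classical
  set s := Finset.range (k + 1)
  set P := Lagrange.interpolate s v (fun i => g 0 (v i)) with hP
  have hinj : Set.InjOn v s := hv.injective.injOn
  have hdeg : P.degree < s.card := Lagrange.degree_interpolate_lt _ hinj
  have hnat : P.natDegree ≤ k := by
    rw [Finset.card_range, Polynomial.degree_lt_iff_coeff_zero] at hdeg
    exact Polynomial.natDegree_le_iff_coeff_eq_zero.2 fun N hN => hdeg N hN
  -- The function minus its interpolating polynomial vanishes at the k+1 nodes, so its k-th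
  -- derivative has a zero; the k-th derivative of the polynomial is k! times its top coefficient,
  -- the divided difference.
  obtain ⟨z, hz, hz0⟩ := exists_zero_of_iterated_deriv k
    (fun j t => g j t - ((Polynomial.derivative^[j] P).eval t)) v (fun i _ => hv (Nat.lt_succ_self i))
    (fun j hj z hz => by
      refine (hg j hj z hz).sub ?_
      rw [Function.iterate_succ_apply']
      exact Polynomial.hasDerivAt _ _)
    (fun i hi => by
      simp only [Function.iterate_zero, id_eq, hP]
      rw [Lagrange.eval_interpolate_at_node _ hinj (by simp [s]; omega), sub_self])
  refine ⟨z, hz, ?_⟩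
  have hc : P.coeff k = divDiff k v (fun i => g 0 (v i)) := by
    have := Lagrange.coeff_eq_sum (v := v) (s := s) (P := P) hinj hdeg
    simp only [s, Finset.card_range, Nat.add_sub_cancel] at this
    rw [this, divDiff]
    refine Finset.sum_congr rfl fun i hi => ?_
    rw [hP, Lagrange.eval_interpolate_at_node _ hinj hi]
  have hd : (Polynomial.derivative^[k] P).eval z = k.factorial * P.coeff k := by
    have h1 : (Polynomial.derivative^[k] P).natDegree ≤ 0 :=
      (Polynomial.natDegree_iterate_derivative P k).trans (by omega)
    rw [Polynomial.eq_C_of_natDegree_le_zero h1, Polynomial.eval_C,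
      Polynomial.coeff_iterate_derivative]
    simp [Nat.descFactorial_self]
  rw [← hc, ← hd]
  exact sub_eq_zero.1 hz0

/-- The divided difference of integer values at integer nodes is an integer divided by the
Vandermonde product. -/
theorem exists_int_divDiff (k : ℕ) (n m : ℕ → ℤ) (hn : StrictMono n) :
    ∃ N : ℤ, (∏ a ∈ Finset.range (k + 1), ∏ b ∈ Finset.range a, ((n a : ℝ) - n b)) *
      divDiff k (fun i => (n i : ℝ)) (fun i => (m i : ℝ)) = N := by
  classical
  set V : ℤ := ∏ a ∈ Finset.range (k + 1), ∏ b ∈ Finset.range a, (n a - n b) with hV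
  have hdvd : ∀ i ∈ Finset.range (k + 1),
      (∏ j ∈ (Finset.range (k + 1)).erase i, (n i - n j)) ∣ V := by
    intro i hi
    have hi' := Finset.mem_range.1 hi
    -- Factors with j < i form row i of the Vandermonde product; the factor with j > i occurs, up to
    -- sign, in row j. The rows involved are distinct, so the whole product divides.
    have e : (Finset.range (k + 1)).erase i = Finset.range i ∪ Finset.Ioc i k := by
      ext j; simp only [Finset.mem_erase, Finset.mem_range, Finset.mem_union, Finset.mem_Ioc]; omega
    have hdis : Disjoint (Finset.range i) (Finset.Ioc i k) := by
      rw [Finset.disjoint_left]; intro j; simp only [Finset.mem_range, Finset.mem_Ioc]; omega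
    have hsub : insert i (Finset.Ioc i k) ⊆ Finset.range (k + 1) := by
      intro j; simp only [Finset.mem_insert, Finset.mem_range, Finset.mem_Ioc]; omega
    rw [e, Finset.prod_union hdis]
    refine dvd_trans ?_ (Finset.prod_dvd_prod_of_subset _ _ _ hsub)
    rw [Finset.prod_insert (by simp)]
    refine mul_dvd_mul_left _ (Finset.prod_dvd_prod_of_dvd _ _ fun a ha => ?_)
    have h1 : (n a - n i) ∣ ∏ b ∈ Finset.range a, (n a - n b) :=
      Finset.dvd_prod_of_mem (fun b => n a - n b) (Finset.mem_range.2 (Finset.mem_Ioc.1 ha).1)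
    rw [← neg_sub]
    exact (neg_dvd).2 h1
  have hne : ∀ i ∈ Finset.range (k + 1),
      (∏ j ∈ (Finset.range (k + 1)).erase i, ((n i : ℝ) - n j)) ≠ 0 := by
    intro i _
    refine Finset.prod_ne_zero_iff.2 fun j hj => ?_
    have := hn.injective.ne (Finset.ne_of_mem_erase hj)
    rw [sub_ne_zero]
    exact fun h => this (by exact_mod_cast h.symm)
  choose! N hN using hdvd
  refine ⟨∑ i ∈ Finset.range (k + 1), m i * N i, ?_⟩
  have hVr : (∏ a ∈ Finset.range (k + 1), ∏ b ∈ Finset.range a, ((n a : ℝ) - n b)) = (V : ℝ) := by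
    rw [hV]; push_cast; rfl
  rw [hVr, divDiff, Finset.mul_sum]
  push_cast
  refine Finset.sum_congr rfl fun i hi => ?_
  have h1 := hN i hi
  have h2 : (V : ℝ) = (∏ j ∈ (Finset.range (k + 1)).erase i, ((n i : ℝ) - n j)) * N i := by
    rw [h1]; push_cast; rfl
  have h3 := hne i hi
  rw [h2]
  field_simp

/-- If the `k`-th derivative is of order `lam` and the values at `k + 1` integers, with gaps at
least `γ`, in an interval of length `B` are close to integers, then `B` is large. -/
theorem one_le_of_nodes (k γ : ℕ) (hk : 1 ≤ k) (hγ : 1 ≤ γ) {C C' lam δ B : ℝ}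
    (hlam : 0 < lam) (hδ0 : 0 ≤ δ) (hδ : δ ≤ C' * lam)
    (hγC : (k + 1) * C' * k.factorial < γ) (hB : 0 ≤ B)
    (g : ℕ → ℝ → ℝ) (n : ℕ → ℕ) (m : ℕ → ℤ)
    (hn : ∀ i, n i + γ ≤ n (i + 1)) (hnB : (n k : ℝ) ≤ n 0 + B)
    (hg : ∀ j < k, ∀ z ∈ Set.Icc (n 0 : ℝ) (n k), HasDerivAt (g j) (g (j + 1) z) z)
    (hgk : ∀ z ∈ Set.Icc (n 0 : ℝ) (n k), lam ≤ |g k z| ∧ |g k z| ≤ C * lam)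
    (hm : ∀ i ≤ k, |g 0 (n i) - m i| ≤ δ) :
    1 ≤ B ^ (∑ a ∈ Finset.range (k + 1), a) * ((C + (k + 1) * C') * lam) := by
  classical
  have hmono : StrictMono n := strictMono_nat_of_lt_succ fun i => by have := hn i; omega
  have hmonoR : StrictMono (fun i => (n i : ℝ)) := fun a b h => by
    simpa using hmono h
  have hgap : ∀ i j, i ≠ j → (γ : ℝ) ≤ |(n i : ℝ) - n j| := by
    have key : ∀ i j, i < j → (γ : ℝ) ≤ (n j : ℝ) - n i := by
      intro i j hij
      have h1 := hn i
      have h2 := hmono.monotone (show i + 1 ≤ j from hij)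
      have h3 : n i + γ ≤ n j := h1.trans h2
      have : (n i : ℝ) + γ ≤ n j := by exact_mod_cast h3
      linarith
    intro i j hij
    rcases lt_or_gt_of_ne hij with h | h
    · rw [abs_sub_comm]; exact (key i j h).trans (le_abs_self _)
    · exact (key j i h).trans (le_abs_self _)
  obtain ⟨z, hz, hzd⟩ := exists_divDiff_eq k g (fun i => (n i : ℝ)) hmonoR hg
  obtain ⟨N, hN⟩ := exists_int_divDiff k (fun i => (n i : ℤ)) m
    (fun a b h => by simpa using hmono h)
  simp only [Int.cast_natCast] at hN
  set V := ∏ a ∈ Finset.range (k + 1), ∏ b ∈ Finset.range a, ((n a : ℝ) - n b) with hV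
  set Dg := divDiff k (fun i => (n i : ℝ)) (fun i => g 0 (n i)) with hDg
  set Dm := divDiff k (fun i => (n i : ℝ)) (fun i => (m i : ℝ)) with hDm
  have hfact : (1 : ℝ) ≤ k.factorial := by exact_mod_cast Nat.factorial_pos k
  have hγ1 : (1 : ℝ) ≤ γ := by exact_mod_cast hγ
  -- the error in passing from function values to integers
  have herr : |Dg - Dm| ≤ (k + 1) * (δ / γ) := by
    rw [hDg, hDm, ← divDiff_sub, divDiff]
    refine (Finset.abs_sum_le_sum_abs _ _).trans ?_
    have : ∀ i ∈ Finset.range (k + 1), |(g 0 (n i) - m i) /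
        ∏ j ∈ (Finset.range (k + 1)).erase i, ((n i : ℝ) - n j)| ≤ δ / γ := by
      intro i hi
      rw [abs_div, Finset.abs_prod]
      have hp : (γ : ℝ) ≤ ∏ j ∈ (Finset.range (k + 1)).erase i, |(n i : ℝ) - n j| := by
        calc (γ : ℝ) ≤ (γ : ℝ) ^ k := le_self_pow₀ hγ1 (by omega)
          _ = ∏ j ∈ (Finset.range (k + 1)).erase i, (γ : ℝ) := by
            rw [Finset.prod_const, Finset.card_erase_of_mem hi, Finset.card_range]; rfl
          _ ≤ _ := Finset.prod_le_prod (fun _ _ => by positivity)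
            (fun j hj => hgap i j (Finset.ne_of_mem_erase hj).symm)
      exact div_le_div₀ hδ0 (hm i (by have := Finset.mem_range.1 hi; omega)) (by linarith) hp
    refine (Finset.sum_le_sum this).trans ?_
    simp
  -- The spacing γ makes the perturbation smaller than the least size λ/k! of the true divided
  -- difference, so the one formed from integers cannot vanish.
  have herr1 : (k + 1) * (δ / γ) < lam / k.factorial := by
    rw [mul_div_assoc', div_lt_div_iff₀ (by linarith) (by linarith)]
    calc (k + 1) * δ * k.factorial ≤ (k + 1) * (C' * lam) * k.factorial := by gcongr
      _ = lam * ((k + 1) * C' * k.factorial) := by ring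
      _ < lam * γ := by gcongr
  have hgz := hgk z hz
  have hDg1 : |g k z| = k.factorial * |Dg| := by
    rw [hzd, abs_mul, abs_of_pos (by linarith : (0 : ℝ) < k.factorial)]
  have hDglow : lam / k.factorial ≤ |Dg| := by
    rw [div_le_iff₀ (by linarith)]; linarith
  have hDgup : |Dg| ≤ C * lam := by
    nlinarith [abs_nonneg Dg]
  have hDm0 : Dm ≠ 0 := by
    intro h
    rw [h, sub_zero] at herr
    linarith
  have hDmup : |Dm| ≤ (C + (k + 1) * C') * lam := by
    have h1 : |Dm| ≤ |Dg| + |Dg - Dm| := by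
      have := abs_sub_abs_le_abs_sub Dm Dg
      rw [abs_sub_comm] at this; linarith
    have h2 : (k + 1) * (δ / γ) ≤ (k + 1) * (C' * lam) := by
      gcongr
      exact (div_le_self hδ0 hγ1).trans hδ
    nlinarith
  have hVpos : 0 < V := by
    refine Finset.prod_pos fun a _ => Finset.prod_pos fun b hb => ?_
    exact sub_pos.2 (hmonoR (Finset.mem_range.1 hb))
  have hVup : V ≤ B ^ (∑ a ∈ Finset.range (k + 1), a) := by
    rw [← Finset.prod_pow_eq_pow_sum]
    refine Finset.prod_le_prod (fun a _ => Finset.prod_nonneg fun b hb => ?_) fun a ha => ?_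
    · exact sub_nonneg.2 (hmonoR (Finset.mem_range.1 hb)).le
    · calc ∏ b ∈ Finset.range a, ((n a : ℝ) - n b) ≤ ∏ b ∈ Finset.range a, B := by
            refine Finset.prod_le_prod (fun b hb => ?_) fun b hb => ?_
            · exact sub_nonneg.2 (hmonoR (Finset.mem_range.1 hb)).le
            · have h1 := hmonoR.monotone (show a ≤ k by have := Finset.mem_range.1 ha; omega)
              have h2 := hmonoR.monotone (Nat.zero_le b)
              linarith
        _ = B ^ a := by simp
  -- A nonzero integer has modulus at least 1, while the Vandermonde product is at most B to the
  -- power 0 + 1 + ... + k.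
  have hN0 : N ≠ 0 := by
    intro h
    rw [h, Int.cast_zero] at hN
    exact (mul_ne_zero hVpos.ne' hDm0) hN
  have hN1 : (1 : ℝ) ≤ |V * Dm| := by
    rw [hN]; exact_mod_cast Int.one_le_abs hN0
  rw [abs_mul, abs_of_pos hVpos] at hN1
  refine hN1.trans ?_
  gcongr

/-- Number of integers at which a function with `k`-th derivative of order `lam` is within
`δ = O(lam)` of an integer. -/
theorem card_le_of_deriv_bounds (k : ℕ) (hk : 1 ≤ k) {C C' : ℝ} (hC : 0 < C) (hC' : 0 ≤ C') :
    ∃ A > 0, ∀ (g : ℕ → ℝ → ℝ) (u L lam δ : ℝ) (S : Finset ℕ) (m : ℕ → ℤ),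
      0 < lam → 0 ≤ L → 0 ≤ δ → δ ≤ C' * lam →
      (∀ j < k, ∀ z ∈ Set.Icc u (u + L), HasDerivAt (g j) (g (j + 1) z) z) →
      (∀ z ∈ Set.Icc u (u + L), lam ≤ |g k z| ∧ |g k z| ≤ C * lam) →
      (∀ s ∈ S, (s : ℝ) ∈ Set.Icc u (u + L) ∧ |g 0 s - m s| ≤ δ) →
      (S.card : ℝ) ≤ A * (L * lam ^ (1 / ((∑ a ∈ Finset.range (k + 1), a : ℕ) : ℝ)) + 1) := by
  classical
  set E := ∑ a ∈ Finset.range (k + 1), a with hE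
  have hE0 : 0 < E := by
    refine Finset.sum_pos' (fun _ _ => Nat.zero_le _) ⟨k, by simp, by omega⟩
  obtain ⟨γ, hγ⟩ : ∃ γ : ℕ, (k + 1) * C' * k.factorial < γ := exists_nat_gt _
  have hγ1 : 1 ≤ γ := by
    by_contra h
    have : γ = 0 := by omega
    rw [this, Nat.cast_zero] at hγ
    have : 0 ≤ (k + 1) * C' * k.factorial := by positivity
    linarith
  set D := 2 * (C + (k + 1) * C') with hD
  have hDpos : 0 < D := by positivity
  refine ⟨k * γ * (D ^ (1 / (E : ℝ)) + 1), by positivity, ?_⟩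
  intro g u L lam δ S m hlam hL hδ0 hδ hg hgk hS
  -- With this B, and the factor 2 in D, the inequality of `one_le_of_nodes` would read 1 ≤ 1/2; so
  -- no interval of length B holds more than kγ points.
  set B := (D * lam) ^ (-(1 / (E : ℝ))) with hB
  have hBpos : 0 < B := by positivity
  have hBE : B ^ E * (D * lam) = 1 := by
    rw [hB, ← Real.rpow_natCast, ← Real.rpow_mul (by positivity)]
    have : -(1 / (E : ℝ)) * E = -1 := by
      have : (E : ℝ) ≠ 0 := by positivity
      field_simp
    rw [this, Real.rpow_neg_one]
    exact inv_mul_cancel₀ (by positivity)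
  have hfib : ∀ T ⊆ S, (∀ s ∈ T, ∀ t ∈ T, (t : ℝ) ≤ s + B) → T.card ≤ k * γ := by
    intro T hTS hTB
    by_contra! hcard
    have hidx : ∀ i, i ≤ k → i * γ < T.card := fun i hi =>
      lt_of_le_of_lt (Nat.mul_le_mul_right γ hi) hcard
    set e := T.orderEmbOfFin rfl
    set last := e ⟨k * γ, hcard⟩ with hlast
    -- Every γ-th element of T gives k+1 nodes with gaps at least γ. The continuation beyond k only
    -- serves to make the gap condition hold for all indices.
    set n : ℕ → ℕ := fun i => if h : i ≤ k then e ⟨i * γ, hidx i h⟩ else last + (i - k) * γ with hn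
    have he : ∀ (a b : ℕ) (ha : a < T.card) (hb : b < T.card), a ≤ b →
        e ⟨a, ha⟩ + (b - a) ≤ e ⟨b, hb⟩ := by
      intro a b ha hb hab
      induction b with
      | zero => have : a = 0 := by omega
                subst this; simp
      | succ b ih =>
        rcases Nat.lt_or_ge b a with h | h
        · have : a = b + 1 := by omega
          subst this; simp
        · have h1 := ih (by omega) h
          have h2 : e ⟨b, by omega⟩ < e ⟨b + 1, hb⟩ := e.strictMono (by simp [Fin.lt_def])
          omega
    have hstep : ∀ i, n i + γ ≤ n (i + 1) := by
      intro i
      by_cases h1 : i + 1 ≤ k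
      · have h2 : i ≤ k := by omega
        simp only [hn, h1, h2, dif_pos]
        have := he (i * γ) ((i + 1) * γ) (hidx i h2) (hidx _ h1) (Nat.mul_le_mul_right _ (by omega))
        have h3 : (i + 1) * γ - i * γ = γ := by rw [← Nat.sub_mul]; simp
        omega
      · by_cases h2 : i ≤ k
        · have h3 : i = k := by omega
          subst h3
          simp [hn, hlast]
        · simp only [hn, h1, h2, dif_neg, not_false_eq_true]
          have : i + 1 - k = (i - k) + 1 := by omega
          rw [this, Nat.add_mul]; omega
    have hmem : ∀ i ≤ k, n i ∈ T := by
      intro i hi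
      simp only [hn, hi, dif_pos]
      exact Finset.orderEmbOfFin_mem _ _ _
    have hsub : ∀ z ∈ Set.Icc (n 0 : ℝ) (n k), z ∈ Set.Icc u (u + L) := fun z hz =>
      ⟨(hS _ (hTS (hmem 0 (by omega)))).1.1.trans hz.1,
        hz.2.trans (hS _ (hTS (hmem k le_rfl))).1.2⟩
    have := one_le_of_nodes k γ hk hγ1 hlam hδ0 hδ hγ hBpos.le g n (fun i => m (n i)) hstep
      (hTB _ (hmem 0 (by omega)) _ (hmem k le_rfl)) (fun j hj z hz => hg j hj z (hsub z hz))
      (fun z hz => hgk z (hsub z hz)) (fun i hi => (hS _ (hTS (hmem i hi))).2)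
    rw [← hE] at this
    have h2 : B ^ E * ((C + (k + 1) * C') * lam) = 1 / 2 := by
      have : D * lam = 2 * ((C + (k + 1) * C') * lam) := by rw [hD]; ring
      rw [this] at hBE; linarith
    linarith
  have hcard : S.card ≤ k * γ * (Finset.range (⌊L / B⌋₊ + 1)).card := by
    refine Finset.card_le_mul_card_image_of_maps_to (f := fun s : ℕ => ⌊((s : ℝ) - u) / B⌋₊)
      (fun s hs => ?_) _ fun j _ => ?_
    · rw [Finset.mem_range]
      refine Nat.lt_succ_of_le (Nat.floor_le_floor ?_)
      have := (hS s hs).1.2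
      gcongr
      linarith
    · refine hfib _ (Finset.filter_subset _ _) fun s hs t ht => ?_
      rw [Finset.mem_filter] at hs ht
      have h1 : 0 ≤ ((s : ℝ) - u) / B := div_nonneg (by have := (hS s hs.1).1.1; linarith) hBpos.le
      have h2 := Nat.floor_le h1
      rw [hs.2] at h2
      have h3 := Nat.lt_floor_add_one (((t : ℝ) - u) / B)
      rw [ht.2] at h3
      rw [le_div_iff₀ hBpos] at h2
      rw [div_lt_iff₀ hBpos] at h3
      nlinarith
  rw [Finset.card_range] at hcard
  have hLB : L / B = D ^ (1 / (E : ℝ)) * (L * lam ^ (1 / (E : ℝ))) := by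
    rw [hB, Real.rpow_neg (by positivity), div_inv_eq_mul, Real.mul_rpow hDpos.le hlam.le]
    ring
  calc (S.card : ℝ) ≤ k * γ * (⌊L / B⌋₊ + 1) := by exact_mod_cast hcard
    _ ≤ k * γ * (L / B + 1) := by
      gcongr
      exact Nat.floor_le (by positivity)
    _ ≤ k * γ * ((D ^ (1 / (E : ℝ)) + 1) * (L * lam ^ (1 / (E : ℝ)) + 1)) := by
      rw [hLB]
      gcongr
      have : 0 ≤ L * lam ^ (1 / (E : ℝ)) := by positivity
      have : 0 ≤ D ^ (1 / (E : ℝ)) := by positivity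
      nlinarith
    _ = _ := by ring

/-! ### Power functions -/

/-- Iterated derivatives of `c * t ^ p`. -/
noncomputable def powDeriv (c p : ℝ) (j : ℕ) (t : ℝ) : ℝ :=
  c * (∏ i ∈ Finset.range j, (p - i)) * t ^ (p - j)

theorem hasDerivAt_powDeriv (c p : ℝ) (j : ℕ) {t : ℝ} (ht : 0 < t) :
    HasDerivAt (powDeriv c p j) (powDeriv c p (j + 1) t) t := by
  have := (Real.hasDerivAt_rpow_const (p := p - j) (Or.inl ht.ne')).const_mul
    (c * (∏ i ∈ Finset.range j, (p - i)))
  change HasDerivAt (fun t => c * (∏ i ∈ Finset.range j, (p - i)) * t ^ (p - j)) _ t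
  refine this.congr_deriv ?_
  rw [powDeriv, Finset.prod_range_succ]
  have : p - ((j + 1 : ℕ) : ℝ) = p - j - 1 := by push_cast; ring
  rw [this]; ring

theorem powDeriv_zero (c p t : ℝ) : powDeriv c p 0 t = c * t ^ p := by simp [powDeriv]

/-- Number of integers at which `c t ^ p` is close to an integer, by a `(k + 1)`-point argument. -/
theorem card_pow_near_int (k : ℕ) (hk : 1 ≤ k) (p : ℝ) (hp : ∀ i < k, p ≠ i) (hpk : p ≤ k)
    {κ C' : ℝ} (hκ : 1 ≤ κ) (hC' : 0 ≤ C') :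
    ∃ A > 0, ∀ (c M δ : ℝ) (S : Finset ℕ) (m : ℕ → ℤ), 0 < c → 0 < M → 0 ≤ δ →
      δ ≤ C' * (c * M ^ (p - k)) →
      (∀ s ∈ S, (s : ℝ) ∈ Set.Icc M (κ * M) ∧ |c * (s : ℝ) ^ p - m s| ≤ δ) →
      (S.card : ℝ) ≤
        A * (M * (c * M ^ (p - k)) ^ (1 / ((∑ a ∈ Finset.range (k + 1), a : ℕ) : ℝ)) + 1) := by
  set a := |∏ i ∈ Finset.range k, (p - i)| with ha
  -- As p is none of 0, ..., k-1, the coefficient of the k-th derivative does not vanish; p ≤ k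
  -- makes its modulus nonincreasing, so it has constant order on [M, κM].
  have hapos : 0 < a := by
    rw [ha, abs_pos, Finset.prod_ne_zero_iff]
    exact fun i hi => sub_ne_zero.2 (hp i (Finset.mem_range.1 hi))
  have hκ0 : 0 < κ := by linarith
  set e := κ ^ (p - k) with he
  have hepos : 0 < e := Real.rpow_pos_of_pos hκ0 _
  set E : ℝ := ((∑ a ∈ Finset.range (k + 1), a : ℕ) : ℝ) with hE
  obtain ⟨A, hA, h⟩ := card_le_of_deriv_bounds k hk (C := e⁻¹) (C' := C' * (a * e)⁻¹)
    (by positivity) (by positivity)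
  refine ⟨A * (κ * (a * e) ^ (1 / E) + 1), by positivity, ?_⟩
  intro c M δ S m hc hM hδ0 hδ hS
  have hQ : 0 < M ^ (p - k) := Real.rpow_pos_of_pos hM _
  have h1 := h (powDeriv c p) M ((κ - 1) * M) (a * e * (c * M ^ (p - k))) δ S m (by positivity)
    (mul_nonneg (by linarith) hM.le) hδ0 ?_ ?_ ?_ ?_
  · refine h1.trans ?_
    rw [← hE, Real.mul_rpow (by positivity) (by positivity), mul_assoc A]
    have h2 : 0 ≤ (a * e) ^ (1 / E) := by positivity
    have h3 : 0 ≤ M * (c * M ^ (p - k)) ^ (1 / E) := by positivity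
    have h4 : (κ - 1) * M * ((a * e) ^ (1 / E) * (c * M ^ (p - k)) ^ (1 / E)) =
      (κ - 1) * (a * e) ^ (1 / E) * (M * (c * M ^ (p - k)) ^ (1 / E)) := by ring
    rw [h4]
    gcongr
    nlinarith [mul_nonneg h2 h3, mul_nonneg (mul_nonneg hκ0.le h2) h3]
  · calc δ ≤ _ := hδ
      _ = _ := by field_simp
  · intro j _ z hz
    exact hasDerivAt_powDeriv c p j (hM.trans_le hz.1)
  · intro z hz
    have hz0 : 0 < z := hM.trans_le hz.1
    have hz2 : z ≤ κ * M := by have := hz.2; linarith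
    unfold powDeriv
    rw [abs_mul, abs_mul, ← ha, abs_of_pos hc, abs_of_pos (Real.rpow_pos_of_pos hz0 _)]
    have h5 : z ^ (p - k) ≤ M ^ (p - k) := Real.rpow_le_rpow_of_nonpos hM hz.1 (by linarith)
    have h6 : e * M ^ (p - k) ≤ z ^ (p - k) := by
      rw [he, ← Real.mul_rpow hκ0.le hM.le]
      exact Real.rpow_le_rpow_of_nonpos hz0 hz2 (by linarith)
    constructor
    · calc a * e * (c * M ^ (p - k)) = c * a * (e * M ^ (p - k)) := by ring
        _ ≤ _ := by gcongr
    · calc c * a * z ^ (p - k) ≤ c * a * M ^ (p - k) := by gcongr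
        _ = _ := by field_simp
  · intro s hs
    obtain ⟨⟨h7, h8⟩, h9⟩ := hS s hs
    exact ⟨⟨h7, by linarith⟩, by rwa [powDeriv_zero]⟩

/-! ### Gaps between consecutive points and their increments -/

/-- Distance from `s` to the next element of `S` (zero if there is none). -/
noncomputable def nextGap (S : Finset ℕ) (s : ℕ) : ℕ := sInf {q | 0 < q ∧ s + q ∈ S}

theorem nextGap_mem {S : Finset ℕ} {s : ℕ} (h : 0 < nextGap S s) : s + nextGap S s ∈ S :=
  (Nat.sInf_mem (Nat.nonempty_of_pos_sInf h)).2

theorem nextGap_le {S : Finset ℕ} {s t : ℕ} (hst : s < t) (ht : t ∈ S) :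
    0 < nextGap S s ∧ s + nextGap S s ≤ t := by
  have hmem : t - s ∈ {q | 0 < q ∧ s + q ∈ S} :=
    ⟨by omega, by rw [Nat.add_sub_cancel' hst.le]; exact ht⟩
  refine ⟨(Nat.sInf_mem ⟨_, hmem⟩).1, ?_⟩
  have : nextGap S s ≤ t - s := Nat.sInf_le hmem
  omega

/-- The elements of `S` followed by another element at distance at most `Q`. -/
noncomputable def shortGaps (S : Finset ℕ) (Q : ℝ) : Finset ℕ := by
  classical exact S.filter fun s => 0 < nextGap S s ∧ (nextGap S s : ℝ) ≤ Q

theorem mem_shortGaps {S : Finset ℕ} {Q : ℝ} {s : ℕ} :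
    s ∈ shortGaps S Q ↔ s ∈ S ∧ 0 < nextGap S s ∧ (nextGap S s : ℝ) ≤ Q := by
  classical
  simp [shortGaps]

/-- Any two elements outside `shortGaps` are more than Q apart, because the smaller one is followed
by a gap exceeding Q. -/
theorem card_le_card_shortGaps {S : Finset ℕ} {u L Q : ℝ} (hQ : 0 < Q) (hL : 0 ≤ L)
    (hS : ∀ s ∈ S, u ≤ s ∧ (s : ℝ) ≤ u + L) :
    (S.card : ℝ) ≤ L / Q + 1 + (shortGaps S Q).card := by
  classical
  have hsub : shortGaps S Q ⊆ S := fun s hs => (mem_shortGaps.1 hs).1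
  have h1 : ((S \ shortGaps S Q).card : ℝ) ≤ L / Q + 1 := by
    refine card_le_of_separated (u := u) hQ hL
      (fun s hs => hS s (Finset.sdiff_subset hs)) fun s hs t ht hst => ?_
    rw [Finset.mem_sdiff] at hs ht
    obtain ⟨h2, h3⟩ := nextGap_le hst ht.1
    have h4 : ¬ ((nextGap S s : ℝ) ≤ Q) := fun h => hs.2 (mem_shortGaps.2 ⟨hs.1, h2, h⟩)
    have h5 : (s : ℝ) + nextGap S s ≤ t := by exact_mod_cast h3
    linarith
  have h2 := Finset.card_sdiff_add_card_eq_card hsub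
  have h3 : ((S \ shortGaps S Q).card : ℝ) + (shortGaps S Q).card = S.card := by exact_mod_cast h2
  linarith

/-- The gap after `s`, with the corresponding increment of `m`. -/
noncomputable def step (S : Finset ℕ) (m : ℕ → ℤ) (s : ℕ) : ℕ × ℤ :=
  (nextGap S s, m (s + nextGap S s) - m s)

/-- The pairs (gap, increment) arising from the gaps of length at most `Q`. -/
noncomputable def stepPairs (S : Finset ℕ) (m : ℕ → ℤ) (Q : ℝ) : Finset (ℕ × ℤ) :=
  (shortGaps S Q).image (step S m)

theorem mem_stepPairs {S : Finset ℕ} {m : ℕ → ℤ} {Q : ℝ} {w : ℕ × ℤ} :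
    w ∈ stepPairs S m Q ↔ ∃ s ∈ S, s + w.1 ∈ S ∧ 0 < w.1 ∧ (w.1 : ℝ) ≤ Q ∧ nextGap S s = w.1 ∧
      w.2 = m (s + w.1) - m s := by
  classical
  simp only [stepPairs, Finset.mem_image, mem_shortGaps, step]
  constructor
  · rintro ⟨s, ⟨h1, h2, h3⟩, rfl⟩
    exact ⟨s, h1, nextGap_mem h2, h2, h3, rfl, rfl⟩
  · rintro ⟨s, h1, h2, h3, h4, h5, h6⟩
    refine ⟨s, ⟨h1, by omega, by rw [h5]; exact h4⟩, ?_⟩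
    ext
    · exact h5
    · simp only [h5, h6]

/-- If equal pairs (gap `q`, increment) only occur within intervals of length `Λ q`, the number of
short gaps is at most `Λ + 1` times the number of pairs. -/
theorem card_shortGaps_le {S : Finset ℕ} {m : ℕ → ℤ} {Q Λ : ℝ} (hΛ : 0 ≤ Λ)
    (h : ∀ s ∈ S, ∀ t ∈ S, ∀ q : ℕ, 0 < q → (q : ℝ) ≤ Q → s + q ∈ S → t + q ∈ S → s < t →
      m (s + q) - m s = m (t + q) - m t → (t : ℝ) ≤ s + Λ * q) :
    ((shortGaps S Q).card : ℝ) ≤ (Λ + 1) * (stepPairs S m Q).card := by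
  classical
  have h1 : (shortGaps S Q).card ≤ ⌊Λ + 1⌋₊ * (stepPairs S m Q).card := by
    refine Finset.card_le_mul_card_image _ _ fun w hw => ?_
    refine Nat.le_floor ?_
    set F := (shortGaps S Q).filter fun s => step S m s = w with hF
    rcases F.eq_empty_or_nonempty with h0 | h0
    · rw [h0]; simp; linarith
    obtain ⟨s₀, hs₀, hmin⟩ := F.exists_minimal h0
    have hFm : ∀ s ∈ F, s ∈ S ∧ 0 < w.1 ∧ (w.1 : ℝ) ≤ Q ∧ s + w.1 ∈ S ∧ nextGap S s = w.1 ∧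
        m (s + w.1) - m s = w.2 := by
      intro s hs
      rw [hF, Finset.mem_filter, mem_shortGaps] at hs
      obtain ⟨⟨h2, h3, h4⟩, h5⟩ := hs
      have h6 : nextGap S s = w.1 := congrArg Prod.fst h5
      have h7 : m (s + nextGap S s) - m s = w.2 := congrArg Prod.snd h5
      have h8 := nextGap_mem h3
      rw [h6] at h3 h4 h7 h8
      exact ⟨h2, h3, h4, h8, h6, h7⟩
    have hw0 := (hFm s₀ hs₀).2.1
    have hw0' : (0 : ℝ) < w.1 := by exact_mod_cast hw0
    have hle : ∀ s ∈ F, s₀ ≤ s := fun s hs => by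
      rcases le_total s₀ s with h2 | h2
      · exact h2
      · exact hmin hs h2
    -- All elements of the fibre have their successor in S exactly q further on, so they are
    -- q-separated; they lie within Λq of the least one.
    have := card_le_of_separated (T := F) (u := s₀) (L := Λ * w.1) (q := w.1) hw0' (by positivity)
      (fun s hs => ⟨by exact_mod_cast hle s hs, by
        rcases (hle s hs).eq_or_lt with h2 | h2
        · rw [← h2]
          have : 0 ≤ Λ * w.1 := by positivity
          linarith
        · obtain ⟨a1, a2, a3, a4, a5, a6⟩ := hFm s₀ hs₀
          obtain ⟨b1, b2, b3, b4, b5, b6⟩ := hFm s hs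
          exact h s₀ a1 s b1 w.1 a2 a3 a4 b4 h2 (a6.trans b6.symm)⟩)
      (fun s hs t ht hst => by
        have h2 := (nextGap_le hst (hFm t ht).1).2
        rw [(hFm s hs).2.2.2.2.1] at h2
        exact_mod_cast h2)
    rwa [mul_div_assoc, div_self hw0'.ne', mul_one] at this
  calc ((shortGaps S Q).card : ℝ) ≤ (⌊Λ + 1⌋₊ : ℝ) * (stepPairs S m Q).card := by exact_mod_cast h1
    _ ≤ _ := by
      gcongr
      exact Nat.floor_le (by linarith)

/-- Count of pairs `(q, b)`, fibre by fibre over `q`. -/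
theorem card_pairs_le {W : Finset (ℕ × ℤ)} {Q X : ℝ} (hQ : 0 ≤ Q) (hX : 0 ≤ X)
    (hW : ∀ w ∈ W, 0 < w.1 ∧ (w.1 : ℝ) ≤ Q)
    (hfib : ∀ q : ℕ, 0 < q → (q : ℝ) ≤ Q → ∀ T : Finset ℤ, (∀ b ∈ T, (q, b) ∈ W) → (T.card : ℝ) ≤ X) :
    (W.card : ℝ) ≤ Q * X := by
  classical
  have h1 : W.card = ∑ q ∈ Finset.Icc 1 ⌊Q⌋₊, (W.filter fun w => w.1 = q).card := by
    refine Finset.card_eq_sum_card_fiberwise fun w hw => ?_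
    obtain ⟨h2, h3⟩ := hW w hw
    simp only [Finset.coe_Icc, Set.mem_Icc]
    exact ⟨h2, Nat.le_floor h3⟩
  rw [h1]
  push_cast
  calc ∑ q ∈ Finset.Icc 1 ⌊Q⌋₊, ((W.filter fun w => w.1 = q).card : ℝ)
      ≤ ∑ q ∈ Finset.Icc 1 ⌊Q⌋₊, X := by
        refine Finset.sum_le_sum fun q hq => ?_
        rw [Finset.mem_Icc] at hq
        have h2 : (W.filter fun w => w.1 = q).card =
            ((W.filter fun w => w.1 = q).image Prod.snd).card := by
          rw [Finset.card_image_of_injOn]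
          rintro ⟨a, b⟩ hw ⟨a', b'⟩ hw' hb
          simp only [Finset.coe_filter, Set.mem_ofPred_eq] at hw hw' hb
          rw [hw.2, hw'.2, hb]
        rw [h2]
        refine hfib q hq.1 ((Nat.le_floor_iff hQ).1 hq.2) _ fun b hb => ?_
        obtain ⟨w, hw, rfl⟩ := Finset.mem_image.1 hb
        rw [Finset.mem_filter] at hw
        rw [← hw.2]
        exact hw.1
    _ = ⌊Q⌋₊ * X := by simp
    _ ≤ Q * X := by gcongr; exact Nat.floor_le hQ

/-! ### Counting by chords -/

/-- Chord slopes of `c t ^ p` are values of the derivative. -/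
theorem exists_chord_slope (c p : ℝ) {s q : ℝ} (hs : 0 < s) (hq : 0 < q) :
    ∃ z ∈ Set.Ioo s (s + q), c * (s + q) ^ p - c * s ^ p = q * powDeriv c p 1 z := by
  obtain ⟨z, hz, h⟩ := exists_hasDerivAt_eq_slope (powDeriv c p 0) (powDeriv c p 1)
    (show s < s + q by linarith)
    (fun z hz => (hasDerivAt_powDeriv c p 0 (hs.trans_le hz.1)).continuousAt.continuousWithinAt)
    (fun z hz => hasDerivAt_powDeriv c p 0 (hs.trans hz.1))
  refine ⟨z, hz, ?_⟩
  rw [h, powDeriv_zero, powDeriv_zero, add_sub_cancel_left, mul_div_cancel₀ _ hq.ne']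

/-- Strict convexity made quantitative: for p < 0 the second derivative is positive and decreasing,
hence at least its value at κM. The value of the derivative therefore locates the point. -/
theorem powDeriv_one_sub_ge {p κ c M z w : ℝ} (hp : p < 0) (hκ0 : 0 < κ) (hc : 0 < c) (hM : 0 < M)
    (hz : M ≤ z) (hzw : z < w) (hw : w ≤ κ * M) :
    p * (p - 1) * κ ^ (p - 2) * (c * M ^ (p - 2)) * (w - z) ≤
      powDeriv c p 1 w - powDeriv c p 1 z := by
  obtain ⟨y, hy, h⟩ := exists_hasDerivAt_eq_slope (powDeriv c p 1) (powDeriv c p 2) hzw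
    (fun y hy => (hasDerivAt_powDeriv c p 1
      (hM.trans_le (hz.trans hy.1))).continuousAt.continuousWithinAt)
    (fun y hy => hasDerivAt_powDeriv c p 1 (hM.trans_le (hz.trans hy.1.le)))
  have hy0 : 0 < y := hM.trans_le (hz.trans hy.1.le)
  rw [eq_div_iff (by linarith)] at h
  rw [← h]
  refine mul_le_mul_of_nonneg_right ?_ (by linarith)
  have h6 : κ ^ (p - 2) * M ^ (p - 2) ≤ y ^ (p - 2) := by
    rw [← Real.mul_rpow hκ0.le hM.le]
    exact Real.rpow_le_rpow_of_nonpos hy0 (by linarith [hy.2]) (by linarith)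
  have h7 : 0 < p * (p - 1) := mul_pos_of_neg_of_neg hp (by linarith)
  simp only [powDeriv, Finset.prod_range_succ, Finset.prod_range_zero, Nat.cast_zero, sub_zero,
    Nat.cast_one, one_mul, Nat.cast_ofNat]
  calc p * (p - 1) * κ ^ (p - 2) * (c * M ^ (p - 2))
      = c * (p * (p - 1)) * (κ ^ (p - 2) * M ^ (p - 2)) := by ring
    _ ≤ _ := by gcongr

set_option maxHeartbeats 1000000 in
/-- Number of integers at which `c t ^ p`, with `p < 0`, is close to an integer, by comparison of
consecutive solutions. -/
theorem card_pow_near_int_of_chords (p : ℝ) (hp : p < 0) {κ : ℝ} (hκ : 1 ≤ κ) :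
    ∃ A > 0, ∀ (c M δ Q : ℝ) (S : Finset ℕ) (m : ℕ → ℤ), 0 < c → 0 < M → 0 ≤ δ → δ ≤ 1 → 1 ≤ Q →
      (∀ s ∈ S, (s : ℝ) ∈ Set.Icc M (κ * M) ∧ |c * (s : ℝ) ^ p - m s| ≤ δ) →
      (S.card : ℝ) ≤ A * (1 + M / Q + (1 + δ / (c * M ^ (p - 2))) *
        (Q + Q ^ 2 * M * (c * M ^ (p - 2)))) := by
  classical
  have hκ0 : 0 < κ := by linarith
  set e := p * (p - 1) * κ ^ (p - 2) with he
  have hepos : 0 < e := mul_pos (mul_pos_of_neg_of_neg hp (by linarith)) (by positivity)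
  refine ⟨κ + (2 + 4 / e) * (5 - p), by
    have : 0 < (2 + 4 / e) * (5 - p) := mul_pos (by positivity) (by linarith)
    linarith, ?_⟩
  intro c M δ Q S m hc hM hδ0 hδ1 hQ hS
  set lam := c * M ^ (p - 2) with hlam
  have hlampos : 0 < lam := by positivity
  have hM1 : powDeriv c p 1 M = p * (lam * M) := by
    have : M ^ (p - 1) = M ^ (p - 2) * M := by
      rw [← Real.rpow_add_one hM.ne']; congr 1; ring
    simp only [powDeriv, Finset.prod_range_one, Nat.cast_zero, sub_zero, Nat.cast_one, this, hlam]
    ring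
  have hneg : ∀ z, 0 < z → powDeriv c p 1 z ≤ 0 := by
    intro z hz
    simp only [powDeriv, Finset.prod_range_one, Nat.cast_zero, sub_zero]
    exact mul_nonpos_of_nonpos_of_nonneg (mul_nonpos_of_nonneg_of_nonpos hc.le hp.le) (by positivity)
  have hgrow : ∀ z w, M ≤ z → z < w → w ≤ κ * M →
      e * lam * (w - z) ≤ powDeriv c p 1 w - powDeriv c p 1 z := fun z w hz hzw hw =>
    powDeriv_one_sub_ge hp hκ0 hc hM hz hzw hw
  -- each chord between points of `S` has slope near a value of the derivative
  have hchord : ∀ s ∈ S, ∀ q : ℕ, 0 < q → s + q ∈ S → ∃ z ∈ Set.Ioo (s : ℝ) (s + q),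
      M ≤ z ∧ z ≤ κ * M ∧ |((m (s + q) - m s : ℤ) : ℝ) - q * powDeriv c p 1 z| ≤ 2 * δ := by
    intro s hs q hq hsq
    obtain ⟨h1, h2⟩ := hS s hs
    obtain ⟨h3, h4⟩ := hS _ hsq
    obtain ⟨z, hz, h⟩ := exists_chord_slope c p (hM.trans_le h1.1)
      (show (0 : ℝ) < q by exact_mod_cast hq)
    push_cast at h3 h4
    refine ⟨z, hz, h1.1.trans hz.1.le, hz.2.le.trans h3.2, ?_⟩
    rw [← h]
    push_cast
    have := abs_sub (c * (s : ℝ) ^ p - m s) (c * ((s : ℝ) + q) ^ p - m (s + q))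
    have e1 : (m (s + q) : ℝ) - m s - (c * (s + q) ^ p - c * s ^ p) =
      (c * (s : ℝ) ^ p - m s) - (c * ((s : ℝ) + q) ^ p - m (s + q)) := by ring
    rw [e1]
    linarith
  have hshort : ((shortGaps S Q).card : ℝ) ≤
      ((1 + 4 * δ / (e * lam)) + 1) * (stepPairs S m Q).card := by
    -- Two equal chords over the same q have mean-value points whose derivatives differ by at most
    -- 4δ/q, so these points are within 4δ/(eλ); each lies within q of its left endpoint.
    refine card_shortGaps_le (by positivity) ?_
    intro s hs t ht q hq _ hsq htq hst hb
    obtain ⟨z, hz, z1, z2, hz3⟩ := hchord s hs q hq hsq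
    obtain ⟨w, hw, w1, w2, hw3⟩ := hchord t ht q hq htq
    rw [hb] at hz3
    have hq1 : (1 : ℝ) ≤ q := by exact_mod_cast hq
    have hdiff : (q : ℝ) * (powDeriv c p 1 w - powDeriv c p 1 z) ≤ 4 * δ := by
      have h5 := abs_le.1 hz3
      have h6 := abs_le.1 hw3
      linarith [h5.1, h5.2, h6.1, h6.2]
    have hX : 0 ≤ 4 * δ / (e * lam) := by positivity
    rcases le_or_gt w z with h | h
    · have := hw.1; have := hz.2
      nlinarith
    · have h7 := hgrow z w z1 h w2
      have h8 : w - z ≤ 4 * δ / (e * lam) := by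
        rw [le_div_iff₀ (by positivity)]
        have : 0 ≤ e * lam * (w - z) := mul_nonneg (by positivity) (by linarith)
        nlinarith
      have := hw.1; have := hz.2
      nlinarith
  have hpairs : ((stepPairs S m Q).card : ℝ) ≤ Q * (Q * (-p) * (lam * M) + 4 + 1) := by
    have hL : 0 ≤ Q * (-p) * (lam * M) :=
      mul_nonneg (mul_nonneg (by linarith) (by linarith)) (by positivity)
    refine card_pairs_le (by linarith) (by linarith) (fun w hw => ?_) fun q hq hqQ T hT => ?_
    · obtain ⟨s, _, _, h1, h2, _⟩ := mem_stepPairs.1 hw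
      exact ⟨h1, h2⟩
    · refine card_int_le_of_mem_interval (u := Q * (p * (lam * M)) - 2) (by linarith)
        fun b hb => ?_
      obtain ⟨s, hs, hsq, _, _, _, h1⟩ := mem_stepPairs.1 (hT b hb)
      simp only at hsq h1
      obtain ⟨z, hz, z1, z2, hz3⟩ := hchord s hs q hq hsq
      rw [← h1] at hz3
      have hq1 : (1 : ℝ) ≤ q := by exact_mod_cast hq
      have h2 := hneg z (hM.trans_le z1)
      have h3 : p * (lam * M) ≤ powDeriv c p 1 z := by
        rcases z1.eq_or_lt with h | h
        · rw [← h, hM1]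
        · have h4 := hgrow M z le_rfl h z2
          have : 0 ≤ e * lam * (z - M) := mul_nonneg (by positivity) (by linarith)
          rw [← hM1]; linarith
      have h4 : Q * (p * (lam * M)) ≤ q * powDeriv c p 1 z := by
        have : p * (lam * M) ≤ 0 := mul_nonpos_of_nonpos_of_nonneg hp.le (by positivity)
        nlinarith
      have h5 : q * powDeriv c p 1 z ≤ 0 := mul_nonpos_of_nonneg_of_nonpos (by linarith) h2
      have h6 := abs_le.1 hz3
      constructor <;> nlinarith [h6.1, h6.2]
  have hmain := card_le_card_shortGaps (S := S) (u := M) (L := (κ - 1) * M) (Q := Q) (by linarith)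
    (mul_nonneg (by linarith) hM.le) (fun s hs => ⟨(hS s hs).1.1, by linarith [(hS s hs).1.2]⟩)
  have hx : 0 ≤ δ / lam := by positivity
  have hy : 0 ≤ Q ^ 2 * M * lam := by positivity
  have hMQ : 0 ≤ M / Q := by positivity
  have h1 : (1 + 4 * δ / (e * lam)) + 1 ≤ (2 + 4 / e) * (1 + δ / lam) := by
    have : 4 * δ / (e * lam) = 4 / e * (δ / lam) := by field_simp
    rw [this]
    have : 0 < 4 / e := by positivity
    linarith
  have h2 : Q * (Q * (-p) * (lam * M) + 4 + 1) ≤ (5 - p) * (Q + Q ^ 2 * M * lam) := by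
    have : 0 ≤ -p * Q := mul_nonneg (by linarith) (by linarith)
    linarith
  have h3 : ((shortGaps S Q).card : ℝ) ≤
      ((2 + 4 / e) * (1 + δ / lam)) * ((5 - p) * (Q + Q ^ 2 * M * lam)) :=
    hshort.trans (mul_le_mul h1 (hpairs.trans h2) (by positivity) (by positivity))
  have h4 : (κ - 1) * M / Q = (κ - 1) * (M / Q) := by ring
  have h5 : 0 ≤ (1 + δ / lam) * (Q + Q ^ 2 * M * lam) := by positivity
  have h6 : 0 ≤ (2 + 4 / e) * (5 - p) := mul_nonneg (by positivity) (by linarith)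
  rw [h4] at hmain
  have h7 := mul_nonneg h6 hMQ
  have h8 := mul_nonneg hκ0.le h5
  linarith

/-! ### Midpoints of chords -/

theorem abs_le_of_hasDerivAt {f f' : ℝ → ℝ} {h B : ℝ} (hf0 : f 0 = 0)
    (hf : ∀ y ∈ Set.Icc 0 h, HasDerivAt f (f' y) y) (hB : ∀ y ∈ Set.Icc 0 h, |f' y| ≤ B) :
    ∀ y ∈ Set.Icc 0 h, |f y| ≤ B * h := by
  intro y hy
  have hB0 : 0 ≤ B := (abs_nonneg _).trans (hB y hy)
  have := (convex_Icc (0 : ℝ) h).norm_image_sub_le_of_norm_hasDerivWithin_le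
    (fun z hz => (hf z hz).hasDerivWithinAt) (fun z hz => hB z hz)
    (Set.left_mem_Icc.2 (hy.1.trans hy.2)) hy
  rw [hf0, sub_zero, sub_zero, Real.norm_eq_abs, Real.norm_eq_abs, abs_of_nonneg hy.1] at this
  exact this.trans (by gcongr; exact hy.2)

/-- A chord is parallel to the tangent at its midpoint, up to the third derivative. -/
theorem abs_symm_diff_le {g₀ g₁ g₂ g₃ : ℝ → ℝ} {τ h B : ℝ} (hh : 0 ≤ h)
    (h0 : ∀ y ∈ Set.Icc (τ - h) (τ + h), HasDerivAt g₀ (g₁ y) y)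
    (h1 : ∀ y ∈ Set.Icc (τ - h) (τ + h), HasDerivAt g₁ (g₂ y) y)
    (h2 : ∀ y ∈ Set.Icc (τ - h) (τ + h), HasDerivAt g₂ (g₃ y) y)
    (hB : ∀ y ∈ Set.Icc (τ - h) (τ + h), |g₃ y| ≤ B) :
    |g₀ (τ + h) - g₀ (τ - h) - 2 * h * g₁ τ| ≤ 2 * B * h ^ 3 := by
  have hp : ∀ y ∈ Set.Icc 0 h, τ + y ∈ Set.Icc (τ - h) (τ + h) := fun y hy =>
    ⟨by linarith [hy.1], by linarith [hy.2]⟩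
  have hn : ∀ y ∈ Set.Icc 0 h, τ - y ∈ Set.Icc (τ - h) (τ + h) := fun y hy =>
    ⟨by linarith [hy.2], by linarith [hy.1]⟩
  have hadd : ∀ {g g' : ℝ → ℝ}, (∀ y ∈ Set.Icc (τ - h) (τ + h), HasDerivAt g (g' y) y) →
      ∀ y ∈ Set.Icc 0 h, HasDerivAt (fun y => g (τ + y)) (g' (τ + y)) y := fun hg y hy =>
    (hg _ (hp y hy)).comp_const_add τ y
  have hsub : ∀ {g g' : ℝ → ℝ}, (∀ y ∈ Set.Icc (τ - h) (τ + h), HasDerivAt g (g' y) y) →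
      ∀ y ∈ Set.Icc 0 h, HasDerivAt (fun y => g (τ - y)) (-g' (τ - y)) y := fun hg y hy =>
    (hg _ (hn y hy)).comp_const_sub τ y
  -- The three symmetric combinations in y vanish at y = 0 and each is the derivative of the next,
  -- so the bound on the third derivative is integrated three times.
  have b2 := abs_le_of_hasDerivAt (f := fun y => g₂ (τ + y) - g₂ (τ - y))
    (f' := fun y => g₃ (τ + y) - -g₃ (τ - y)) (h := h) (B := 2 * B) (by simp)
    (fun y hy => (hadd h2 y hy).sub (hsub h2 y hy))
    (fun y hy => by
      have := abs_sub (g₃ (τ + y)) (-g₃ (τ - y))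
      rw [abs_neg] at this
      linarith [hB _ (hp y hy), hB _ (hn y hy)])
  have b1 := abs_le_of_hasDerivAt (f := fun y => g₁ (τ + y) + g₁ (τ - y) - 2 * g₁ τ)
    (f' := fun y => g₂ (τ + y) - g₂ (τ - y)) (h := h) (B := 2 * B * h) (by simp; ring)
    (fun y hy => by
      have := ((hadd h1 y hy).add (hsub h1 y hy)).sub_const (2 * g₁ τ)
      rwa [← sub_eq_add_neg] at this) b2
  have b0 := abs_le_of_hasDerivAt (f := fun y => g₀ (τ + y) - g₀ (τ - y) - 2 * y * g₁ τ)
    (f' := fun y => g₁ (τ + y) + g₁ (τ - y) - 2 * g₁ τ) (h := h) (B := 2 * B * h * h) (by simp)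
    (fun y hy => by
      have := ((hadd h0 y hy).sub (hsub h0 y hy)).sub
        (((hasDerivAt_id y).const_mul 2).mul_const (g₁ τ))
      exact this.congr_deriv (by ring)) b1 h ⟨hh, le_rfl⟩
  calc _ ≤ 2 * B * h * h * h := b0
    _ = _ := by ring

theorem abs_rpow_sub_rpow_le {p a u v : ℝ} (hp : p < 0) (ha : 0 < a) (hu : a ≤ u) (hv : a ≤ v) :
    |u ^ p - v ^ p| ≤ -p * a ^ (p - 1) * |u - v| := by
  have := (convex_Ici a).norm_image_sub_le_of_norm_hasDerivWithin_le
    (f := fun t : ℝ => t ^ p) (f' := fun t => p * t ^ (p - 1)) (C := -p * a ^ (p - 1))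
    (fun z hz => (Real.hasDerivAt_rpow_const (Or.inl (ha.trans_le hz).ne')).hasDerivWithinAt)
    (fun z hz => by
      rw [Real.norm_eq_abs, abs_mul, abs_of_neg hp,
        abs_of_pos (Real.rpow_pos_of_pos (ha.trans_le hz) _)]
      have := Real.rpow_le_rpow_of_nonpos ha (show a ≤ z from hz) (by linarith : p - 1 ≤ 0)
      exact mul_le_mul_of_nonneg_left this (by linarith)) hv hu
  simpa using this

/-- The midpoint of a chord between two integer points near the curve `y = K M^(β+1) t^(-β)` is
almost determined by the direction of the chord. -/
theorem midpoint_of_chord (β : ℝ) (hβ : 0 < β) {κ C₀ : ℝ} (hκ : 1 ≤ κ) (hC₀ : 0 ≤ C₀) :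
    ∃ k₁ > 0, ∃ k₂ > 0, ∃ C₁ > 0, ∃ M₀ > 0, ∀ (K M s q b : ℝ), 1 ≤ K → M₀ ≤ M → 1 ≤ q → M ≤ s →
      s + q ≤ κ * M →
      |K * M ^ (β + 1) * s ^ (-β) - K * M ^ (β + 1) * (s + q) ^ (-β) - b| ≤ C₀ * (K / M) →
      k₁ * (K * q) ≤ b ∧ b ≤ k₂ * (K * q) ∧
      |2 * s + q - 2 * (M * (β * K) ^ (1 / (β + 1)) * (b / q) ^ (-(1 / (β + 1))))| ≤
        C₁ * (1 / q + q ^ 2 / M) := by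
  have hκ0 : 0 < κ := by linarith
  set γ := 1 / (β + 1) with hγ
  have hγ0 : 0 < γ := by positivity
  set l := β * κ ^ (-β - 1) with hl
  have hl0 : 0 < l := by positivity
  set B₃ := β * (β + 1) * (β + 2) with hB₃
  have hB₃0 : 0 < B₃ := by positivity
  set T := 2 * (γ * β ^ γ * (l / 2) ^ (-γ - 1)) with hT
  have hT0 : 0 < T := by positivity
  -- M₀ puts C₀/M below both l/2 and β. As minus the derivative lies between lK and βK, the
  -- closeness error cannot spoil the two-sided bound b ≍ Kq.
  refine ⟨l / 2, by positivity, 2 * β, by positivity, T * (C₀ + B₃), by positivity,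
    2 * C₀ / l + C₀ / β + 1, by positivity, ?_⟩
  intro K M s q b hK hM hq hs hsq hb
  have hM1 : 1 ≤ M := by
    have : 0 ≤ 2 * C₀ / l + C₀ / β := by positivity
    linarith
  have hM0 : 0 < M := by linarith
  have hK0 : 0 < K := by linarith
  have hq0 : 0 < q := by linarith
  have hs0 : 0 < s := by linarith
  have hMl : C₀ / M ≤ l / 2 := by
    rw [div_le_iff₀ hM0]
    have h1 : 2 * C₀ / l ≤ M := by
      have : 0 ≤ C₀ / β := by positivity
      linarith
    rw [div_le_iff₀ hl0] at h1
    linarith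
  have hMβ : C₀ / M ≤ β := by
    rw [div_le_iff₀ hM0]
    have h1 : C₀ / β ≤ M := by
      have : 0 ≤ 2 * C₀ / l := by positivity
      linarith
    rw [div_le_iff₀ hβ] at h1
    linarith
  set c := K * M ^ (β + 1) with hc
  have hc0 : 0 < c := by positivity
  have hcpow : ∀ e : ℝ, c * M ^ (-β - 1 + e) = K * M ^ e := by
    intro e
    rw [hc, mul_assoc, ← Real.rpow_add hM0]
    congr 2; ring
  have hd1 : ∀ z, powDeriv c (-β) 1 z = -(β * (c * z ^ (-β - 1))) := by
    intro z
    simp only [powDeriv, Finset.prod_range_one, Nat.cast_zero, sub_zero, Nat.cast_one]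
    ring
  have hbd : ∀ z, M ≤ z → z ≤ κ * M → l * K ≤ β * (c * z ^ (-β - 1)) ∧
      β * (c * z ^ (-β - 1)) ≤ β * K := by
    intro z hz hz2
    have h0 := hcpow 0
    rw [add_zero, Real.rpow_zero, mul_one] at h0
    have h1 : z ^ (-β - 1) ≤ M ^ (-β - 1) := Real.rpow_le_rpow_of_nonpos hM0 hz (by linarith)
    have h2 : κ ^ (-β - 1) * M ^ (-β - 1) ≤ z ^ (-β - 1) := by
      rw [← Real.mul_rpow hκ0.le hM0.le]
      exact Real.rpow_le_rpow_of_nonpos (hM0.trans_le hz) hz2 (by linarith)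
    constructor
    · calc l * K = β * (c * (κ ^ (-β - 1) * M ^ (-β - 1))) := by rw [hl, ← h0]; ring
        _ ≤ _ := by gcongr
    · calc β * (c * z ^ (-β - 1)) ≤ β * (c * M ^ (-β - 1)) := by gcongr
        _ = _ := by rw [h0]
  -- the size of `b`
  obtain ⟨z, hz, hzc⟩ := exists_chord_slope c (-β) hs0 hq0
  rw [hd1] at hzc
  have hzb := hbd z (hs.trans hz.1.le) (hz.2.le.trans hsq)
  have hb' := abs_le.1 hb
  have hKM : C₀ * (K / M) = C₀ / M * K := by ring
  have hKq : K ≤ K * q := le_mul_of_one_le_right hK0.le hq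
  have hb1 : l / 2 * (K * q) ≤ b := by
    have h1 : l * (K * q) ≤ q * (β * (c * z ^ (-β - 1))) := by nlinarith [hzb.1]
    have h2 : C₀ / M * K ≤ l / 2 * (K * q) := by gcongr
    linarith [hb'.1, hb'.2]
  have hb2 : b ≤ 2 * β * (K * q) := by
    have h1 : q * (β * (c * z ^ (-β - 1))) ≤ β * (K * q) := by nlinarith [hzb.2]
    have h2 : C₀ / M * K ≤ β * (K * q) := by gcongr
    linarith [hb'.1, hb'.2]
  refine ⟨hb1, hb2, ?_⟩
  -- the slope at the midpoint
  set τ := s + q / 2 with hτ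
  have hτ0 : 0 < τ := by positivity
  set u := β * (c * τ ^ (-β - 1)) with hu
  have hub := hbd τ (by linarith) (by linarith)
  have hpos : ∀ y ∈ Set.Icc (τ - q / 2) (τ + q / 2), M ≤ y := fun y hy => by
    have := hy.1; linarith
  have hsym := abs_symm_diff_le (g₀ := powDeriv c (-β) 0) (g₁ := powDeriv c (-β) 1)
    (g₂ := powDeriv c (-β) 2) (g₃ := powDeriv c (-β) 3) (τ := τ) (h := q / 2)
    (B := B₃ * (K / M ^ 2)) (by positivity)
    (fun y hy => hasDerivAt_powDeriv c (-β) 0 (hM0.trans_le (hpos y hy)))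
    (fun y hy => hasDerivAt_powDeriv c (-β) 1 (hM0.trans_le (hpos y hy)))
    (fun y hy => hasDerivAt_powDeriv c (-β) 2 (hM0.trans_le (hpos y hy)))
    (fun y hy => by
      have hy0 := hM0.trans_le (hpos y hy)
      have h1 : powDeriv c (-β) 3 y = -(B₃ * (c * y ^ (-β - 3))) := by
        simp only [powDeriv, Finset.prod_range_succ, Finset.prod_range_zero, Nat.cast_zero,
          Nat.cast_one, Nat.cast_ofNat]
        rw [hB₃]; ring
      rw [h1, abs_neg, abs_of_nonneg (by positivity)]
      have h2 : y ^ (-β - 3) ≤ M ^ (-β - 3) :=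
        Real.rpow_le_rpow_of_nonpos hM0 (hpos y hy) (by linarith)
      have h3 := hcpow (-2)
      have h4 : M ^ (-2 : ℝ) = 1 / M ^ 2 := by
        rw [Real.rpow_neg hM0.le, one_div]; norm_cast
      have h5 : (-β - 1 + -2 : ℝ) = -β - 3 := by ring
      rw [h4, h5] at h3
      calc B₃ * (c * y ^ (-β - 3)) ≤ B₃ * (c * M ^ (-β - 3)) := by gcongr
        _ = _ := by rw [h3]; ring)
  have e1 : τ + q / 2 = s + q := by rw [hτ]; ring
  have e2 : τ - q / 2 = s := by rw [hτ]; ring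
  rw [e1, e2, powDeriv_zero, powDeriv_zero, hd1, ← hu] at hsym
  have hub1 : |u - b / q| ≤ (C₀ + B₃) * (K / M) * (1 / q + q ^ 2 / M) := by
    have h1 : |q * u - b| ≤ C₀ * (K / M) + 2 * (B₃ * (K / M ^ 2)) * (q / 2) ^ 3 := by
      have e3 : q * u - b = (c * s ^ (-β) - c * (s + q) ^ (-β) - b) +
        (c * (s + q) ^ (-β) - c * s ^ (-β) - 2 * (q / 2) * -u) := by ring
      rw [e3]
      exact (abs_add_le _ _).trans (add_le_add hb hsym)
    have h2 : u - b / q = (q * u - b) / q := by field_simp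
    rw [h2, abs_div, abs_of_pos hq0, div_le_iff₀ hq0]
    refine h1.trans ?_
    have e4 : (C₀ + B₃) * (K / M) * (1 / q + q ^ 2 / M) * q =
        C₀ * (K / M) + B₃ * (K / M) + C₀ * (K / M) * (q ^ 3 / M) + B₃ * (K / M ^ 2) * q ^ 3 := by
      field_simp
      ring
    rw [e4]
    have h3 : 0 ≤ B₃ * (K / M) := by positivity
    have h4 : 0 ≤ C₀ * (K / M) * (q ^ 3 / M) := by positivity
    have h5 : 0 ≤ B₃ * (K / M ^ 2) * q ^ 3 := by positivity
    have e5 : 2 * (B₃ * (K / M ^ 2)) * (q / 2) ^ 3 = B₃ * (K / M ^ 2) * q ^ 3 / 4 := by ring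
    rw [e5]; linarith
  -- pass to the inverse function of the derivative
  have htau : M * (β * K) ^ γ * u ^ (-γ) = τ := by
    have h1 : u = (β * K) * (M ^ (β + 1) * τ ^ (-β - 1)) := by rw [hu, hc]; ring
    have h2 : M ^ (β + 1) * τ ^ (-β - 1) = (M / τ) ^ (β + 1) := by
      rw [Real.div_rpow hM0.le hτ0.le, div_eq_mul_inv, ← Real.rpow_neg hτ0.le]; congr 2; ring
    rw [h1, h2, Real.mul_rpow (y := (M / τ) ^ (β + 1)) (by positivity) (by positivity), ← Real.rpow_mul (by positivity),
      Real.rpow_neg (by positivity)]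
    have h3 : (β + 1) * -γ = -1 := by rw [hγ]; field_simp
    rw [h3, Real.rpow_neg_one]
    have h4 : (β * K) ^ γ ≠ 0 := by positivity
    field_simp
  have hbq : l / 2 * K ≤ b / q := by
    rw [le_div_iff₀ hq0]; linarith
  have hul : l / 2 * K ≤ u := by
    have := hub.1
    have : 0 < l * K := by positivity
    linarith
  have hr := abs_rpow_sub_rpow_le (p := -γ) (by linarith) (by positivity : 0 < l / 2 * K) hul hbq
  have e6 : 2 * s + q - 2 * (M * (β * K) ^ γ * (b / q) ^ (-γ)) =
      2 * (M * (β * K) ^ γ) * (u ^ (-γ) - (b / q) ^ (-γ)) := by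
    have : 2 * s + q = 2 * τ := by rw [hτ]; ring
    rw [this, ← htau]; ring
  rw [e6, abs_mul, abs_of_pos (by positivity)]
  have e7 : K ^ γ * K ^ (-γ - 1) = K⁻¹ := by
    rw [← Real.rpow_add hK0, ← Real.rpow_neg_one]; congr 1; ring
  calc 2 * (M * (β * K) ^ γ) * |u ^ (-γ) - (b / q) ^ (-γ)|
      ≤ 2 * (M * (β * K) ^ γ) * (- -γ * (l / 2 * K) ^ (-γ - 1) *
        ((C₀ + B₃) * (K / M) * (1 / q + q ^ 2 / M))) := by
          refine mul_le_mul_of_nonneg_left (hr.trans ?_) (by positivity)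
          refine mul_le_mul_of_nonneg_left hub1 ?_
          rw [neg_neg]; positivity
    _ = T * (C₀ + B₃) * (1 / q + q ^ 2 / M) * ((K ^ γ * K ^ (-γ - 1)) * K) := by
          rw [Real.mul_rpow hβ.le hK0.le, Real.mul_rpow (by positivity) hK0.le, hT]
          field_simp
    _ = _ := by rw [e7, inv_mul_cancel₀ hK0.ne', mul_one]

/-! ### From points near a curve to pairs (gap, increment) -/

set_option maxHeartbeats 1000000 in
/-- Reduction of the count of integer points near `y = K M^(β+1) t^(-β)`, where `M = G^3 K`, to
a count of pairs (gap, increment) at which another power function is nearly an integer. -/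
theorem exists_stepPairs (β : ℝ) (hβ : 0 < β) {κ C₀ : ℝ} (hκ : 1 ≤ κ) (hC₀ : 0 ≤ C₀) :
    ∃ A > 0, ∃ k₁ > 0, ∃ k₂ > 0, ∃ C₁ > 0, ∀ (K G w M : ℝ) (S : Finset ℕ) (m : ℕ → ℤ),
      1 ≤ K → 1 ≤ w → w ^ 2 ≤ G → M = G ^ 3 * K →
      (∀ s ∈ S, (s : ℝ) ∈ Set.Icc M (κ * M) ∧
        |K * M ^ (β + 1) * (s : ℝ) ^ (-β) + m s| ≤ C₀ * (K / M)) →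
      ∃ W : Finset (ℕ × ℤ), (∀ x ∈ W, G / w < x.1 ∧ (x.1 : ℝ) ≤ G * w ∧ k₁ * (K * x.1) ≤ x.2 ∧
        (x.2 : ℝ) ≤ k₂ * (K * x.1) ∧ ∃ z : ℤ,
          |2 * (M * (β * K) ^ (1 / (β + 1)) * (x.2 / x.1 : ℝ) ^ (-(1 / (β + 1)))) - z| ≤
            C₁ * (w ^ 2 / G)) ∧
        (S.card : ℝ) ≤ A * (K * G ^ 2 / w + W.card) := by
  classical
  obtain ⟨k₁, hk₁, k₂, hk₂, C₁, hC₁, M₀, hM₀, hmid⟩ :=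
    midpoint_of_chord β hβ hκ (C₀ := 2 * C₀) (by positivity)
  set Λ := C₁ * (1 + κ) with hΛ
  have hκ0 : 0 < κ := by linarith
  have hΛ0 : 0 < Λ := by positivity
  refine ⟨κ * M₀ ^ 2 + κ + (Λ + 1) * (k₂ + 2), by positivity, k₁, hk₁, k₂, hk₂, 2 * C₁,
    by positivity, ?_⟩
  intro K G w M S m hK hw hwG hM hS
  have hw0 : 0 < w := by linarith
  have hwG' : w ≤ G := by nlinarith
  have hG : 1 ≤ G := hw.trans hwG'
  have hG0 : 0 < G := by linarith
  have hK0 : 0 < K := by linarith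
  have hM1 : 1 ≤ M := by
    rw [hM]; exact one_le_mul_of_one_le_of_one_le (one_le_pow₀ hG) hK
  have hM0 : 0 < M := by linarith
  set Y := K * G ^ 2 / w with hY
  have hY1 : 1 ≤ Y := by
    rw [hY, le_div_iff₀ hw0]; nlinarith
  have hSint : ∀ s ∈ S, M ≤ s ∧ (s : ℝ) ≤ M + (κ - 1) * M := fun s hs =>
    ⟨(hS s hs).1.1, by linarith [(hS s hs).1.2]⟩
  have hκM : 0 ≤ (κ - 1) * M := mul_nonneg (by linarith) hM0.le
  -- Below the threshold M₀ the factor Gw is bounded by M₀², so the trivial count O(M) is already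
  -- O(KG²/w).
  rcases lt_or_ge M M₀ with hlt | hge
  · refine ⟨∅, by simp, ?_⟩
    have h1 := card_le_of_separated (T := S) (q := 1) one_pos hκM hSint
      (fun s _ t _ hst => by exact_mod_cast hst)
    have hGM : G ≤ M := by
      rw [hM]
      nlinarith [one_le_pow₀ hG (n := 2), mul_le_mul (one_le_pow₀ hG (n := 2)) hK zero_le_one
        (by positivity)]
    have h2 : M ≤ M₀ ^ 2 * Y := by
      have : M = G * w * Y := by rw [hM, hY]; field_simp
      rw [this]
      have : G * w ≤ M₀ ^ 2 := by nlinarith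
      gcongr
    have h3 : (S.card : ℝ) ≤ κ * M := by linarith
    simp only [Finset.card_empty, Nat.cast_zero, add_zero]
    have h4 : 0 ≤ (κ + (Λ + 1) * (k₂ + 2)) * Y := by positivity
    nlinarith
  · set P := stepPairs S m (G * w) with hP
    have hstep : ∀ s ∈ S, ∀ q : ℕ, 0 < q → s + q ∈ S →
        k₁ * (K * q) ≤ (m (s + q) - m s : ℤ) ∧ ((m (s + q) - m s : ℤ) : ℝ) ≤ k₂ * (K * q) ∧
        |2 * (s : ℝ) + q - 2 * (M * (β * K) ^ (1 / (β + 1)) *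
          (((m (s + q) - m s : ℤ) : ℝ) / q) ^ (-(1 / (β + 1))))| ≤ C₁ * (1 / q + q ^ 2 / M) ∧
        (q : ℝ) ≤ κ * M := by
      intro s hs q hq hsq
      obtain ⟨h1, h2⟩ := hS s hs
      obtain ⟨h3, h4⟩ := hS _ hsq
      push_cast at h3 h4
      obtain ⟨h5, h6, h7⟩ := hmid K M s q (m (s + q) - m s : ℤ) hK hge (by exact_mod_cast hq) h1.1
        h3.2 (by
          push_cast
          have e : K * M ^ (β + 1) * (s : ℝ) ^ (-β) - K * M ^ (β + 1) * ((s : ℝ) + q) ^ (-β) -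
            (m (s + q) - m s) = (K * M ^ (β + 1) * (s : ℝ) ^ (-β) + m s) -
            (K * M ^ (β + 1) * ((s : ℝ) + q) ^ (-β) + m (s + q)) := by ring
          rw [e]
          refine (abs_sub _ _).trans ?_
          linarith)
      exact ⟨h5, h6, h7, by have := h3.2; have : (0 : ℝ) ≤ s := Nat.cast_nonneg s; linarith⟩
    have hshort : ((shortGaps S (G * w)).card : ℝ) ≤ (Λ + 1) * P.card := by
      refine card_shortGaps_le hΛ0.le ?_
      intro s hs t ht q hq _ hsq htq _ hb
      obtain ⟨-, -, h1, h2⟩ := hstep s hs q hq hsq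
      obtain ⟨-, -, h3, -⟩ := hstep t ht q hq htq
      rw [← hb] at h3
      have hq1 : (1 : ℝ) ≤ q := by exact_mod_cast hq
      have h4 : C₁ * (1 / q + q ^ 2 / M) ≤ Λ * q := by
        rw [hΛ, mul_assoc]
        refine mul_le_mul_of_nonneg_left ?_ hC₁.le
        have h5 : 1 / (q : ℝ) ≤ q := by
          rw [div_le_iff₀ (by linarith)]; nlinarith
        have h6 : (q : ℝ) ^ 2 / M ≤ κ * q := by
          rw [div_le_iff₀ hM0]; nlinarith
        linarith
      have h5 := abs_le.1 (h1.trans h4)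
      have h6 := abs_le.1 (h3.trans h4)
      linarith [h5.1, h5.2, h6.1, h6.2]
    have hPm : ∀ x ∈ P, 0 < x.1 ∧ (x.1 : ℝ) ≤ G * w ∧ k₁ * (K * x.1) ≤ x.2 ∧
        (x.2 : ℝ) ≤ k₂ * (K * x.1) ∧ ∃ z : ℤ,
          |2 * (M * (β * K) ^ (1 / (β + 1)) * (x.2 / x.1 : ℝ) ^ (-(1 / (β + 1)))) - z| ≤
            C₁ * (1 / x.1 + (x.1 : ℝ) ^ 2 / M) := by
      rintro ⟨q, b⟩ hx
      obtain ⟨s, hs, hsq, h1, h2, -, h3⟩ := mem_stepPairs.1 hx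
      dsimp only at hsq h1 h2 h3 ⊢
      obtain ⟨h4, h5, h6, -⟩ := hstep s hs q h1 hsq
      rw [← h3] at h4 h5 h6
      -- The arithmetic input: twice the midpoint of the chord is an integer.
      refine ⟨h1, h2, h4, h5, 2 * s + q, ?_⟩
      rw [abs_sub_comm]
      push_cast
      exact h6
    -- Gaps above Gw number O(M/(Gw)) = O(KG²/w), and pairs with q ≤ G/w number O(KG²/w) since b =
    -- O(Kq). Only the intermediate pairs are left to count.
    refine ⟨P.filter fun x => G / w < x.1, fun x hx => ?_, ?_⟩
    · rw [Finset.mem_filter] at hx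
      obtain ⟨h1, h2, h3, h4, z, h5⟩ := hPm x hx.1
      refine ⟨hx.2, h2, h3, h4, z, h5.trans ?_⟩
      have hx0 : (0 : ℝ) < x.1 := by exact_mod_cast h1
      have h6 : 1 / (x.1 : ℝ) ≤ w ^ 2 / G := by
        rw [div_le_div_iff₀ hx0 hG0]
        have := (div_lt_iff₀ hw0).1 hx.2
        nlinarith
      have h7 : (x.1 : ℝ) ^ 2 / M ≤ w ^ 2 / G := by
        rw [div_le_div_iff₀ hM0 hG0, hM]
        calc (x.1 : ℝ) ^ 2 * G ≤ (G * w) ^ 2 * G := by gcongr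
          _ = w ^ 2 * (G ^ 3 * 1) := by ring
          _ ≤ w ^ 2 * (G ^ 3 * K) := by gcongr
      calc C₁ * (1 / x.1 + (x.1 : ℝ) ^ 2 / M) ≤ C₁ * (w ^ 2 / G + w ^ 2 / G) := by gcongr
        _ = _ := by ring
    · have h1 := card_le_card_shortGaps (S := S) (u := M) (Q := G * w) (by positivity) hκM hSint
      have hsmall : ((P.filter fun x => ¬ G / w < x.1).card : ℝ) ≤
          G / w * (k₂ * (K * (G / w)) + 1) := by
        refine card_pairs_le (by positivity) (by positivity) (fun x hx => ?_) fun q hq hqG T hT => ?_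
        · rw [Finset.mem_filter] at hx
          exact ⟨(hPm x hx.1).1, not_lt.1 hx.2⟩
        · refine card_int_le_of_mem_interval (u := 0) (by positivity) fun b hb => ?_
          obtain ⟨h2, h3, h4, h5, -⟩ := hPm _ (Finset.mem_filter.1 (hT b hb)).1
          dsimp only at h2 h3 h4 h5
          refine ⟨le_trans (by positivity) h4, ?_⟩
          rw [zero_add]
          refine h5.trans ?_
          gcongr
      have h2 : G / w * (k₂ * (K * (G / w)) + 1) ≤ (k₂ + 1) * Y := by
        have h3 : 1 ≤ G / w := by rwa [le_div_iff₀ hw0, one_mul]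
        have h4 : G / w ≤ K * G := by
          rw [div_le_iff₀ hw0]; nlinarith [mul_le_mul hK hw zero_le_one hK0.le]
        have h5 : Y = (K * G) * (G / w) := by rw [hY]; ring
        have h6 : K * (G / w) ≤ K * G := by gcongr; exact div_le_self hG0.le hw
        have h7 : 1 ≤ K * G := h3.trans h4
        have h8 : k₂ * (K * (G / w)) + 1 ≤ (k₂ + 1) * (K * G) := by nlinarith
        calc _ ≤ G / w * ((k₂ + 1) * (K * G)) := by gcongr
          _ = _ := by rw [h5]; ring
      have h3 : (κ - 1) * M / (G * w) = (κ - 1) * Y := by rw [hM, hY]; field_simp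
      have h4 := Finset.card_filter_add_card_filter_not (s := P) (fun x => G / w < x.1)
      have h5 : ((P.filter fun x => G / w < x.1).card : ℝ) +
        (P.filter fun x => ¬ G / w < x.1).card = P.card := by exact_mod_cast h4
      set n := ((P.filter fun x => G / w < x.1).card : ℝ)
      have hn : 0 ≤ n := Nat.cast_nonneg _
      rw [h3] at h1
      have h6 : (P.card : ℝ) ≤ n + (k₂ + 1) * Y := by linarith
      have h7 : (Λ + 1) * (P.card : ℝ) ≤ (Λ + 1) * (n + (k₂ + 1) * Y) := by gcongr
      have h8 : 0 ≤ κ * M₀ ^ 2 * (Y + n) + κ * n + (Λ + 1) * (k₂ + 1) * n + (Λ + 1) * Y := by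
        positivity
      have h9 : (S.card : ℝ) ≤ (κ - 1) * Y + 1 + (Λ + 1) * (n + (k₂ + 1) * Y) := by linarith
      linarith

/-! ### Counting the pairs in the two ranges K ≤ G and G ≤ K -/

theorem card_image_toNat {T : Finset ℤ} (hT : ∀ b ∈ T, 0 ≤ b) :
    (T.image Int.toNat).card = T.card := by
  refine Finset.card_image_of_injOn fun a ha b hb hab => ?_
  have h1 := Int.toNat_of_nonneg (hT a ha)
  have h2 := Int.toNat_of_nonneg (hT b hb)
  rw [← h1, ← h2]
  exact congrArg _ hab

/-- Integer points near `y = K M^(β+1) t^(-β)`, `M = G^3 K`: gain of a factor `w` over the bound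
`K G^2` when `K ≤ G`. -/
theorem card_near_curve_of_le (β : ℝ) (hβ : 0 < β) {κ C₀ : ℝ} (hκ : 1 ≤ κ) (hC₀ : 0 ≤ C₀) :
    ∃ A > 0, ∀ (K G w M : ℝ) (S : Finset ℕ) (m : ℕ → ℤ),
      1 ≤ K → 1 ≤ w → w ^ 40 ≤ K → w ^ 40 * K ≤ G → M = G ^ 3 * K →
      (∀ s ∈ S, (s : ℝ) ∈ Set.Icc M (κ * M) ∧
        |K * M ^ (β + 1) * (s : ℝ) ^ (-β) + m s| ≤ C₀ * (K / M)) →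
      (S.card : ℝ) ≤ A * (K * G ^ 2 / w) := by
  classical
  obtain ⟨A, hA, k₁, hk₁, k₂, hk₂, C₁, hC₁, hred⟩ := exists_stepPairs β hβ hκ hC₀
  set γ := 1 / (β + 1) with hγ
  have hγ0 : 0 < γ := by positivity
  have hγ1 : γ < 1 := by rw [hγ, div_lt_one (by linarith)]; linarith
  set κ' := max 1 (k₂ / k₁) with hκ'
  have hκ'1 : 1 ≤ κ' := le_max_left _ _
  have hκ'0 : 0 < κ' := by linarith
  set C₃ := 2 * (β / k₂) ^ γ with hC₃
  have hC₃0 : 0 < C₃ := by positivity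
  -- For fixed b the function of q has third derivative of order M/G³ = K, which is not small, but
  -- fourth derivative of order K/G (up to powers of w). Hence five points.
  obtain ⟨A₄, hA₄, hcount⟩ := card_pow_near_int 4 (by norm_num) γ (by
      intro i _
      rcases Nat.eq_zero_or_pos i with h | h
      · rw [h, Nat.cast_zero]; exact hγ0.ne'
      · have : (1 : ℝ) ≤ i := by exact_mod_cast h
        exact (hγ1.trans_le this).ne) (by push_cast; linarith) hκ'1
    (C' := C₁ / C₃) (by positivity)
  set C₅ := (C₃ * κ' ^ 4) ^ (1 / 10 : ℝ) with hC₅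
  have hC₅0 : 0 < C₅ := by positivity
  refine ⟨A * (1 + k₂ * (A₄ * (C₅ + 1))), by positivity, ?_⟩
  intro K G w M S m hK hw hwK hwG hM hS
  have hw0 : 0 < w := by linarith
  have hK0 : 0 < K := by linarith
  have hw40 : 1 ≤ w ^ 40 := one_le_pow₀ hw
  have hw2 : w ^ 2 ≤ G :=
    calc w ^ 2 ≤ w ^ 40 := pow_le_pow_right₀ hw (by norm_num)
      _ ≤ w ^ 40 * K := le_mul_of_one_le_right (by linarith) hK
      _ ≤ G := hwG
  have hG0 : 0 < G := lt_of_lt_of_le (by positivity) hw2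
  have hM0 : 0 < M := by rw [hM]; positivity
  obtain ⟨W, hW, hcard⟩ := hred K G w M S m hK hw hw2 hM hS
  have hWpos : ∀ x ∈ W, 0 < x.2 := by
    intro x hx
    obtain ⟨h1, -, h2, -⟩ := hW x hx
    have h3 : (0 : ℝ) < x.1 := lt_trans (by positivity) h1
    have h4 : (0 : ℝ) < x.2 := lt_of_lt_of_le (by positivity) h2
    exact_mod_cast h4
  have hWcard : (W.card : ℝ) ≤ k₂ * (K * (G * w)) * (A₄ * (C₅ + 1) * (G / w ^ 2)) := by
    -- Coordinates are exchanged so that the fibres are taken over b.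
    set W' := W.image fun x => (x.2.toNat, (x.1 : ℤ)) with hW'
    have hc : W'.card = W.card := by
      refine Finset.card_image_of_injOn fun x hx y hy hxy => ?_
      simp only [Prod.mk.injEq, Nat.cast_inj] at hxy
      have h1 := Int.toNat_of_nonneg (hWpos x hx).le
      have h2 := Int.toNat_of_nonneg (hWpos y hy).le
      ext
      · exact hxy.2
      · rw [← h1, ← h2, hxy.1]
    rw [← hc]
    have hW'm : ∀ (b : ℕ) (q : ℤ), (b, q) ∈ W' → 0 ≤ q ∧ (q.toNat, (b : ℤ)) ∈ W := by
      intro b q h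
      obtain ⟨x, hx, hxe⟩ := Finset.mem_image.1 h
      simp only [Prod.mk.injEq] at hxe
      refine ⟨by omega, ?_⟩
      have h1 := Int.toNat_of_nonneg (hWpos x hx).le
      rw [← hxe.1, ← hxe.2, h1, Int.toNat_natCast]
      exact hx
    refine card_pairs_le (by positivity) (by positivity) (fun x hx => ?_) fun b hb _ T hT => ?_
    · obtain ⟨-, h2⟩ := hW'm x.1 x.2 hx
      have h3 := hWpos _ h2
      obtain ⟨-, h4, -, h5, -⟩ := hW _ h2
      dsimp only at h3 h4 h5
      refine ⟨by exact_mod_cast h3, ?_⟩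
      push_cast at h5
      exact h5.trans (by gcongr)
    · rcases T.eq_empty_or_nonempty with h0 | ⟨q₀, hq₀⟩
      · rw [h0]; simp; positivity
      rw [← card_image_toNat fun q hq => (hW'm b q (hT q hq)).1]
      have hb0 : (0 : ℝ) < b := by exact_mod_cast hb
      set N := b / (k₂ * K) with hN
      have hN0 : 0 < N := by positivity
      set c := 2 * (M * (β * K) ^ γ * (b : ℝ) ^ (-γ)) with hcdef
      have hTm : ∀ q ∈ T.image Int.toNat, G / w < q ∧ (q : ℝ) ≤ G * w ∧ N ≤ q ∧
          (q : ℝ) ≤ κ' * N ∧ ∃ z : ℤ, |c * (q : ℝ) ^ γ - z| ≤ C₁ * (w ^ 2 / G) := by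
        intro q hq
        obtain ⟨q', hq', rfl⟩ := Finset.mem_image.1 hq
        obtain ⟨-, h1⟩ := hW'm b q' (hT q' hq')
        obtain ⟨h2, h3, h4, h5, z, h6⟩ := hW _ h1
        dsimp only at h2 h3 h4 h5 h6
        push_cast at h4 h5 h6
        have hq0 : (0 : ℝ) < (q'.toNat : ℕ) := lt_trans (by positivity) h2
        refine ⟨h2, h3, ?_, ?_, z, ?_⟩
        · rw [hN, div_le_iff₀ (by positivity)]
          linarith
        · calc ((q'.toNat : ℕ) : ℝ) ≤ b / (k₁ * K) := by
                rw [le_div_iff₀ (by positivity)]; linarith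
            _ = k₂ / k₁ * N := by rw [hN]; field_simp
            _ ≤ κ' * N := by gcongr; exact le_max_right _ _
        · have : c * ((q'.toNat : ℕ) : ℝ) ^ γ =
              2 * (M * (β * K) ^ γ * ((b : ℝ) / (q'.toNat : ℕ)) ^ (-γ)) := by
            rw [hcdef, Real.div_rpow hb0.le hq0.le, Real.rpow_neg hq0.le, div_inv_eq_mul]
            ring
          rw [this]
          exact h6
      have hlam : c * N ^ (γ - 4) = C₃ * (M / N ^ 4) := by
        have h1 : N ^ (γ - 4) = N ^ γ / N ^ 4 := by
          rw [Real.rpow_sub hN0]; norm_cast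
        have h2 : (β * K) ^ γ * (b : ℝ) ^ (-γ) * N ^ γ = (β / k₂) ^ γ := by
          rw [Real.rpow_neg hb0.le, ← div_eq_mul_inv, ← Real.div_rpow (by positivity) hb0.le,
            ← Real.mul_rpow (by positivity) hN0.le]
          congr 1
          rw [hN]; field_simp
        rw [h1, hC₃, ← h2, hcdef]; ring
      obtain ⟨a1, a2, a3, a4, -⟩ := hTm _ (Finset.mem_image_of_mem _ hq₀)
      have hNup : N ≤ G * w := a3.trans a2
      have hNlow : G / (w * κ') ≤ N := by
        rw [div_le_iff₀ (by positivity)]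
        have := (div_lt_iff₀ hw0).1 (a1.trans_le a4)
        linarith
      -- The closeness w²/G must not exceed the fourth derivative, at least of order K/(w⁴G): this
      -- needs w⁶ ≤ K.
      have hδ : C₁ * (w ^ 2 / G) ≤ C₁ / C₃ * (c * N ^ (γ - (4 : ℕ))) := by
        push_cast
        rw [hlam]
        have e : C₁ / C₃ * (C₃ * (M / N ^ 4)) = C₁ * (M / N ^ 4) := by field_simp
        rw [e]
        refine mul_le_mul_of_nonneg_left ?_ hC₁.le
        calc w ^ 2 / G ≤ (K / w ^ 4) / G := by
              rw [div_le_div_iff_of_pos_right hG0, le_div_iff₀ (by positivity), ← pow_add]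
              exact (pow_le_pow_right₀ hw (by norm_num)).trans hwK
          _ = M / (G * w) ^ 4 := by rw [hM]; field_simp
          _ ≤ M / N ^ 4 := by gcongr
      have hex : ∀ q : ℕ, ∃ z : ℤ, q ∈ T.image Int.toNat →
          |c * (q : ℝ) ^ γ - z| ≤ C₁ * (w ^ 2 / G) := by
        intro q
        by_cases h : q ∈ T.image Int.toNat
        · obtain ⟨-, -, -, -, z, hz⟩ := hTm q h
          exact ⟨z, fun _ => hz⟩
        · exact ⟨0, fun h' => absurd h' h⟩
      choose z hz using hex
      have hfin := hcount c N (C₁ * (w ^ 2 / G)) (T.image Int.toNat) z (by positivity) hN0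
        (by positivity) hδ (fun q hq => ⟨⟨(hTm q hq).2.2.1, (hTm q hq).2.2.2.1⟩, hz q hq⟩)
      have hE : (∑ a ∈ Finset.range (4 + 1), a : ℕ) = 10 := rfl
      rw [hE] at hfin
      push_cast at hfin
      rw [hlam] at hfin
      -- The exponent 1/10 is 1/(1+2+3+4). A saving of w³ here needs w³⁴K ≤ G, so the hypothesis
      -- with 40 leaves room; one factor w is spent on the range of q and one on that of b.
      have hpow : (C₃ * (M / N ^ 4)) ^ (1 / 10 : ℝ) ≤ C₅ / w ^ 3 := by
        have h1 : C₃ * (M / N ^ 4) ≤ C₃ * κ' ^ 4 / (w ^ 3) ^ 10 := by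
          calc C₃ * (M / N ^ 4) ≤ C₃ * (M / (G / (w * κ')) ^ 4) := by gcongr
            _ = C₃ * κ' ^ 4 * (w ^ 4 * K / G) := by rw [hM]; field_simp
            _ ≤ C₃ * κ' ^ 4 * (1 / (w ^ 3) ^ 10) := by
              refine mul_le_mul_of_nonneg_left ?_ (by positivity)
              rw [div_le_div_iff₀ hG0 (by positivity)]
              calc w ^ 4 * K * (w ^ 3) ^ 10 = w ^ 34 * K := by ring
                _ ≤ w ^ 40 * K := by gcongr; all_goals norm_num
                _ ≤ 1 * G := by linarith
            _ = _ := by ring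
        calc (C₃ * (M / N ^ 4)) ^ (1 / 10 : ℝ) ≤ (C₃ * κ' ^ 4 / (w ^ 3) ^ 10) ^ (1 / 10 : ℝ) :=
              Real.rpow_le_rpow (by positivity) h1 (by norm_num)
          _ = C₅ / w ^ 3 := by
            rw [Real.div_rpow (by positivity) (by positivity), hC₅, ← Real.rpow_natCast (w ^ 3) 10,
              ← Real.rpow_mul (by positivity)]
            norm_num
      refine hfin.trans ?_
      rw [mul_assoc A₄]
      refine mul_le_mul_of_nonneg_left ?_ hA₄.le
      have h1 : N * (C₃ * (M / N ^ 4)) ^ (1 / 10 : ℝ) ≤ G * w * (C₅ / w ^ 3) := by gcongr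
      have h2 : G * w * (C₅ / w ^ 3) = C₅ * (G / w ^ 2) := by field_simp
      have h3 : 1 ≤ G / w ^ 2 := by rwa [le_div_iff₀ (by positivity), one_mul]
      linarith
  have hfinal : k₂ * (K * (G * w)) * (A₄ * (C₅ + 1) * (G / w ^ 2)) =
      k₂ * (A₄ * (C₅ + 1)) * (K * G ^ 2 / w) := by field_simp
  rw [hfinal] at hWcard
  calc (S.card : ℝ) ≤ A * (K * G ^ 2 / w + W.card) := hcard
    _ ≤ A * (K * G ^ 2 / w + k₂ * (A₄ * (C₅ + 1)) * (K * G ^ 2 / w)) := by gcongr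
    _ = _ := by ring

/-- Integer points near `y = K M^(β+1) t^(-β)`, `M = G^3 K`: gain of a factor `w` over the bound
`K G^2` when `G ≤ K`. -/
theorem card_near_curve_of_ge (β : ℝ) (hβ : 0 < β) {κ C₀ : ℝ} (hκ : 1 ≤ κ) (hC₀ : 0 ≤ C₀) :
    ∃ A > 0, ∀ (K G w M : ℝ) (S : Finset ℕ) (m : ℕ → ℤ),
      1 ≤ w → w ^ 13 ≤ G → w ^ 13 * G ≤ K → M = G ^ 3 * K →
      (∀ s ∈ S, (s : ℝ) ∈ Set.Icc M (κ * M) ∧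
        |K * M ^ (β + 1) * (s : ℝ) ^ (-β) + m s| ≤ C₀ * (K / M)) →
      (S.card : ℝ) ≤ A * (K * G ^ 2 / w) := by
  classical
  obtain ⟨A, hA, k₁, hk₁, k₂, hk₂, C₁, hC₁, hred⟩ := exists_stepPairs β hβ hκ hC₀
  set γ := 1 / (β + 1) with hγ
  have hγ0 : 0 < γ := by positivity
  set κ' := max 1 (k₂ / k₁) with hκ'
  have hκ'1 : 1 ≤ κ' := le_max_left _ _
  set C₄ := 2 * (β / k₁) ^ γ with hC₄
  have hC₄0 : 0 < C₄ := by positivity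
  -- For fixed q the second derivative in b has order M/(KG)² = G/K, up to powers of w, which is
  -- small in this range; chords then suffice.
  obtain ⟨A₄, hA₄, hcount⟩ := card_pow_near_int_of_chords (-γ) (by linarith) hκ'1
  set C₆ := C₁ * k₁ ^ 2 / C₄ with hC₆
  set C₇ := C₄ / k₁ with hC₇
  have hC₆0 : 0 < C₆ := by positivity
  have hC₇0 : 0 < C₇ := by positivity
  set C₈ := A₄ * (1 + k₁ + (1 + C₆) * (1 + C₇)) with hC₈
  have hC₈0 : 0 < C₈ := by positivity
  refine ⟨A * (1 + C₈), by positivity, ?_⟩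
  intro K G w M S m hw hwG hwK hM hS
  have hw0 : 0 < w := by linarith
  have hw13 : 1 ≤ w ^ 13 := one_le_pow₀ hw
  have hG : 1 ≤ G := hw13.trans hwG
  have hG0 : 0 < G := by linarith
  have hGK : G ≤ K := (le_mul_of_one_le_left hG0.le hw13).trans hwK
  have hK : 1 ≤ K := hG.trans hGK
  have hK0 : 0 < K := by linarith
  have hw2 : w ^ 2 ≤ G := (pow_le_pow_right₀ hw (by norm_num)).trans hwG
  have hM0 : 0 < M := by rw [hM]; positivity
  obtain ⟨W, hW, hcard⟩ := hred K G w M S m hK hw hw2 hM hS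
  have hWcard : (W.card : ℝ) ≤ G * w * (C₈ * (K * G / w ^ 2)) := by
    refine card_pairs_le (by positivity) (by positivity) (fun x hx => ?_) fun q hq hqG T hT => ?_
    · obtain ⟨h1, h2, -⟩ := hW x hx
      have : (0 : ℝ) < x.1 := lt_trans (by positivity) h1
      exact ⟨by exact_mod_cast this, h2⟩
    rcases T.eq_empty_or_nonempty with h0 | ⟨b₀, hb₀⟩
    · rw [h0]; simp; positivity
    have hq0 : (0 : ℝ) < q := by exact_mod_cast hq
    have hqlow : G / w < q := (hW _ (hT b₀ hb₀)).1
    have hTpos : ∀ b ∈ T, 0 < b := by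
      intro b hb
      obtain ⟨-, -, h2, -⟩ := hW _ (hT b hb)
      have h4 : (0 : ℝ) < b := lt_of_lt_of_le (by positivity) h2
      exact_mod_cast h4
    rw [← card_image_toNat fun b hb => (hTpos b hb).le]
    set N := k₁ * (K * q) with hN
    have hN0 : 0 < N := by positivity
    set c := 2 * (M * (β * K) ^ γ * (q : ℝ) ^ γ) with hcdef
    -- The chord bound needs closeness at most 1. When w²/G is too large for that, rounding supplies
    -- a nearby integer for free.
    set δ := min (C₁ * (w ^ 2 / G)) 1 with hδ
    have hδ0 : 0 ≤ δ := le_min (by positivity) zero_le_one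
    have hTm : ∀ b ∈ T.image Int.toNat, N ≤ b ∧ (b : ℝ) ≤ κ' * N ∧
        ∃ z : ℤ, |c * (b : ℝ) ^ (-γ) - z| ≤ δ := by
      intro b hb
      obtain ⟨b', hb', rfl⟩ := Finset.mem_image.1 hb
      obtain ⟨h2, h3, h4, h5, z, h6⟩ := hW _ (hT b' hb')
      dsimp only at h4 h5 h6
      have hbe : ((b'.toNat : ℕ) : ℝ) = (b' : ℝ) := by
        have := Int.toNat_of_nonneg (hTpos b' hb').le
        exact_mod_cast congrArg (fun t : ℤ => (t : ℝ)) this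
      rw [hbe]
      have hb0 : (0 : ℝ) < b' := by exact_mod_cast hTpos b' hb'
      refine ⟨h4, ?_, ?_⟩
      · calc (b' : ℝ) ≤ k₂ * (K * q) := h5
          _ = k₂ / k₁ * N := by rw [hN]; field_simp
          _ ≤ κ' * N := by gcongr; exact le_max_right _ _
      · have : c * (b' : ℝ) ^ (-γ) = 2 * (M * (β * K) ^ γ * ((b' : ℝ) / q) ^ (-γ)) := by
          rw [hcdef, Real.div_rpow hb0.le hq0.le, Real.rpow_neg hq0.le, div_inv_eq_mul]
          ring
        rw [this]
        rcases le_total (C₁ * (w ^ 2 / G)) 1 with h | h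
        · exact ⟨z, by rw [hδ, min_eq_left h]; exact h6⟩
        · refine ⟨round (2 * (M * (β * K) ^ γ * ((b' : ℝ) / q) ^ (-γ))), ?_⟩
          rw [hδ, min_eq_right h]
          exact (abs_sub_round _).trans (by norm_num)
    have hex : ∀ b : ℕ, ∃ z : ℤ, b ∈ T.image Int.toNat → |c * (b : ℝ) ^ (-γ) - z| ≤ δ := by
      intro b
      by_cases h : b ∈ T.image Int.toNat
      · obtain ⟨-, -, z, hz⟩ := hTm b h
        exact ⟨z, fun _ => hz⟩
      · exact ⟨0, fun h' => absurd h' h⟩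
    choose z hz using hex
    -- Taking Q = w³ makes the long gaps contribute N/Q = O(KG/w²), exactly what is wanted for each
    -- q.
    have hfin := hcount c N δ (w ^ 3) (T.image Int.toNat) z (by positivity) hN0 hδ0
      (min_le_right _ _) (one_le_pow₀ hw)
      (fun b hb => ⟨⟨(hTm b hb).1, (hTm b hb).2.1⟩, hz b hb⟩)
    have hlam : c * N ^ (-γ - 2) = C₄ * (M / N ^ 2) := by
      have h1 : N ^ (-γ - 2) = N ^ (-γ) / N ^ 2 := by
        rw [Real.rpow_sub hN0]; norm_cast
      have h2 : (β * K) ^ γ * (q : ℝ) ^ γ * N ^ (-γ) = (β / k₁) ^ γ := by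
        rw [Real.rpow_neg hN0.le, ← div_eq_mul_inv, ← Real.mul_rpow (by positivity) hq0.le,
          ← Real.div_rpow (by positivity) hN0.le]
        congr 1
        rw [hN]; field_simp
      rw [h1, hC₄, ← h2, hcdef]; ring
    rw [hlam] at hfin
    have hNup : N ≤ k₁ * (K * (G * w)) := by rw [hN]; gcongr
    have h1 : N / w ^ 3 ≤ k₁ * (K * G / w ^ 2) := by
      calc N / w ^ 3 ≤ k₁ * (K * (G * w)) / w ^ 3 := by gcongr
        _ = _ := by field_simp
    have h2 : δ / (C₄ * (M / N ^ 2)) ≤ C₆ * (w ^ 4 * K / G ^ 2) := by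
      calc δ / (C₄ * (M / N ^ 2)) ≤ C₁ * (w ^ 2 / G) / (C₄ * (M / (k₁ * (K * (G * w))) ^ 2)) := by
            gcongr
            exact min_le_left _ _
        _ = _ := by rw [hM, hC₆]; field_simp
    have h3 : (w ^ 3) ^ 2 * N * (C₄ * (M / N ^ 2)) ≤ C₇ * (w ^ 7 * G ^ 2) := by
      have e1 : (w ^ 3) ^ 2 * N * (C₄ * (M / N ^ 2)) = C₇ * (w ^ 6 * (G ^ 3 / q)) := by
        rw [hM, hN, hC₇]; field_simp
      rw [e1]
      calc C₇ * (w ^ 6 * (G ^ 3 / q)) ≤ C₇ * (w ^ 6 * (G ^ 3 / (G / w))) := by gcongr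
        _ = _ := by field_simp
    set Y := K * G / w ^ 2 with hY
    -- This inequality, coming from the ratio of closeness to second derivative, is what requires
    -- w¹³ ≤ G.
    have y1 : w ^ 11 * K ≤ Y := by
      rw [hY, le_div_iff₀ (by positivity)]
      calc w ^ 11 * K * w ^ 2 = K * w ^ 13 := by ring
        _ ≤ K * G := by gcongr
    have y2 : w ^ 7 * G ^ 2 ≤ Y := by
      rw [hY, le_div_iff₀ (by positivity)]
      calc w ^ 7 * G ^ 2 * w ^ 2 = w ^ 9 * G * G := by ring
        _ ≤ w ^ 13 * G * G := by gcongr; all_goals norm_num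
        _ ≤ K * G := by gcongr
    have y3 : w ^ 3 ≤ w ^ 7 * G ^ 2 := by
      calc w ^ 3 ≤ w ^ 7 := pow_le_pow_right₀ hw (by norm_num)
        _ ≤ w ^ 7 * G ^ 2 := le_mul_of_one_le_right (by positivity) (one_le_pow₀ hG)
    have y4 : 1 ≤ w ^ 3 := one_le_pow₀ hw
    have h4 : (1 + C₆ * (w ^ 4 * K / G ^ 2)) * (w ^ 7 * G ^ 2) ≤ (1 + C₆) * Y := by
      have e1 : (1 + C₆ * (w ^ 4 * K / G ^ 2)) * (w ^ 7 * G ^ 2) =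
        w ^ 7 * G ^ 2 + C₆ * (w ^ 11 * K) := by field_simp
      rw [e1]
      have := mul_le_mul_of_nonneg_left y1 hC₆0.le
      linarith
    refine hfin.trans ?_
    rw [hC₈, mul_assoc A₄]
    refine mul_le_mul_of_nonneg_left ?_ hA₄.le
    have h5 : w ^ 3 + (w ^ 3) ^ 2 * N * (C₄ * (M / N ^ 2)) ≤ (1 + C₇) * (w ^ 7 * G ^ 2) := by
      linarith
    have h6 : (1 + δ / (C₄ * (M / N ^ 2))) * (w ^ 3 + (w ^ 3) ^ 2 * N * (C₄ * (M / N ^ 2))) ≤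
        (1 + C₆ * (w ^ 4 * K / G ^ 2)) * ((1 + C₇) * (w ^ 7 * G ^ 2)) :=
      mul_le_mul (by linarith) h5 (by positivity) (by positivity)
    have h7 : (1 + C₆ * (w ^ 4 * K / G ^ 2)) * ((1 + C₇) * (w ^ 7 * G ^ 2)) ≤
        (1 + C₆) * (1 + C₇) * Y := by
      have := mul_le_mul_of_nonneg_left h4 (by linarith : 0 ≤ 1 + C₇)
      linarith
    linarith
  have hfinal : G * w * (C₈ * (K * G / w ^ 2)) = C₈ * (K * G ^ 2 / w) := by field_simp
  rw [hfinal] at hWcard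
  calc (S.card : ℝ) ≤ A * (K * G ^ 2 / w + W.card) := hcard
    _ ≤ A * (K * G ^ 2 / w + C₈ * (K * G ^ 2 / w)) := by gcongr
    _ = _ := by ring

/-! ### Dyadic summation -/

theorem geom_sum_le {ρ : ℝ} (h0 : 0 ≤ ρ) (h1 : ρ < 1) (n : ℕ) :
    ∑ j ∈ Finset.range n, ρ ^ j ≤ (1 - ρ)⁻¹ := by
  rw [← tsum_geometric_of_lt_one h0 h1]
  exact (summable_geometric_of_lt_one h0 h1).sum_le_tsum _ fun _ _ => by positivity

/-- Summation over dyadic ranges. -/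
theorem sum_rpow_le_of_dyadic {α s : ℝ} (hα : 0 ≤ α) (hs : 0 < s) :
    ∃ A > 0, ∀ (P : Finset ℕ) (a b B : ℝ), 0 < a → a ≤ b → 0 ≤ B →
      (∀ d ∈ P, a ≤ d ∧ (d : ℝ) ≤ b) →
      (∀ D : ℝ, a ≤ D → D ≤ b → ∀ T ⊆ P, (∀ d ∈ T, D ≤ d ∧ (d : ℝ) ≤ 2 * D) →
        (T.card : ℝ) * D ^ α ≤ B * ((D / b) ^ s + (D / a) ^ (-s))) →
      ∑ d ∈ P, (d : ℝ) ^ α ≤ A * B := by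
  classical
  set ρ : ℝ := 2 ^ (-s) with hρ
  have hρ0 : 0 < ρ := by positivity
  have hρ1 : ρ < 1 := Real.rpow_lt_one_of_one_lt_of_neg (by norm_num) (by linarith)
  have hρ2 : 0 < (1 - ρ)⁻¹ := inv_pos.2 (by linarith)
  refine ⟨2 ^ α * (2 * (1 - ρ)⁻¹), by positivity, ?_⟩
  intro P a b B ha hab hB hP hcount
  obtain ⟨J, hJ1, hJ2⟩ := exists_nat_pow_near (x := b / a) (y := (2 : ℝ))
    (by rwa [le_div_iff₀ ha, one_mul]) (by norm_num)
  rw [le_div_iff₀ ha] at hJ1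
  rw [div_lt_iff₀ ha] at hJ2
  have hj : ∀ d : ℕ, ∃ j : ℕ, d ∈ P → (j ≤ J ∧ 2 ^ j * a ≤ d ∧ (d : ℝ) ≤ 2 * (2 ^ j * a)) := by
    intro d
    by_cases hd : d ∈ P
    · obtain ⟨h1, h2⟩ := hP d hd
      obtain ⟨j, h3, h4⟩ := exists_nat_pow_near (x := d / a) (y := (2 : ℝ))
        (by rwa [le_div_iff₀ ha, one_mul]) (by norm_num)
      rw [le_div_iff₀ ha] at h3
      rw [div_lt_iff₀ ha] at h4
      refine ⟨j, fun _ => ⟨?_, h3, by rw [pow_succ] at h4; linarith⟩⟩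
      have h5 : (2 : ℝ) ^ j < 2 ^ (J + 1) := lt_of_mul_lt_mul_right (h3.trans_lt (h2.trans_lt hJ2)) ha.le
      have := (pow_lt_pow_iff_right₀ (by norm_num : (1 : ℝ) < 2)).1 h5
      omega
    · exact ⟨0, fun h => absurd h hd⟩
  choose j hj using hj
  have hmaps : ∀ d ∈ P, j d ∈ Finset.range (J + 1) := fun d hd => by
    have := (hj d hd).1
    simp; omega
  rw [← Finset.sum_fiberwise_of_maps_to hmaps]
  -- The block at 2^i a is bounded by two geometric sequences, one decaying away from each end of
  -- the range, so the sum over i costs a constant and no logarithm.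
  have hterm : ∀ i ∈ Finset.range (J + 1), ∑ d ∈ P with j d = i, (d : ℝ) ^ α ≤
      2 ^ α * (B * (ρ ^ (J - i) + ρ ^ i)) := by
    intro i hi
    have hiJ : i ≤ J := by simp at hi; omega
    set D := 2 ^ i * a with hD
    have hD0 : 0 < D := by positivity
    have hDa : a ≤ D := by
      rw [hD]; exact le_mul_of_one_le_left ha.le (one_le_pow₀ (by norm_num))
    have hDJ : D ≤ 2 ^ J * a := by
      rw [hD]; gcongr; norm_num
    have hDb : D ≤ b := hDJ.trans hJ1
    have h1 := hcount D hDa hDb (P.filter fun d => j d = i) (Finset.filter_subset _ _)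
      (fun d hd => by
        rw [Finset.mem_filter] at hd
        have := (hj d hd.1).2
        rwa [hd.2] at this)
    have h2 : (D / a) ^ (-s) = ρ ^ i := by
      have : D / a = 2 ^ i := by rw [hD]; field_simp
      rw [this, hρ, ← Real.rpow_natCast, ← Real.rpow_natCast, ← Real.rpow_mul (by norm_num),
        ← Real.rpow_mul (by norm_num)]
      congr 1; ring
    have h3 : (D / b) ^ s ≤ ρ ^ (J - i) := by
      have e1 : D / b ≤ 2⁻¹ ^ (J - i) := by
        rw [div_le_iff₀ (ha.trans_le hab)]
        calc D = 2⁻¹ ^ (J - i) * (2 ^ J * a) := by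
              rw [hD, ← Nat.sub_add_cancel hiJ, pow_add, Nat.add_sub_cancel, inv_pow]
              field_simp
          _ ≤ _ := by gcongr
      have e2 : ρ = (2⁻¹ : ℝ) ^ s := by rw [hρ, Real.inv_rpow (by norm_num), Real.rpow_neg (by norm_num)]
      calc (D / b) ^ s ≤ ((2⁻¹ : ℝ) ^ (J - i)) ^ s :=
            Real.rpow_le_rpow (div_nonneg hD0.le (ha.le.trans hab)) e1 hs.le
        _ = ρ ^ (J - i) := by
          rw [e2, ← Real.rpow_natCast, ← Real.rpow_natCast, ← Real.rpow_mul (by norm_num),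
            ← Real.rpow_mul (by norm_num), mul_comm]
    calc ∑ d ∈ P with j d = i, (d : ℝ) ^ α ≤ ∑ d ∈ P with j d = i, (2 * D) ^ α := by
          refine Finset.sum_le_sum fun d hd => ?_
          rw [Finset.mem_filter] at hd
          have := (hj d hd.1).2.2
          rw [hd.2] at this
          exact Real.rpow_le_rpow (Nat.cast_nonneg _) this hα
      _ = 2 ^ α * ((P.filter fun d => j d = i).card * D ^ α) := by
          rw [Finset.sum_const, nsmul_eq_mul, Real.mul_rpow (by norm_num) hD0.le]; ring
      _ ≤ 2 ^ α * (B * ((D / b) ^ s + (D / a) ^ (-s))) := by gcongr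
      _ ≤ _ := by rw [h2]; gcongr
  refine (Finset.sum_le_sum hterm).trans ?_
  rw [← Finset.mul_sum, ← Finset.mul_sum, Finset.sum_add_distrib]
  have h1 : ∑ i ∈ Finset.range (J + 1), ρ ^ (J - i) = ∑ i ∈ Finset.range (J + 1), ρ ^ i := by
    rw [← Finset.sum_range_reflect (fun i => ρ ^ i) (J + 1)]
    exact Finset.sum_congr rfl fun i _ => by simp
  rw [h1]
  have h2 := geom_sum_le hρ0.le hρ1 (J + 1)
  calc 2 ^ α * (B * (∑ i ∈ Finset.range (J + 1), ρ ^ i + ∑ i ∈ Finset.range (J + 1), ρ ^ i))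
      ≤ 2 ^ α * (B * ((1 - ρ)⁻¹ + (1 - ρ)⁻¹)) := by gcongr
    _ = _ := by ring

/-! ### From the floor sum to the sum over large d -/

/-- The integers `d` such that `⌊x / n⌋ = d ^ r` for some `n ≥ 1`. -/
noncomputable def hits (r : ℕ) (x : ℝ) : Finset ℕ := by
  classical
  exact (Finset.Icc 1 ⌊x⌋₊).filter fun d =>
    ∃ n : ℕ, 1 ≤ n ∧ (d : ℝ) ^ r * n ≤ x ∧ x < ((d : ℝ) ^ r + 1) * n

theorem mem_hits {r : ℕ} {x : ℝ} {d : ℕ} (hd : d ∈ hits r x) : 1 ≤ d ∧ (d : ℝ) ≤ x ∧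
    ∃ n : ℕ, 1 ≤ n ∧ (d : ℝ) ^ r * n ≤ x ∧ x < ((d : ℝ) ^ r + 1) * n := by
  classical
  simp only [hits, Finset.mem_filter, Finset.mem_Icc] at hd
  exact ⟨hd.1.1, (Nat.le_floor_iff' (by omega)).1 hd.1.2, hd.2⟩

/-- The integers `n` with `⌊x / n⌋ = d ^ r`. -/
noncomputable def preimages (r : ℕ) (x : ℝ) (d : ℕ) : Finset ℕ :=
  (Finset.Icc 1 ⌊x⌋₊).filter fun n => ⌊x / (n : ℝ)⌋₊ = d ^ r

theorem floor_div_eq_iff {r d n : ℕ} {x : ℝ} (hd : 1 ≤ d) (hn : 1 ≤ n) :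
    ⌊x / (n : ℝ)⌋₊ = d ^ r ↔ (d : ℝ) ^ r * n ≤ x ∧ x < ((d : ℝ) ^ r + 1) * n := by
  have hn0 : (0 : ℝ) < n := by exact_mod_cast hn
  have hd0 : d ^ r ≠ 0 := (pow_pos hd r).ne'
  rw [Nat.floor_eq_iff' hd0, le_div_iff₀ hn0, div_lt_iff₀ hn0]
  push_cast
  rfl

theorem mem_preimages {r d n : ℕ} {x : ℝ} (hd : 1 ≤ d) (h : n ∈ preimages r x d) :
    1 ≤ n ∧ (d : ℝ) ^ r * n ≤ x ∧ x < ((d : ℝ) ^ r + 1) * n := by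
  rw [preimages, Finset.mem_filter, Finset.mem_Icc] at h
  exact ⟨h.1.1, (floor_div_eq_iff hd h.1.1).1 h.2⟩

/-- With y = d^r, the integers n are those in (x/(y+1), x/y], an interval of length x/(y(y+1)). -/
theorem card_preimages {r d : ℕ} {x : ℝ} (hd : 1 ≤ d) (hx : 0 ≤ x) :
    |((preimages r x d).card : ℝ) - x / ((d : ℝ) ^ r * ((d : ℝ) ^ r + 1))| ≤ 1 := by
  have hd1 : (1 : ℝ) ≤ (d : ℝ) ^ r := one_le_pow₀ (by exact_mod_cast hd)
  set y := (d : ℝ) ^ r with hy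
  have he : preimages r x d = Finset.Ioc ⌊x / (y + 1)⌋₊ ⌊x / y⌋₊ := by
    ext n
    rw [Finset.mem_Ioc, Nat.floor_lt (by positivity)]
    constructor
    · intro h
      obtain ⟨h1, h2, h3⟩ := mem_preimages hd h
      refine ⟨by rw [div_lt_iff₀ (by linarith)]; linarith, Nat.le_floor ?_⟩
      rw [le_div_iff₀ (by linarith)]; linarith
    · rintro ⟨h1, h2⟩
      have hn : 1 ≤ n := by
        by_contra h0
        have : n = 0 := by omega
        rw [this, Nat.cast_zero] at h1
        have : 0 ≤ x / (y + 1) := by positivity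
        linarith
      have h3 := (Nat.le_floor_iff' (by omega)).1 h2
      rw [le_div_iff₀ (by linarith)] at h3
      rw [div_lt_iff₀ (by linarith)] at h1
      have hn0 : (0 : ℝ) ≤ n := Nat.cast_nonneg n
      rw [preimages, Finset.mem_filter, Finset.mem_Icc, floor_div_eq_iff hd hn]
      refine ⟨⟨hn, Nat.le_floor ?_⟩, ?_, ?_⟩
      · nlinarith
      · rw [← hy]; linarith
      · rw [← hy]; linarith
  have hle : ⌊x / (y + 1)⌋₊ ≤ ⌊x / y⌋₊ := Nat.floor_le_floor (by gcongr; linarith)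
  rw [he, Nat.card_Ioc, Nat.cast_sub hle]
  have a1 := Nat.floor_le (show 0 ≤ x / (y + 1) by positivity)
  have a2 := Nat.lt_floor_add_one (x / (y + 1))
  have a3 := Nat.floor_le (show 0 ≤ x / y by positivity)
  have a4 := Nat.lt_floor_add_one (x / y)
  have e : x / (y * (y + 1)) = x / y - x / (y + 1) := by field_simp; ring
  rw [e, abs_le]
  constructor <;> linarith

theorem S_eq_sum {r : ℕ} (hr : r ≠ 0) {h f : ℕ → ℂ} (hf : IsPowerSupported r h f) {x : ℝ} :
    S f x = ∑ d ∈ Finset.Icc 1 ⌊x⌋₊, h d * ((preimages r x d).card : ℂ) := by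
  classical
  have h1 : ∀ n ∈ Finset.Icc 1 ⌊x⌋₊, f ⌊x / (n : ℝ)⌋₊ =
      ∑ d ∈ Finset.Icc 1 ⌊x⌋₊, if ⌊x / (n : ℝ)⌋₊ = d ^ r then h d else 0 := by
    intro n hn
    rw [Finset.mem_Icc] at hn
    have hn0 : (0 : ℝ) < n := by exact_mod_cast hn.1
    have hxn : (n : ℝ) ≤ x := (Nat.le_floor_iff' (by omega)).1 hn.2
    have hpos : 1 ≤ ⌊x / (n : ℝ)⌋₊ := Nat.le_floor (by
      rw [Nat.cast_one, le_div_iff₀ hn0]; linarith)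
    by_cases hex : ∃ d : ℕ, ⌊x / (n : ℝ)⌋₊ = d ^ r
    · obtain ⟨d, hd⟩ := hex
      have hd1 : 1 ≤ d := by
        by_contra h0
        have : d = 0 := by omega
        rw [this, zero_pow hr] at hd
        omega
      have hdx : d ∈ Finset.Icc 1 ⌊x⌋₊ := by
        rw [Finset.mem_Icc]
        refine ⟨hd1, (Nat.le_self_pow hr d).trans (hd ▸ Nat.floor_le_floor ?_)⟩
        exact div_le_self (hn0.le.trans hxn) (by exact_mod_cast hn.1)
      rw [Finset.sum_eq_single_of_mem d hdx, if_pos hd, hd, hf.1 d hd1]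
      intro d' _ hne
      rw [if_neg]
      intro hd'
      exact hne (Nat.pow_left_injective hr (hd'.symm.trans hd))
    · rw [hf.2 _ hpos hex, Finset.sum_eq_zero]
      intro d _
      rw [if_neg fun h' => hex ⟨d, h'⟩]
  rw [S, Finset.sum_congr rfl h1, Finset.sum_comm]
  refine Finset.sum_congr rfl fun d _ => ?_
  rw [← Finset.sum_filter, Finset.sum_const, nsmul_eq_mul, mul_comm]
  rfl

/-- The term of index `d` of the series `C_f` for `f` supported on `r`-th powers. -/
noncomputable def powTerm (r : ℕ) (h : ℕ → ℂ) (d : ℕ) : ℂ :=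
  h d / (((d : ℝ) ^ r * ((d : ℝ) ^ r + 1) : ℝ) : ℂ)

/-- The terms of C_f are indexed by m = n - 1, so they are supported on the image of the injection d
↦ (d+1)^r - 1; summability and sum transfer along it. -/
theorem CTerm_series {r : ℕ} (hr : r ≠ 0) {h f : ℕ → ℂ} (hf : IsPowerSupported r h f) :
    (Summable (CTerm f) ↔ Summable fun d : ℕ => powTerm r h (d + 1)) ∧
      C f = ∑' d : ℕ, powTerm r h (d + 1) := by
  set e : ℕ → ℕ := fun d => (d + 1) ^ r - 1 with he
  have hpos : ∀ d : ℕ, 1 ≤ (d + 1) ^ r := fun d => Nat.one_le_pow _ _ (by omega)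
  have hinj : Function.Injective e := by
    intro a b hab
    have h1 := hpos a
    have h2 := hpos b
    have h3 : (a + 1) ^ r = (b + 1) ^ r := by simp only [he] at hab; omega
    have := Nat.pow_left_injective hr h3
    omega
  have hz : ∀ m ∉ Set.range e, CTerm f m = 0 := by
    intro m hm
    rw [CTerm, hf.2 (m + 1) (by omega), zero_div]
    rintro ⟨d, hd⟩
    refine hm ⟨d - 1, ?_⟩
    have hd1 : d ≠ 0 := by
      rintro rfl
      rw [zero_pow hr] at hd
      omega
    simp only [he]
    rw [Nat.sub_add_cancel (by omega), ← hd]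
    rfl
  have hcomp : CTerm f ∘ e = fun d : ℕ => powTerm r h (d + 1) := by
    funext d
    have h1 : e d + 1 = (d + 1) ^ r := Nat.sub_add_cancel (hpos d)
    have h2 : ((e d : ℂ) + 1) = ((d : ℂ) + 1) ^ r := by exact_mod_cast congrArg (fun n : ℕ => (n : ℂ)) h1
    have h3 : ((e d : ℂ) + 2) = ((d : ℂ) + 1) ^ r + 1 := by rw [← h2]; ring
    simp only [Function.comp, CTerm, powTerm]
    rw [h1, hf.1 (d + 1) (by omega), h2, h3]
    push_cast
    rfl
  constructor
  · rw [← hcomp]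
    exact (hinj.summable_iff hz).symm
  · rw [C, ← hcomp]
    exact (hinj.tsum_eq (Function.support_subset_iff'.2 hz)).symm

theorem sum_range_add_one {E : Type*} [AddCommMonoid E] (p : ℕ → E) (n : ℕ) :
    ∑ i ∈ Finset.range n, p (i + 1) = ∑ d ∈ Finset.Ioc 0 n, p d := by
  refine Finset.sum_nbij (· + 1) (fun i hi => ?_) (fun i _ j _ hij => ?_) (fun d hd => ?_)
    fun _ _ => rfl
  · simp only [Finset.mem_range, Finset.mem_Ioc] at *; omega
  · simpa using hij
  · simp only [Finset.coe_Ioc, Set.mem_Ioc, Finset.coe_range, Set.mem_image, Set.mem_Iio] at *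
    exact ⟨d - 1, by omega, by omega⟩

theorem sum_range_inv_sq_le (k n : ℕ) :
    ∑ i ∈ Finset.range n, (((i + (k + 1) : ℕ) : ℝ) ^ 2)⁻¹ ≤ 2 / (k + 1) := by
  refine le_trans (le_of_eq ?_) (sum_Ioo_inv_sq_le (α := ℝ) k (k + n + 1))
  refine Finset.sum_nbij (· + (k + 1)) (fun i hi => ?_) (fun i _ j _ hij => ?_) (fun d hd => ?_)
    fun _ _ => rfl
  · simp only [Finset.mem_range, Finset.mem_Ioo] at *; omega
  · simpa using hij
  · simp only [Finset.coe_Ioo, Set.mem_Ioo, Finset.coe_range, Set.mem_image, Set.mem_Iio] at *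
    exact ⟨d - (k + 1), by omega, by omega⟩

/-- Reduction of the asymptotic formula to a bound for the sum over large `d`. -/
theorem exists_error_bound {r : ℕ} (hr : 2 ≤ r) {α θ : ℝ} (hα : 0 ≤ α) (hα1 : α ≤ 1)
    (hθ : 1 ≤ 2 * r * θ) (hθ1 : θ ≤ 1) {h f : ℕ → ℂ} (hf : IsPowerSupported r h f)
    (hh : h =O[atTop] fun d : ℕ => (d : ℝ) ^ α) :
    Summable (CTerm f) ∧ ∃ H > 0, ∀ x : ℝ, 1 ≤ x → ∀ B : ℝ,
      (∑ d ∈ (hits r x).filter (fun d : ℕ => x ^ θ < d), (d : ℝ) ^ α ≤ B) →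
      ‖S f x - C f * (x : ℂ)‖ ≤ H * (x ^ (θ * (1 + α)) + B) := by
  classical
  have hr0 : r ≠ 0 := by omega
  have hr2 : (2 : ℝ) ≤ r := by exact_mod_cast hr
  have hθ0 : 0 < θ := by
    by_contra! h0
    nlinarith
  obtain ⟨H, hH, hbd⟩ := bound_of_isBigO_nat_atTop hh
  have hhd : ∀ d : ℕ, 1 ≤ d → ‖h d‖ ≤ H * (d : ℝ) ^ α := by
    intro d hd
    have hd0 : (0 : ℝ) < d := by exact_mod_cast hd
    have h1 : (0 : ℝ) < (d : ℝ) ^ α := Real.rpow_pos_of_pos hd0 _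
    have := hbd (x := d) h1.ne'
    rwa [Real.norm_of_nonneg h1.le] at this
  -- the terms of the series
  have hterm : ∀ d : ℕ, 1 ≤ d → ‖powTerm r h d‖ ≤ H * (d : ℝ) ^ (α - 2 * r + 2) * ((d : ℝ) ^ 2)⁻¹ := by
    intro d hd
    have hd0 : (0 : ℝ) < d := by exact_mod_cast hd
    have e1 : (d : ℝ) ^ (α - 2 * r + 2) * ((d : ℝ) ^ 2)⁻¹ = (d : ℝ) ^ α / ((d : ℝ) ^ r * (d : ℝ) ^ r) := by
      have : (d : ℝ) ^ (α - 2 * r + 2) = (d : ℝ) ^ α / ((d : ℝ) ^ r * (d : ℝ) ^ r) * (d : ℝ) ^ 2 := by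
        rw [Real.rpow_add hd0, Real.rpow_sub hd0, two_mul (r : ℝ), Real.rpow_add hd0 (r : ℝ) r,
          Real.rpow_natCast, Real.rpow_two]
      rw [this]
      field_simp
    rw [mul_assoc, e1, powTerm, norm_div, Complex.norm_real, Real.norm_of_nonneg (by positivity),
      mul_div_assoc']
    gcongr
    · exact hhd d hd
    · linarith
  have hsum : Summable fun d : ℕ => powTerm r h (d + 1) := by
    have h2 : Summable fun d : ℕ => H * (((d + 1 : ℕ) : ℝ) ^ 2)⁻¹ :=
      (((summable_nat_add_iff 1).2 (Real.summable_nat_pow_inv.2 (by norm_num : 1 < 2)))).mul_left H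
    refine Summable.of_norm_bounded h2 fun d => (hterm (d + 1) (by omega)).trans ?_
    have h3 : ((d + 1 : ℕ) : ℝ) ^ (α - 2 * r + 2) ≤ 1 :=
      Real.rpow_le_one_of_one_le_of_nonpos (by exact_mod_cast (by omega : 1 ≤ d + 1)) (by linarith)
    calc H * ((d + 1 : ℕ) : ℝ) ^ (α - 2 * r + 2) * (((d + 1 : ℕ) : ℝ) ^ 2)⁻¹
        ≤ H * 1 * (((d + 1 : ℕ) : ℝ) ^ 2)⁻¹ := by gcongr
      _ = _ := by rw [mul_one]
  obtain ⟨hiff, hC⟩ := CTerm_series hr0 hf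
  refine ⟨hiff.2 hsum, 3 * H, by positivity, ?_⟩
  intro x hx B hB
  have hx0 : 0 < x := by linarith
  set y := x ^ θ with hy
  have hy1 : 1 ≤ y := Real.one_le_rpow hx hθ0.le
  have hyx : y ≤ x := by
    calc x ^ θ ≤ x ^ (1 : ℝ) := Real.rpow_le_rpow_of_exponent_le hx hθ1
      _ = x := Real.rpow_one x
  -- The role of 1 ≤ 2rθ: each d > y has at most one n, since the interval is shorter than 1, and
  -- the tail of the series beyond y, times x, is O(y^(1+α)).
  have hxy : x ≤ y ^ (2 * r) := by
    rw [hy, ← Real.rpow_natCast, ← Real.rpow_mul hx0.le]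
    calc x = x ^ (1 : ℝ) := (Real.rpow_one x).symm
      _ ≤ _ := Real.rpow_le_rpow_of_exponent_le hx (by push_cast; linarith)
  set D := ⌊y⌋₊ with hD
  have hDX : D ≤ ⌊x⌋₊ := Nat.floor_le_floor hyx
  have hyα : x ^ (θ * (1 + α)) = y * y ^ α := by
    rw [hy, ← Real.rpow_mul hx0.le, ← Real.rpow_add hx0]; congr 1; ring
  have hIcc : Finset.Icc 1 ⌊x⌋₊ = Finset.Ioc 0 ⌊x⌋₊ := by
    ext d; simp only [Finset.mem_Icc, Finset.mem_Ioc]; omega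
  have hsplit : C f = ∑ d ∈ Finset.Ioc 0 D, powTerm r h d + ∑' i : ℕ, powTerm r h (i + D + 1) := by
    rw [hC, ← hsum.sum_add_tsum_nat_add D, sum_range_add_one]
  rw [S_eq_sum hr0 hf, hIcc, ← Finset.sum_Ioc_consecutive _ (Nat.zero_le D) hDX, hsplit]
  have e1 : ∑ d ∈ Finset.Ioc 0 D, h d * ((preimages r x d).card : ℂ) +
      ∑ d ∈ Finset.Ioc D ⌊x⌋₊, h d * ((preimages r x d).card : ℂ) -
      (∑ d ∈ Finset.Ioc 0 D, powTerm r h d + ∑' i : ℕ, powTerm r h (i + D + 1)) * (x : ℂ) =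
      ∑ d ∈ Finset.Ioc 0 D, (h d * ((preimages r x d).card : ℂ) - powTerm r h d * x) +
      ∑ d ∈ Finset.Ioc D ⌊x⌋₊, h d * ((preimages r x d).card : ℂ) -
      (∑' i : ℕ, powTerm r h (i + D + 1)) * (x : ℂ) := by
    rw [Finset.sum_sub_distrib, ← Finset.sum_mul]; ring
  rw [e1]
  have b1 : ‖∑ d ∈ Finset.Ioc 0 D, (h d * ((preimages r x d).card : ℂ) - powTerm r h d * x)‖ ≤
      H * (y * y ^ α) := by
    have hone : ∀ d ∈ Finset.Ioc 0 D,
        ‖h d * ((preimages r x d).card : ℂ) - powTerm r h d * x‖ ≤ H * y ^ α := by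
      intro d hd
      rw [Finset.mem_Ioc] at hd
      have hd1 : 1 ≤ d := hd.1
      have hdy : (d : ℝ) ≤ y := (Nat.le_floor_iff' (by omega)).1 hd.2
      have e2 : h d * ((preimages r x d).card : ℂ) - powTerm r h d * x =
          h d * (((preimages r x d).card - x / ((d : ℝ) ^ r * ((d : ℝ) ^ r + 1)) : ℝ) : ℂ) := by
        rw [powTerm]; push_cast; ring
      rw [e2, norm_mul, Complex.norm_real, Real.norm_eq_abs]
      calc ‖h d‖ * |((preimages r x d).card : ℝ) - x / ((d : ℝ) ^ r * ((d : ℝ) ^ r + 1))|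
          ≤ (H * (d : ℝ) ^ α) * 1 := by
            gcongr
            · exact hhd d hd1
            · exact card_preimages hd1 hx0.le
        _ ≤ H * y ^ α := by
            rw [mul_one]
            gcongr
    refine (norm_sum_le_of_le _ hone).trans ?_
    rw [Finset.sum_const, Nat.card_Ioc, Nat.sub_zero, nsmul_eq_mul]
    have := Nat.floor_le (show 0 ≤ y by linarith)
    calc (D : ℝ) * (H * y ^ α) ≤ y * (H * y ^ α) := by gcongr
      _ = _ := by ring
  have b2 : ‖∑ d ∈ Finset.Ioc D ⌊x⌋₊, h d * ((preimages r x d).card : ℂ)‖ ≤ H * B := by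
    have hone : ∀ d ∈ Finset.Ioc D ⌊x⌋₊, ‖h d * ((preimages r x d).card : ℂ)‖ ≤
        H * (if d ∈ (hits r x).filter (fun d : ℕ => y < d) then (d : ℝ) ^ α else 0) := by
      intro d hd
      rw [Finset.mem_Ioc] at hd
      have hd1 : 1 ≤ d := by omega
      have hdy : y < d := Nat.lt_of_floor_lt hd.1
      rw [norm_mul, Complex.norm_natCast]
      rcases (preimages r x d).eq_empty_or_nonempty with h0 | ⟨n, hn⟩
      · rw [h0, Finset.card_empty, Nat.cast_zero, mul_zero]
        refine mul_nonneg hH.le ?_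
        split_ifs <;> positivity
      · have hmem : d ∈ (hits r x).filter (fun d : ℕ => y < d) := by
          rw [Finset.mem_filter]
          refine ⟨?_, hdy⟩
          rw [hits, Finset.mem_filter, Finset.mem_Icc]
          exact ⟨⟨hd1, hd.2⟩, n, mem_preimages hd1 hn⟩
        rw [if_pos hmem]
        have hc : (preimages r x d).card ≤ 1 := by
          have h3 := (abs_le.1 (card_preimages (r := r) hd1 hx0.le)).2
          have h4 : x / ((d : ℝ) ^ r * ((d : ℝ) ^ r + 1)) < 1 := by
            have hd0 : (0 : ℝ) < (d : ℝ) ^ r := by positivity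
            rw [div_lt_one (by positivity)]
            have : x ≤ (d : ℝ) ^ r * (d : ℝ) ^ r := by
              rw [← pow_add, ← two_mul]
              exact hxy.trans (by gcongr)
            linarith
          have h5 : ((preimages r x d).card : ℝ) < 2 := by linarith
          have : (preimages r x d).card < 2 := by exact_mod_cast h5
          omega
        calc ‖h d‖ * ((preimages r x d).card : ℝ) ≤ (H * (d : ℝ) ^ α) * 1 := by
              gcongr
              · exact hhd d hd1
              · exact_mod_cast hc
          _ = _ := mul_one _
    refine (norm_sum_le_of_le _ hone).trans ?_
    rw [← Finset.mul_sum]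
    refine mul_le_mul_of_nonneg_left (le_trans ?_ hB) hH.le
    rw [← Finset.sum_filter]
    refine Finset.sum_le_sum_of_subset_of_nonneg (fun d hd => ?_) fun _ _ _ => by positivity
    exact (Finset.mem_filter.1 hd).2
  have b3 : ‖(∑' i : ℕ, powTerm r h (i + D + 1)) * (x : ℂ)‖ ≤ 2 * H * (y * y ^ α) := by
    have hs2 : Summable fun i : ℕ => ‖powTerm r h (i + D + 1)‖ :=
      ((summable_nat_add_iff D).2 hsum).norm
    have hDy : y < D + 1 := Nat.lt_floor_add_one y
    have h4 : ∑' i : ℕ, ‖powTerm r h (i + D + 1)‖ ≤ H * y ^ (α - 2 * r + 2) * (2 / (D + 1)) := by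
      refine Real.tsum_le_of_sum_range_le (fun _ => norm_nonneg _) fun n => ?_
      calc ∑ i ∈ Finset.range n, ‖powTerm r h (i + D + 1)‖
          ≤ ∑ i ∈ Finset.range n, H * y ^ (α - 2 * r + 2) * (((i + (D + 1) : ℕ) : ℝ) ^ 2)⁻¹ := by
            refine Finset.sum_le_sum fun i _ => (hterm _ (by omega)).trans ?_
            have hle : y ≤ ((i + D + 1 : ℕ) : ℝ) := by
              push_cast
              have : (0 : ℝ) ≤ i := Nat.cast_nonneg i
              linarith
            have h5 : ((i + D + 1 : ℕ) : ℝ) ^ (α - 2 * r + 2) ≤ y ^ (α - 2 * r + 2) :=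
              Real.rpow_le_rpow_of_nonpos (by linarith) hle (by linarith)
            rw [← add_assoc i D 1]
            gcongr
        _ = H * y ^ (α - 2 * r + 2) * ∑ i ∈ Finset.range n, (((i + (D + 1) : ℕ) : ℝ) ^ 2)⁻¹ := by
            rw [Finset.mul_sum]
        _ ≤ _ := by
            gcongr
            exact sum_range_inv_sq_le D n
    rw [norm_mul, Complex.norm_real, Real.norm_of_nonneg hx0.le]
    have hy0 : 0 < y := by linarith
    have e3 : y ^ (α - 2 * r + 2) = y ^ α * y ^ 2 / y ^ (2 * r) := by
      rw [Real.rpow_add hy0, Real.rpow_sub hy0, ← Real.rpow_natCast y (2 * r)]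
      push_cast
      rw [← Real.rpow_natCast y 2]
      push_cast
      ring
    calc ‖∑' i : ℕ, powTerm r h (i + D + 1)‖ * x
        ≤ H * y ^ (α - 2 * r + 2) * (2 / (D + 1)) * x := by
          gcongr
          exact (norm_tsum_le_tsum_norm hs2).trans h4
      _ ≤ H * y ^ (α - 2 * r + 2) * (2 / y) * y ^ (2 * r) := by gcongr
      _ = _ := by rw [e3]; field_simp
  rw [hyα]
  calc _ ≤ H * (y * y ^ α) + H * B + 2 * H * (y * y ^ α) :=
        (norm_sub_le _ _).trans (add_le_add ((norm_add_le _ _).trans (add_le_add b1 b2)) b3)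
    _ ≤ _ := by
      have hB0 : 0 ≤ B := le_trans (Finset.sum_nonneg fun _ _ => by positivity) hB
      have : 0 ≤ H * B := by positivity
      nlinarith

/-! ### Optimised bound near a curve -/

/-- Integer points near `y = K M^(β+1) t^(-β)`, `M = G^3 K`: power gain over the bound `K G^2`. -/
theorem card_near_curve (β : ℝ) (hβ : 0 < β) {κ C₀ : ℝ} (hκ : 1 ≤ κ) (hC₀ : 0 ≤ C₀) :
    ∃ A > 0, ∀ (K G M : ℝ) (S : Finset ℕ) (m : ℕ → ℤ), 1 ≤ K → 1 ≤ G → M = G ^ 3 * K →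
      (∀ s ∈ S, (s : ℝ) ∈ Set.Icc M (κ * M) ∧
        |K * M ^ (β + 1) * (s : ℝ) ^ (-β) + m s| ≤ C₀ * (K / M)) →
      (S.card : ℝ) ≤ A * (K * G ^ 2 * (K ^ (-(1 / 40) : ℝ) + (K / G) ^ (1 / 40 : ℝ))) ∧
      (S.card : ℝ) ≤ A * (K * G ^ 2 * (G ^ (-(1 / 13) : ℝ) + (G / K) ^ (1 / 13 : ℝ))) := by
  obtain ⟨A, hA, h₁⟩ := card_near_curve_of_le β hβ hκ hC₀
  obtain ⟨A', hA', h₂⟩ := card_near_curve_of_ge β hβ hκ hC₀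
  refine ⟨A + A', by positivity, ?_⟩
  intro K G M S m hK hG hM hS
  have hK0 : 0 < K := by linarith
  have hG0 : 0 < G := by linarith
  -- The largest admissible factor is w = min(X, Y)^(1/n), and 1/w is at most the sum of the two
  -- candidate values.
  have hmin : ∀ {X Y e : ℝ} {n : ℕ}, 1 ≤ X → 1 ≤ Y → e * n = 1 → n ≠ 0 → 0 < e →
      ∃ w : ℝ, 1 ≤ w ∧ w ^ n ≤ X ∧ w ^ n ≤ Y ∧ 1 / w ≤ X ^ (-e) + (1 / Y) ^ e := by
    intro X Y e n hX hY hen hn he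
    have hm : 1 ≤ min X Y := le_min hX hY
    have hX0 : 0 < X := by linarith
    have hY0 : 0 < Y := by linarith
    have hm0 : 0 < min X Y := by linarith
    have hpow : (min X Y ^ e) ^ n = min X Y := by
      rw [← Real.rpow_natCast, ← Real.rpow_mul hm0.le, hen, Real.rpow_one]
    refine ⟨min X Y ^ e, Real.one_le_rpow hm he.le, ?_, ?_, ?_⟩
    · rw [hpow]; exact min_le_left _ _
    · rw [hpow]; exact min_le_right _ _
    · rw [one_div, one_div, ← Real.rpow_neg hm0.le, Real.inv_rpow hY0.le, ← Real.rpow_neg hY0.le]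
      have p1 : 0 < X ^ (-e) := by positivity
      have p2 : 0 < Y ^ (-e) := by positivity
      rcases min_choice X Y with h | h <;> rw [h] <;> linarith
  have hKG2 : 0 < K * G ^ 2 := by positivity
  constructor
  · rcases le_total K G with h | h
    · obtain ⟨w, w1, w2, w3, w4⟩ := hmin (X := K) (Y := G / K) (e := 1 / 40) (n := 40) hK
        (by rwa [le_div_iff₀ hK0, one_mul]) (by norm_num) (by norm_num) (by norm_num)
      rw [le_div_iff₀ hK0] at w3
      rw [one_div_div] at w4
      refine (h₁ K G w M S m hK w1 w2 w3 hM hS).trans ?_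
      have : K * G ^ 2 / w = K * G ^ 2 * (1 / w) := by ring
      rw [this]
      gcongr
      linarith
    -- Outside the range K ≤ G the claimed factor is at least 1, so the classical bound, the case w
    -- = 1 of the other estimate, is enough.
    · have := h₂ K G 1 M S m le_rfl (by simpa using hG) (by simpa using h) hM hS
      rw [div_one] at this
      have h3 : 1 ≤ (K / G) ^ (1 / 40 : ℝ) :=
        Real.one_le_rpow (by rwa [le_div_iff₀ hG0, one_mul]) (by norm_num)
      have h4 : 0 < K ^ (-(1 / 40) : ℝ) := by positivity
      refine this.trans ?_
      calc A' * (K * G ^ 2) ≤ (A + A') * (K * G ^ 2 * 1) := by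
            rw [mul_one]; gcongr; linarith
        _ ≤ _ := by gcongr; linarith
  · rcases le_total K G with h | h
    · have := h₁ K G 1 M S m hK le_rfl (by simpa using hK) (by simpa using h) hM hS
      rw [div_one] at this
      have h3 : 1 ≤ (G / K) ^ (1 / 13 : ℝ) :=
        Real.one_le_rpow (by rwa [le_div_iff₀ hK0, one_mul]) (by norm_num)
      have h4 : 0 < G ^ (-(1 / 13) : ℝ) := by positivity
      refine this.trans ?_
      calc A * (K * G ^ 2) ≤ (A + A') * (K * G ^ 2 * 1) := by
            rw [mul_one]; gcongr; linarith
        _ ≤ _ := by gcongr; linarith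
    · obtain ⟨w, w1, w2, w3, w4⟩ := hmin (X := G) (Y := K / G) (e := 1 / 13) (n := 13) hG
        (by rwa [le_div_iff₀ hG0, one_mul]) (by norm_num) (by norm_num) (by norm_num)
      rw [le_div_iff₀ hG0] at w3
      rw [one_div_div] at w4
      refine (h₂ K G w M S m w1 w2 w3 hM hS).trans ?_
      have : K * G ^ 2 / w = K * G ^ 2 * (1 / w) := by ring
      rw [this]
      gcongr
      linarith

/-! ### Hits as integer points near power curves -/

/-- From d^r n ≤ x < (d^r+1)n, the quotient x/d^r exceeds n by less than n/d^r ≤ x/d^(2r). -/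
theorem hits_near {r : ℕ} {x D : ℝ} {d : ℕ} (hD : 0 < D) (hDd : D ≤ d) (hd : d ∈ hits r x) :
    ∃ n : ℤ, |x * (d : ℝ) ^ (-(r : ℝ)) - n| ≤ x / D ^ (2 * r) := by
  obtain ⟨h1, h2, n, h3, h4, h5⟩ := mem_hits hd
  have hd0 : (0 : ℝ) < d := hD.trans_le hDd
  have hx0 : 0 < x := hd0.trans_le h2
  refine ⟨n, ?_⟩
  set y := (d : ℝ) ^ r with hy
  have hy0 : 0 < y := by positivity
  have e : x * (d : ℝ) ^ (-(r : ℝ)) = x / y := by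
    rw [Real.rpow_neg hd0.le, Real.rpow_natCast, ← div_eq_mul_inv]
  rw [e, Int.cast_natCast]
  have a1 : (n : ℝ) ≤ x / y := by rw [le_div_iff₀ hy0]; linarith
  have a2 : x / y - n ≤ x / y ^ 2 := by
    have : x / y - n = (x - y * n) / y := by field_simp
    rw [this, pow_two, ← div_div]
    gcongr
    linarith
  rw [abs_of_nonneg (by linarith)]
  refine a2.trans ?_
  rw [hy, ← pow_mul, mul_comm r 2]
  gcongr

/-- The four-point bound for the number of `d ∈ [D, 2 D]`. -/
theorem card_hits_le {r : ℕ} (hr : 3 ≤ r) : ∃ A > 0, ∀ (x D : ℝ) (T : Finset ℕ), 0 < x → 1 ≤ D →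
    T ⊆ hits r x → (∀ d ∈ T, D ≤ d ∧ (d : ℝ) ≤ 2 * D) →
    (T.card : ℝ) ≤ A * (D * (x * D ^ (-(r : ℝ) - 3)) ^ (1 / 6 : ℝ) + 1) := by
  classical
  have hr3 : (3 : ℝ) ≤ r := by exact_mod_cast hr
  -- The closeness x/D^(2r) must not exceed the order x D^(-r-3) of the third derivative, which is
  -- exactly r ≥ 3; hence squares need another argument.
  obtain ⟨A, hA, h⟩ := card_pow_near_int 3 (by norm_num) (-(r : ℝ)) (fun i _ => by
      have : (0 : ℝ) ≤ i := Nat.cast_nonneg i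
      exact ne_of_lt (by linarith)) (by push_cast; linarith)
    (κ := 2) (C' := 1) (by norm_num) zero_le_one
  refine ⟨A, hA, ?_⟩
  intro x D T hx hD hT hTD
  have hD0 : 0 < D := by linarith
  have hex : ∀ d : ℕ, ∃ n : ℤ, d ∈ T → |x * (d : ℝ) ^ (-(r : ℝ)) - n| ≤ x / D ^ (2 * r) := by
    intro d
    by_cases hd : d ∈ T
    · obtain ⟨n, hn⟩ := hits_near hD0 (hTD d hd).1 (hT hd)
      exact ⟨n, fun _ => hn⟩
    · exact ⟨0, fun h' => absurd h' hd⟩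
  choose n hn using hex
  have := h x D (x / D ^ (2 * r)) T n hx hD0 (by positivity) (by
      rw [one_mul, div_eq_mul_inv, ← Real.rpow_natCast, ← Real.rpow_neg hD0.le]
      refine mul_le_mul_of_nonneg_left (Real.rpow_le_rpow_of_exponent_le hD ?_) hx.le
      push_cast; linarith)
    (fun d hd => ⟨hTD d hd, hn d hd⟩)
  exact this

/-- Passage from `d` to `n`, where `⌊x / n⌋ = d ^ r`. -/
theorem exists_dual {r : ℕ} (hr : 2 ≤ r) {x D : ℝ} {T : Finset ℕ} (hD : 0 < D)
    (hT : T ⊆ hits r x) (hTD : ∀ d ∈ T, D ≤ d ∧ (d : ℝ) ≤ 2 * D) :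
    ∃ (S : Finset ℕ) (m : ℕ → ℤ), S.card = T.card ∧ ∀ n ∈ S, 1 ≤ n ∧
      (n : ℝ) ∈ Set.Icc (x / (2 ^ (r + 1) * D ^ r)) (2 ^ (r + 1) * (x / (2 ^ (r + 1) * D ^ r))) ∧
      |x ^ (1 / (r : ℝ)) * (n : ℝ) ^ (-(1 / (r : ℝ))) + m n| ≤ 1 / D ^ (r - 1) := by
  classical
  have hex : ∀ d : ℕ, ∃ n : ℕ, d ∈ T →
      1 ≤ n ∧ (d : ℝ) ^ r * n ≤ x ∧ x < ((d : ℝ) ^ r + 1) * n := by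
    intro d
    by_cases hd : d ∈ T
    · obtain ⟨-, -, n, hn⟩ := mem_hits (hT hd)
      exact ⟨n, fun _ => hn⟩
    · exact ⟨0, fun h' => absurd h' hd⟩
  choose n hn using hex
  have hd1 : ∀ d ∈ T, 1 ≤ d := fun d hd => (mem_hits (hT hd)).1
  have hpow : ∀ d ∈ T, ⌊x / (n d : ℝ)⌋₊ = d ^ r := fun d hd =>
    (floor_div_eq_iff (hd1 d hd) (hn d hd).1).2 (hn d hd).2
  have hinj : Set.InjOn n T := by
    intro a ha b hb hab
    have h1 := hpow a ha
    rw [hab, hpow b hb] at h1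
    exact (Nat.pow_left_injective (by omega) h1).symm
  refine ⟨T.image n, fun k => -(Nat.nthRoot r ⌊x / (k : ℝ)⌋₊ : ℤ), Finset.card_image_of_injOn hinj, ?_⟩
  intro k hk
  obtain ⟨d, hd, rfl⟩ := Finset.mem_image.1 hk
  obtain ⟨h1, h2, h3⟩ := hn d hd
  obtain ⟨h4, h5⟩ := hTD d hd
  have hd0 : (0 : ℝ) < d := hD.trans_le h4
  have hk0 : (0 : ℝ) < n d := by exact_mod_cast h1
  have hx0 : 0 < x := lt_of_lt_of_le (by positivity) h2
  have hroot : Nat.nthRoot r (d ^ r) = d := Nat.nthRoot_pow (by omega) d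
  refine ⟨h1, ⟨?_, ?_⟩, ?_⟩
  · rw [div_le_iff₀ (by positivity)]
    have h6 : (d : ℝ) ^ r + 1 ≤ 2 ^ (r + 1) * D ^ r := by
      have h7 : (d : ℝ) ^ r ≤ 2 ^ r * D ^ r := by rw [← mul_pow]; gcongr
      have h8 : (1 : ℝ) ≤ (d : ℝ) ^ r := one_le_pow₀ (by exact_mod_cast hd1 d hd)
      rw [pow_succ]; linarith
    calc x ≤ ((d : ℝ) ^ r + 1) * n d := h3.le
      _ ≤ (2 ^ (r + 1) * D ^ r) * n d := by gcongr
      _ = _ := mul_comm _ _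
  · have e : 2 ^ (r + 1) * (x / (2 ^ (r + 1) * D ^ r)) = x / D ^ r := by field_simp
    rw [e, le_div_iff₀ (by positivity)]
    calc (n d : ℝ) * D ^ r ≤ n d * (d : ℝ) ^ r := by gcongr
      _ ≤ x := by linarith
  · dsimp only
    rw [hpow d hd, hroot]
    set y := (x / n d) ^ (1 / (r : ℝ)) with hy
    have hr0 : (r : ℝ) ≠ 0 := by
      have : r ≠ 0 := by omega
      exact_mod_cast this
    have e : x ^ (1 / (r : ℝ)) * (n d : ℝ) ^ (-(1 / (r : ℝ))) = y := by
      rw [hy, Real.div_rpow hx0.le hk0.le, Real.rpow_neg hk0.le]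
      exact (div_eq_mul_inv _ _).symm
    have hy0 : 0 < y := by positivity
    have hyr : y ^ r = x / n d := by
      rw [hy, ← Real.rpow_natCast, ← Real.rpow_mul (by positivity), one_div_mul_cancel hr0,
        Real.rpow_one]
    have hlow : (d : ℝ) ≤ y := by
      refine le_of_pow_le_pow_left₀ (by omega : r ≠ 0) hy0.le ?_
      rw [hyr, le_div_iff₀ hk0]; exact h2
    -- Bernoulli's inequality: raising d(1 + d^(-r)) to the power r gives at least d^r + r, more
    -- than x/n.
    have hup : y ≤ d + 1 / (d : ℝ) ^ (r - 1) := by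
      refine le_of_pow_le_pow_left₀ (by omega : r ≠ 0) (by positivity) ?_
      rw [hyr]
      have h6 := one_add_mul_le_pow (a := 1 / (d : ℝ) ^ r)
        (by have : 0 ≤ 1 / (d : ℝ) ^ r := by positivity
            linarith) r
      have h7 : (d : ℝ) + 1 / (d : ℝ) ^ (r - 1) = d * (1 + 1 / (d : ℝ) ^ r) := by
        obtain ⟨k, rfl⟩ : ∃ k, r = k + 1 := ⟨r - 1, by omega⟩
        rw [Nat.add_sub_cancel]
        field_simp
        ring
      rw [h7, mul_pow]
      have h8 : x / n d < (d : ℝ) ^ r + 1 := by rw [div_lt_iff₀ hk0]; exact h3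
      have h9 : (d : ℝ) ^ r + 1 ≤ (d : ℝ) ^ r * (1 + r * (1 / (d : ℝ) ^ r)) := by
        have e2 : (d : ℝ) ^ r * (1 + r * (1 / (d : ℝ) ^ r)) = (d : ℝ) ^ r + r := by field_simp
        rw [e2]
        have : (2 : ℝ) ≤ r := by exact_mod_cast hr
        linarith
      calc x / n d ≤ (d : ℝ) ^ r * (1 + r * (1 / (d : ℝ) ^ r)) := by linarith
        _ ≤ _ := by gcongr
    rw [e]
    push_cast
    rw [← sub_eq_add_neg, abs_of_nonneg (by linarith)]
    have h10 : 1 / (d : ℝ) ^ (r - 1) ≤ 1 / D ^ (r - 1) := by gcongr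
    linarith

/-- The trivial bound for the number of `d ∈ [D, 2 D]`, through the number of possible `n`. -/
theorem card_hits_le_div {r : ℕ} (hr : 2 ≤ r) {x D : ℝ} {T : Finset ℕ} (hx : 0 ≤ x) (hD : 0 < D)
    (hT : T ⊆ hits r x) (hTD : ∀ d ∈ T, D ≤ d ∧ (d : ℝ) ≤ 2 * D) : (T.card : ℝ) ≤ x / D ^ r := by
  obtain ⟨S, m, hcard, hS⟩ := exists_dual hr hD hT hTD
  have hsub : S ⊆ Finset.Icc 1 ⌊x / D ^ r⌋₊ := by
    intro n hn
    obtain ⟨h1, h2, -⟩ := hS n hn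
    rw [Finset.mem_Icc]
    refine ⟨h1, Nat.le_floor (h2.2.trans (le_of_eq ?_))⟩
    field_simp
  have := Finset.card_le_card hsub
  rw [Nat.card_Icc, Nat.add_sub_cancel, hcard] at this
  calc (T.card : ℝ) ≤ ⌊x / D ^ r⌋₊ := by exact_mod_cast this
    _ ≤ _ := Nat.floor_le (by positivity)

theorem hits_le_rpow {r : ℕ} (hr : r ≠ 0) {x : ℝ} {d : ℕ} (hd : d ∈ hits r x) :
    (d : ℝ) ≤ x ^ (1 / (r : ℝ)) := by
  obtain ⟨h1, h2, n, h3, h4, -⟩ := mem_hits hd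
  have hn : (1 : ℝ) ≤ n := by exact_mod_cast h3
  have h5 : (d : ℝ) ^ r ≤ x := by
    have : (0 : ℝ) ≤ (d : ℝ) ^ r := by positivity
    nlinarith
  have h6 := Real.rpow_le_rpow (by positivity) h5 (by positivity : (0 : ℝ) ≤ 1 / r)
  have hr0 : (r : ℝ) ≠ 0 := by exact_mod_cast hr
  rwa [← Real.rpow_natCast, ← Real.rpow_mul (Nat.cast_nonneg _), mul_one_div_cancel hr0,
    Real.rpow_one] at h6

theorem exists_eq_rpow {x D : ℝ} (hx : 1 < x) (hD : 0 < D) : ∃ u : ℝ, D = x ^ u :=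
  ⟨Real.logb x D, (Real.rpow_logb (by linarith) hx.ne' hD).symm⟩

/-! ### Third and fourth powers -/

/-- Third powers, range between the trivial one and `x ^ (1 / 4)`. -/
theorem card_hits_three_le : ∃ A > 0, ∀ x : ℝ, 1 < x →
    ∑ d ∈ (hits 3 x).filter (fun d : ℕ => x ^ (11 / 64 : ℝ) < d ∧ (d : ℝ) ≤ x ^ (1 / 4 : ℝ)),
      (d : ℝ) ^ (0 : ℝ) ≤ A * x ^ (11 / 64 : ℝ) := by
  obtain ⟨A, hA, hcount⟩ := card_hits_le (r := 3) le_rfl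
  -- The four-point bound is x^(1/6) at every scale. The rate 1/15 makes 11/64 - s(u - 11/64) equal
  -- to 1/6 at the far end u = 1/4.
  obtain ⟨A', hA', hdy⟩ := sum_rpow_le_of_dyadic (α := 0) (s := 1 / 15) le_rfl (by norm_num)
  refine ⟨A' * (2 * A), by positivity, ?_⟩
  intro x hx
  have hx0 : 0 < x := by linarith
  rw [mul_assoc]
  refine hdy _ (x ^ (11 / 64 : ℝ)) (x ^ (1 / 4 : ℝ)) (2 * A * x ^ (11 / 64 : ℝ)) (by positivity)
    (Real.rpow_le_rpow_of_exponent_le hx.le (by norm_num)) (by positivity)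
    (fun d hd => ?_) fun D hD1 hD2 T hT hTD => ?_
  · have := (Finset.mem_filter.1 hd).2
    exact ⟨this.1.le, this.2⟩
  · have hD : 1 ≤ D := le_trans (Real.one_le_rpow hx.le (by norm_num)) hD1
    obtain ⟨u, rfl⟩ := exists_eq_rpow (D := D) hx (by linarith)
    have hu2 := (Real.rpow_le_rpow_left_iff hx).1 hD2
    have h1 := hcount x _ T hx0 hD (hT.trans (Finset.filter_subset _ _)) hTD
    have e1 : x ^ u * (x * (x ^ u) ^ (-((3 : ℕ) : ℝ) - 3)) ^ (1 / 6 : ℝ) = x ^ (1 / 6 : ℝ) := by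
      nth_rewrite 2 [← Real.rpow_one x]
      rw [← Real.rpow_mul hx0.le, ← Real.rpow_add hx0, ← Real.rpow_mul hx0.le, ← Real.rpow_add hx0]
      congr 1; push_cast; ring
    have e2 : x ^ (1 / 6 : ℝ) ≤ x ^ (11 / 64 : ℝ) * (x ^ u / x ^ (11 / 64 : ℝ)) ^ (-(1 / 15) : ℝ) := by
      rw [← Real.rpow_sub hx0, ← Real.rpow_mul hx0.le, ← Real.rpow_add hx0]
      exact Real.rpow_le_rpow_of_exponent_le hx.le (by linarith)
    have e3 : 1 ≤ x ^ (1 / 6 : ℝ) := Real.one_le_rpow hx.le (by norm_num)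
    have e4 : 0 ≤ (x ^ u / x ^ (1 / 4 : ℝ)) ^ (1 / 15 : ℝ) := by positivity
    rw [Real.rpow_zero, mul_one]
    rw [e1] at h1
    calc (T.card : ℝ) ≤ A * (x ^ (1 / 6 : ℝ) + 1) := h1
      _ ≤ 2 * A * x ^ (1 / 6 : ℝ) := by nlinarith
      _ ≤ 2 * A * (x ^ (11 / 64 : ℝ) * (x ^ u / x ^ (11 / 64 : ℝ)) ^ (-(1 / 15) : ℝ)) := by gcongr
      _ = 2 * A * x ^ (11 / 64 : ℝ) * (0 + (x ^ u / x ^ (11 / 64 : ℝ)) ^ (-(1 / 15) : ℝ)) := by ring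
      _ ≤ _ := by gcongr

/-- Fourth powers. -/
theorem sum_hits_four_le : ∃ A > 0, ∀ x : ℝ, 1 < x →
    ∑ d ∈ (hits 4 x).filter (fun d : ℕ => x ^ (1 / 7 : ℝ) < d), (d : ℝ) ^ (1 / 7 : ℝ) ≤
      A * x ^ (8 / 49 : ℝ) := by
  obtain ⟨A, hA, hcount⟩ := card_hits_le (r := 4) (by norm_num)
  -- The weighted exponent 1/6 - u/6 + u/7 equals 8/49 at u = 1/7 and decreases at rate 1/42.
  obtain ⟨A', hA', hdy⟩ := sum_rpow_le_of_dyadic (α := 1 / 7) (s := 1 / 42) (by norm_num)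
    (by norm_num)
  refine ⟨A' * (2 * A), by positivity, ?_⟩
  intro x hx
  have hx0 : 0 < x := by linarith
  rw [mul_assoc]
  refine hdy _ (x ^ (1 / 7 : ℝ)) (x ^ (1 / 4 : ℝ)) (2 * A * x ^ (8 / 49 : ℝ)) (by positivity)
    (Real.rpow_le_rpow_of_exponent_le hx.le (by norm_num)) (by positivity)
    (fun d hd => ?_) fun D hD1 hD2 T hT hTD => ?_
  · rw [Finset.mem_filter] at hd
    exact ⟨hd.2.le, by exact_mod_cast hits_le_rpow (r := 4) (by norm_num) hd.1⟩
  · have hD : 1 ≤ D := le_trans (Real.one_le_rpow hx.le (by norm_num)) hD1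
    obtain ⟨u, rfl⟩ := exists_eq_rpow (D := D) hx (by linarith)
    have hu1 := (Real.rpow_le_rpow_left_iff hx).1 hD1
    have hu2 := (Real.rpow_le_rpow_left_iff hx).1 hD2
    have h1 := hcount x _ T hx0 hD (hT.trans (Finset.filter_subset _ _)) hTD
    have e1 : x ^ u * (x * (x ^ u) ^ (-((4 : ℕ) : ℝ) - 3)) ^ (1 / 6 : ℝ) =
        x ^ (1 / 6 - u / 6 : ℝ) := by
      nth_rewrite 2 [← Real.rpow_one x]
      rw [← Real.rpow_mul hx0.le, ← Real.rpow_add hx0, ← Real.rpow_mul hx0.le, ← Real.rpow_add hx0]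
      congr 1; push_cast; ring
    have e2 : x ^ (1 / 6 - u / 6 : ℝ) * (x ^ u) ^ (1 / 7 : ℝ) =
        x ^ (8 / 49 : ℝ) * (x ^ u / x ^ (1 / 7 : ℝ)) ^ (-(1 / 42) : ℝ) := by
      rw [← Real.rpow_sub hx0, ← Real.rpow_mul hx0.le, ← Real.rpow_add hx0, ← Real.rpow_mul hx0.le,
        ← Real.rpow_add hx0]
      congr 1; ring
    have e3 : 1 ≤ x ^ (1 / 6 - u / 6 : ℝ) := Real.one_le_rpow hx.le (by linarith)
    have e4 : 0 ≤ (x ^ u / x ^ (1 / 4 : ℝ)) ^ (1 / 42 : ℝ) := by positivity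
    rw [e1] at h1
    calc (T.card : ℝ) * (x ^ u) ^ (1 / 7 : ℝ)
        ≤ (2 * A * x ^ (1 / 6 - u / 6 : ℝ)) * (x ^ u) ^ (1 / 7 : ℝ) := by
          gcongr
          nlinarith
      _ = 2 * A * (x ^ (1 / 6 - u / 6 : ℝ) * (x ^ u) ^ (1 / 7 : ℝ)) := by ring
      _ = 2 * A * x ^ (8 / 49 : ℝ) * (0 + (x ^ u / x ^ (1 / 7 : ℝ)) ^ (-(1 / 42) : ℝ)) := by
          rw [e2]; ring
      _ ≤ _ := by gcongr

/-- Third powers, large `d`. -/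
theorem sum_hits_three_le : ∃ A > 0, ∀ x : ℝ, 1 < x →
    ∑ d ∈ (hits 3 x).filter (fun d : ℕ => x ^ (1 / 4 : ℝ) < d), (d : ℝ) ^ (1 / 3 : ℝ) ≤
      A * x ^ (1 / 4 : ℝ) := by
  obtain ⟨A, hA, hcount⟩ := card_pow_near_int_of_chords (-(1 / 3)) (by norm_num) (κ := 16)
    (by norm_num)
  obtain ⟨A', hA', hdy⟩ := sum_rpow_le_of_dyadic (α := 1 / 3) (s := 1 / 3) (by norm_num)
    (by norm_num)
  set k : ℝ := (1 / 16 : ℝ) ^ (-(1 / 3) - 2 : ℝ) with hk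
  have hk0 : 0 < k := by positivity
  set B := A * (2 + (1 + k⁻¹) * (1 + k)) + 1 with hB
  have hB0 : 0 < B := by positivity
  refine ⟨A' * B, by positivity, ?_⟩
  intro x hx
  have hx0 : 0 < x := by linarith
  rw [mul_assoc]
  refine hdy _ (x ^ (1 / 4 : ℝ)) (x ^ (1 / 3 : ℝ)) (B * x ^ (1 / 4 : ℝ)) (by positivity)
    (Real.rpow_le_rpow_of_exponent_le hx.le (by norm_num)) (by positivity)
    (fun d hd => ?_) fun D hD1 hD2 T hT hTD => ?_
  · rw [Finset.mem_filter] at hd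
    exact ⟨hd.2.le, by exact_mod_cast hits_le_rpow (r := 3) (by norm_num) hd.1⟩
  · have hD0 : 0 < D := lt_of_lt_of_le (by positivity) hD1
    obtain ⟨u, rfl⟩ := exists_eq_rpow hx hD0
    have hu1 := (Real.rpow_le_rpow_left_iff hx).1 hD1
    have hu2 := (Real.rpow_le_rpow_left_iff hx).1 hD2
    have hTh := hT.trans (Finset.filter_subset _ _)
    have hmain : (T.card : ℝ) ≤ B * x ^ (1 / 3 - 2 * u / 3 : ℝ) := by
      -- Up to u = 2/7 chords are used on the dual curve; beyond it the trivial count x^(1-3u) is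
      -- already at most x^((1-2u)/3).
      rcases le_total u (2 / 7) with h | h
      · obtain ⟨S, m, hcard, hS⟩ := exists_dual (by norm_num) hD0 hTh hTD
        rw [← hcard]
        set M := x / (2 ^ (3 + 1) * (x ^ u) ^ 3) with hM
        have hMe : M = 1 / 16 * x ^ (1 - 3 * u) := by
          rw [hM, Real.rpow_sub hx0, Real.rpow_one, ← Real.rpow_natCast (x ^ u), ← Real.rpow_mul hx0.le]
          norm_num
          rw [mul_comm u 3]
          field_simp
        have hδ : 1 / (x ^ u) ^ (3 - 1) = x ^ (-(2 * u)) := by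
          rw [Real.rpow_neg hx0.le, one_div, ← Real.rpow_natCast, ← Real.rpow_mul hx0.le]
          norm_num
          rw [mul_comm]
        have hlam : x ^ (1 / 3 : ℝ) * M ^ (-(1 / 3) - 2 : ℝ) = k * x ^ (7 * u - 2) := by
          rw [hMe, Real.mul_rpow (by norm_num) (by positivity), ← Real.rpow_mul hx0.le, ← hk,
            mul_left_comm, ← Real.rpow_add hx0]
          congr 2; ring
        -- With λ of order x^(7u-2), Q = x^((2-7u)/3) balances M/Q against Q²Mλ; it is at least 1
        -- precisely when u ≤ 2/7.
        have h1 := hcount (x ^ (1 / 3 : ℝ)) M (x ^ (-(2 * u))) (x ^ (2 / 3 - 7 * u / 3)) S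
          (fun n => -m n) (by positivity) (by rw [hMe]; positivity) (by positivity)
          (Real.rpow_le_one_of_one_le_of_nonpos hx.le (by linarith))
          (Real.one_le_rpow hx.le (by linarith)) (fun n hn => by
            obtain ⟨-, h2, h3⟩ := hS n hn
            refine ⟨by norm_num at h2 ⊢; exact h2, ?_⟩
            rw [hδ] at h3
            push_cast at h3 ⊢
            rw [sub_neg_eq_add]
            exact h3)
        rw [hlam, hMe] at h1
        set X := x ^ (1 / 3 - 2 * u / 3 : ℝ) with hX
        have hX1 : 1 ≤ X := Real.one_le_rpow hx.le (by linarith)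
        have t1 : 1 / 16 * x ^ (1 - 3 * u) / x ^ (2 / 3 - 7 * u / 3) = 1 / 16 * X := by
          rw [mul_div_assoc, ← Real.rpow_sub hx0, hX]; congr 2; ring
        have t2 : x ^ (-(2 * u)) / (k * x ^ (7 * u - 2)) ≤ k⁻¹ := by
          rw [mul_comm k, ← div_div, ← Real.rpow_sub hx0, div_eq_mul_inv]
          refine mul_le_of_le_one_left (by positivity) ?_
          exact Real.rpow_le_one_of_one_le_of_nonpos hx.le (by linarith)
        have t3 : x ^ (2 / 3 - 7 * u / 3) ≤ X :=
          Real.rpow_le_rpow_of_exponent_le hx.le (by linarith)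
        have t4 : (x ^ (2 / 3 - 7 * u / 3)) ^ 2 * (1 / 16 * x ^ (1 - 3 * u)) *
            (k * x ^ (7 * u - 2)) = k / 16 * X := by
          rw [← Real.rpow_natCast, ← Real.rpow_mul hx0.le]
          have : ∀ a b c : ℝ, a * (1 / 16 * b) * (k * c) = k / 16 * (a * b * c) := by intros; ring
          rw [this, ← Real.rpow_add hx0, ← Real.rpow_add hx0, hX]
          congr 2; push_cast; ring
        rw [t1, t4] at h1
        have t5 : (1 + x ^ (-(2 * u)) / (k * x ^ (7 * u - 2))) *
            (x ^ (2 / 3 - 7 * u / 3) + k / 16 * X) ≤ (1 + k⁻¹) * ((1 + k) * X) := by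
          refine mul_le_mul (by linarith) ?_ (by positivity) (by positivity)
          nlinarith
        calc (S.card : ℝ) ≤ A * (1 + 1 / 16 * X + (1 + k⁻¹) * ((1 + k) * X)) := h1.trans (by gcongr)
          _ ≤ A * (2 * X + (1 + k⁻¹) * ((1 + k) * X)) := by gcongr; linarith
          _ ≤ B * X := by rw [hB]; nlinarith
      · have h1 := card_hits_le_div (by norm_num) hx0.le hD0 hTh hTD
        have e : x / (x ^ u) ^ 3 = x ^ (1 - 3 * u) := by
          rw [Real.rpow_sub hx0, Real.rpow_one, ← Real.rpow_natCast, ← Real.rpow_mul hx0.le]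
          norm_num
          rw [mul_comm u 3]
        rw [e] at h1
        have hB1 : 1 ≤ B := by
          have : 0 ≤ A * (2 + (1 + k⁻¹) * (1 + k)) := by positivity
          linarith
        calc (T.card : ℝ) ≤ x ^ (1 - 3 * u) := h1
          _ ≤ x ^ (1 / 3 - 2 * u / 3 : ℝ) := Real.rpow_le_rpow_of_exponent_le hx.le (by linarith)
          _ ≤ _ := le_mul_of_one_le_left (by positivity) hB1
    have e2 : x ^ (1 / 3 - 2 * u / 3 : ℝ) * (x ^ u) ^ (1 / 3 : ℝ) =
        x ^ (1 / 4 : ℝ) * (x ^ u / x ^ (1 / 4 : ℝ)) ^ (-(1 / 3) : ℝ) := by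
      rw [← Real.rpow_sub hx0, ← Real.rpow_mul hx0.le, ← Real.rpow_add hx0, ← Real.rpow_mul hx0.le,
        ← Real.rpow_add hx0]
      congr 1; ring
    have e4 : 0 ≤ (x ^ u / x ^ (1 / 3 : ℝ)) ^ (1 / 3 : ℝ) := by positivity
    calc (T.card : ℝ) * (x ^ u) ^ (1 / 3 : ℝ)
        ≤ (B * x ^ (1 / 3 - 2 * u / 3 : ℝ)) * (x ^ u) ^ (1 / 3 : ℝ) := by gcongr
      _ = B * (x ^ (1 / 3 - 2 * u / 3 : ℝ) * (x ^ u) ^ (1 / 3 : ℝ)) := by ring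
      _ = B * x ^ (1 / 4 : ℝ) * (0 + (x ^ u / x ^ (1 / 4 : ℝ)) ^ (-(1 / 3) : ℝ)) := by
          rw [e2]; ring
      _ ≤ _ := by gcongr

/-! ### Squares -/

/-- Squares: power gain for `x ^ (1 / 4) ≤ D ≤ x ^ (1 / 3)`. -/
theorem card_hits_two_le : ∃ A > 0, ∀ (x u : ℝ) (T : Finset ℕ), 1 < x → 1 / 4 ≤ u → u ≤ 1 / 3 →
    T ⊆ hits 2 x → (∀ d ∈ T, x ^ u ≤ d ∧ (d : ℝ) ≤ 2 * x ^ u) →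
    (T.card : ℝ) ≤ A * (x ^ ((1 - u) / 3) * (x ^ (-((1 - 3 * u) / 40)) + x ^ ((4 - 13 * u) / 120))) ∧
    (T.card : ℝ) ≤ A * (x ^ ((1 - u) / 3) * (x ^ (-((4 * u - 1) / 39)) + x ^ ((13 * u - 4) / 39))) := by
  classical
  obtain ⟨A, hA, hcount⟩ := card_near_curve 2 (by norm_num) (κ := 2) (C₀ := 1) (by norm_num)
    zero_le_one
  refine ⟨A, hA, ?_⟩
  intro x u T hx hu1 hu2 hT hTD
  have hx0 : 0 < x := by linarith
  have hD0 : 0 < x ^ u := by positivity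
  have hex : ∀ d : ℕ, ∃ n : ℤ, d ∈ T →
      |x * (d : ℝ) ^ (-((2 : ℕ) : ℝ)) - n| ≤ x / (x ^ u) ^ (2 * 2) := by
    intro d
    by_cases hd : d ∈ T
    · obtain ⟨n, hn⟩ := hits_near hD0 (hTD d hd).1 (hT hd)
      exact ⟨n, fun _ => hn⟩
    · exact ⟨0, fun h' => absurd h' hd⟩
  choose n hn using hex
  have hc : x ^ (1 - 3 * u) * (x ^ u) ^ ((2 : ℝ) + 1) = x := by
    rw [← Real.rpow_mul hx0.le, ← Real.rpow_add hx0]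
    nth_rewrite 2 [← Real.rpow_one x]
    congr 1; ring
  have hδ : x / (x ^ u) ^ (2 * 2) = 1 * (x ^ (1 - 3 * u) / x ^ u) := by
    rw [one_mul, ← Real.rpow_sub hx0, ← Real.rpow_natCast, ← Real.rpow_mul hx0.le]
    nth_rewrite 1 [← Real.rpow_one x]
    rw [← Real.rpow_sub hx0]
    congr 1; push_cast; ring
  -- Here K = x^(1-3u) and G = x^((4u-1)/3); K ≥ 1 and G ≥ 1 are the two ends u ≤ 1/3 and u ≥ 1/4,
  -- and K = G at u = 4/13.
  have hM : x ^ u = (x ^ ((4 * u - 1) / 3)) ^ 3 * x ^ (1 - 3 * u) := by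
    rw [← Real.rpow_natCast, ← Real.rpow_mul hx0.le, ← Real.rpow_add hx0]
    congr 1; push_cast; ring
  obtain ⟨h1, h2⟩ := hcount (x ^ (1 - 3 * u)) (x ^ ((4 * u - 1) / 3)) (x ^ u) T (fun d => -n d)
    (Real.one_le_rpow hx.le (by linarith)) (Real.one_le_rpow hx.le (by linarith)) hM
    (fun d hd => by
      refine ⟨hTD d hd, ?_⟩
      have := hn d hd
      rw [hc, ← hδ]
      push_cast at this ⊢
      rwa [← sub_eq_add_neg])
  have hKG : x ^ (1 - 3 * u) * (x ^ ((4 * u - 1) / 3)) ^ 2 = x ^ ((1 - u) / 3) := by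
    rw [← Real.rpow_natCast, ← Real.rpow_mul hx0.le, ← Real.rpow_add hx0]
    congr 1; push_cast; ring
  rw [hKG, ← Real.rpow_sub hx0, ← Real.rpow_mul hx0.le, ← Real.rpow_mul hx0.le] at h1 h2
  constructor
  · convert h1 using 5 <;> ring
  · convert h2 using 5 <;> ring

/-- Squares: power gain for `x ^ (1 / 3) ≤ D ≤ 8 ^ (-1 / 2) x ^ (2 / 5)`. -/
theorem card_hits_two_le_of_large : ∃ A > 0, ∀ (x u : ℝ) (T : Finset ℕ), 1 < x → 1 / 3 ≤ u →
    8 ^ (1 / 2 : ℝ) * x ^ (u - 2 / 5) ≤ 1 →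
    T ⊆ hits 2 x → (∀ d ∈ T, x ^ u ≤ d ∧ (d : ℝ) ≤ 2 * x ^ u) →
    (T.card : ℝ) ≤ A * (x ^ ((1 - u) / 3) * (x ^ (-((3 * u - 1) / 40)) + x ^ ((14 * u - 5) / 120))) ∧
    (T.card : ℝ) ≤ A * (x ^ ((1 - u) / 3) *
      ((8 ^ (1 / 2 : ℝ) * x ^ (u - 2 / 5)) ^ (5 / 39 : ℝ) + x ^ ((5 - 14 * u) / 39))) := by
  classical
  obtain ⟨A, hA, hcount⟩ := card_near_curve (1 / 2) (by norm_num) (κ := 8) (C₀ := 1) (by norm_num)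
    zero_le_one
  -- This is the power of 8 left by (K/G)^(1/40), since 3/2 + 5/6 = 7/3; it is the largest such
  -- constant in the four terms.
  refine ⟨A * 8 ^ (7 / 120 : ℝ), by positivity, ?_⟩
  intro x u T hx hu1 hu2 hT hTD
  have hx0 : 0 < x := by linarith
  have h8 : (0 : ℝ) < 8 := by norm_num
  have hD0 : 0 < x ^ u := by positivity
  obtain ⟨S, m, hcard, hS⟩ := exists_dual le_rfl hD0 hT hTD
  rw [← hcard]
  set M := x / (2 ^ (2 + 1) * (x ^ u) ^ 2) with hM
  -- On the dual curve x^(1/2) n^(-1/2) one has M = x/(8D²), whence the powers of 8. The condition G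
  -- ≥ 1 is the hypothesis relating x^u to x^(2/5), and K and G have equal powers of x at u = 5/14.
  set K := (8 : ℝ) ^ (3 / 2 : ℝ) * x ^ (3 * u - 1) with hK
  set G := (8 : ℝ) ^ (-(5 / 6) : ℝ) * x ^ ((2 - 5 * u) / 3) with hG
  have hMe : M = 8 ^ (-1 : ℝ) * x ^ (1 - 2 * u) := by
    rw [hM, Real.rpow_sub hx0, Real.rpow_one, ← Real.rpow_natCast (x ^ u), ← Real.rpow_mul hx0.le,
      Real.rpow_neg_one]
    norm_num
    rw [mul_comm u 2]
    field_simp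
  have hcomb : ∀ a b a' b' : ℝ, ((8 : ℝ) ^ a * x ^ b) * (8 ^ a' * x ^ b') =
      8 ^ (a + a') * x ^ (b + b') := by
    intro a b a' b'
    rw [Real.rpow_add h8, Real.rpow_add hx0]; ring
  have hpow : ∀ a b e : ℝ, ((8 : ℝ) ^ a * x ^ b) ^ e = 8 ^ (a * e) * x ^ (b * e) := by
    intro a b e
    rw [Real.mul_rpow (by positivity) (by positivity), ← Real.rpow_mul h8.le, ← Real.rpow_mul hx0.le]
  have hdiv : ∀ a b a' b' : ℝ, ((8 : ℝ) ^ a * x ^ b) / (8 ^ a' * x ^ b') =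
      8 ^ (a - a') * x ^ (b - b') := by
    intro a b a' b'
    rw [Real.rpow_sub h8, Real.rpow_sub hx0]; field_simp
  have hc : K * M ^ (1 / 2 + 1 : ℝ) = x ^ (1 / 2 : ℝ) := by
    rw [hK, hMe, hpow, hcomb]
    have e1 : (3 / 2 + -1 * (1 / 2 + 1) : ℝ) = 0 := by norm_num
    rw [e1, Real.rpow_zero, one_mul]
    congr 1; ring
  have hK1 : 1 ≤ K := by
    rw [hK]
    exact one_le_mul_of_one_le_of_one_le (Real.one_le_rpow (by norm_num) (by norm_num))
      (Real.one_le_rpow hx.le (by linarith))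
  have hGinv : G ^ (-(1 : ℝ)) = (8 ^ (1 / 2 : ℝ) * x ^ (u - 2 / 5)) ^ (5 / 3 : ℝ) := by
    rw [hG, hpow, hpow]
    congr 1
    · norm_num
    · congr 1; ring
  have hG0 : 0 < G := by positivity
  have hG1 : 1 ≤ G := by
    have h1 : G ^ (-(1 : ℝ)) ≤ 1 := by
      rw [hGinv]
      exact Real.rpow_le_one (by positivity) hu2 (by norm_num)
    rw [Real.rpow_neg_one] at h1
    exact (inv_le_one₀ hG0).1 h1
  have hM3 : M = G ^ 3 * K := by
    rw [hMe, hG, hK, ← Real.rpow_natCast, hpow, hcomb]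
    congr 1
    · norm_num
    · congr 1; push_cast; ring
  obtain ⟨h1, h2⟩ := hcount K G M S m hK1 hG1 hM3 (fun n hn => by
    obtain ⟨-, h3, h4⟩ := hS n hn
    refine ⟨by norm_num at h3 ⊢; exact h3, ?_⟩
    rw [hc, one_mul]
    push_cast at h4
    refine h4.trans ?_
    rw [hK, hMe, hdiv]
    calc 1 / (x ^ u) ^ (2 - 1) = x ^ (-u) := by rw [Real.rpow_neg hx0.le, one_div]; norm_num
      _ ≤ x ^ (3 * u - 1 - (1 - 2 * u)) := Real.rpow_le_rpow_of_exponent_le hx.le (by linarith)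
      _ ≤ _ := le_mul_of_one_le_left (by positivity)
        (Real.one_le_rpow (by norm_num) (by norm_num)))
  have hKG : K * G ^ 2 ≤ x ^ ((1 - u) / 3) := by
    rw [hK, hG, ← Real.rpow_natCast, hpow, hcomb]
    have e1 : (3 * u - 1 + (2 - 5 * u) / 3 * ((2 : ℕ) : ℝ)) = (1 - u) / 3 := by push_cast; ring
    rw [e1]
    refine mul_le_of_le_one_left (by positivity) ?_
    exact Real.rpow_le_one_of_one_le_of_nonpos (by norm_num) (by norm_num)
  have h81 : (1 : ℝ) ≤ 8 ^ (7 / 120 : ℝ) := Real.one_le_rpow (by norm_num) (by norm_num)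
  have hfin : ∀ a b a' b' : ℝ, 0 ≤ a → 0 ≤ b → a ≤ 8 ^ (7 / 120 : ℝ) * a' → b ≤ 8 ^ (7 / 120 : ℝ) * b' →
      (S.card : ℝ) ≤ A * (K * G ^ 2 * (a + b)) →
      (S.card : ℝ) ≤ A * 8 ^ (7 / 120 : ℝ) * (x ^ ((1 - u) / 3) * (a' + b')) := by
    intro a b a' b' ha hb haa hbb h
    calc (S.card : ℝ) ≤ A * (K * G ^ 2 * (a + b)) := h
      _ ≤ A * (x ^ ((1 - u) / 3) * (8 ^ (7 / 120 : ℝ) * a' + 8 ^ (7 / 120 : ℝ) * b')) := by gcongr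
      _ = _ := by ring
  have hle : ∀ {a e : ℝ}, 0 ≤ a → e ≤ 0 → (8 : ℝ) ^ e * a ≤ 8 ^ (7 / 120 : ℝ) * a := by
    intro a e ha he
    refine mul_le_mul_of_nonneg_right ?_ ha
    exact Real.rpow_le_rpow_of_exponent_le (by norm_num) (by linarith)
  constructor
  · refine hfin _ _ _ _ (by positivity) (by positivity) ?_ ?_ h1
    · rw [hK, hpow]
      have e1 : (3 * u - 1) * (-(1 / 40)) = -((3 * u - 1) / 40) := by ring
      rw [e1]
      exact hle (by positivity) (by norm_num)
    · rw [hK, hG, hdiv, hpow]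
      refine le_of_eq ?_
      congr 1
      · norm_num
      · congr 1; ring
  · refine hfin _ _ _ _ (by positivity) (by positivity) ?_ ?_ h2
    · have e1 : G ^ (-(1 / 13) : ℝ) = (8 ^ (1 / 2 : ℝ) * x ^ (u - 2 / 5)) ^ (5 / 39 : ℝ) := by
        rw [hG, hpow, hpow]
        congr 1
        · norm_num
        · congr 1; ring
      rw [e1]
      exact le_mul_of_one_le_left (by positivity) h81
    · rw [hK, hG, hdiv, hpow]
      have e1 : ((2 - 5 * u) / 3 - (3 * u - 1)) * (1 / 13) = (5 - 14 * u) / 39 := by ring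
      rw [e1]
      exact hle (by positivity) (by norm_num)

theorem sum_filter_lt_le (P : Finset ℕ) {g : ℕ → ℝ} (hg : ∀ d, 0 ≤ g d) (a b : ℝ) :
    ∑ d ∈ P.filter (fun d : ℕ => a < d), g d ≤
      ∑ d ∈ P.filter (fun d : ℕ => a < d ∧ (d : ℝ) ≤ b), g d +
      ∑ d ∈ P.filter (fun d : ℕ => b < d), g d := by
  classical
  rw [← Finset.sum_union_inter]
  refine le_trans (Finset.sum_le_sum_of_subset_of_nonneg (fun d hd => ?_) fun _ _ _ => hg _)
    (le_add_of_nonneg_right (Finset.sum_nonneg fun _ _ => hg _))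
  rw [Finset.mem_filter] at hd
  rw [Finset.mem_union, Finset.mem_filter, Finset.mem_filter]
  rcases le_or_gt (d : ℝ) b with h | h
  · exact Or.inl ⟨hd.1, hd.2, h⟩
  · exact Or.inr ⟨hd.1, h⟩

/-- Squares: the sum over large `d`, with the critical weight. -/
theorem sum_hits_two_le : ∃ A > 0, ∀ x : ℝ, 8 ^ 12 ≤ x →
    ∑ d ∈ (hits 2 x).filter (fun d : ℕ => x ^ (1 / 4 : ℝ) < d), (d : ℝ) ^ (1 / 3 : ℝ) ≤
      A * x ^ (1 / 3 : ℝ) := by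
  classical
  obtain ⟨A₁, hA₁, h₁⟩ := card_hits_two_le
  obtain ⟨A₂, hA₂, h₂⟩ := card_hits_two_le_of_large
  -- The rate 1/40 lies below all the rates of gain or decay occurring in the five ranges, of which
  -- the smallest is 3/40.
  obtain ⟨A', hA', hdy⟩ := sum_rpow_le_of_dyadic (α := 1 / 3) (s := 1 / 40) (by norm_num)
    (by norm_num)
  refine ⟨A' * A₁ + (A' * A₁ + (A' * A₂ + (A' * A₂ + A' * 8 ^ (5 / 6 : ℝ)))), by positivity, ?_⟩
  intro x hx8
  have hx : 1 < x := lt_of_lt_of_le (by norm_num) hx8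
  have hx0 : 0 < x := by linarith
  have h80 : (0 : ℝ) < 8 := by norm_num
  -- With weight d^(1/3) the factor x^((1-u)/3) becomes x^(1/3) at every scale, so only the gains p
  -- and q make the sum over scales converge.
  have hrange : ∀ a b A : ℝ, 0 < a → a ≤ b → 0 ≤ A →
      (∀ (u : ℝ) (T : Finset ℕ), a ≤ x ^ u → x ^ u ≤ b → T ⊆ hits 2 x →
        (∀ d ∈ T, x ^ u ≤ d ∧ (d : ℝ) ≤ 2 * x ^ u) → ∃ p q : ℝ,
          (T.card : ℝ) ≤ A * (x ^ ((1 - u) / 3) * (p + q)) ∧ p ≤ (x ^ u / b) ^ (1 / 40 : ℝ) ∧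
          q ≤ (x ^ u / a) ^ (-(1 / 40) : ℝ)) →
      ∑ d ∈ (hits 2 x).filter (fun d : ℕ => a < d ∧ (d : ℝ) ≤ b), (d : ℝ) ^ (1 / 3 : ℝ) ≤
        A' * A * x ^ (1 / 3 : ℝ) := by
    intro a b A ha hab hA hT
    rw [mul_assoc]
    refine hdy _ a b _ ha hab (by positivity) (fun d hd => ?_) fun D hD1 hD2 T hTP hTD => ?_
    · have := (Finset.mem_filter.1 hd).2
      exact ⟨this.1.le, this.2⟩
    · obtain ⟨u, rfl⟩ := exists_eq_rpow (D := D) hx (by linarith)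
      obtain ⟨p, q, h3, h4, h5⟩ := hT u T hD1 hD2 (hTP.trans (Finset.filter_subset _ _)) hTD
      have e1 : x ^ ((1 - u) / 3) * (x ^ u) ^ (1 / 3 : ℝ) = x ^ (1 / 3 : ℝ) := by
        rw [← Real.rpow_mul hx0.le, ← Real.rpow_add hx0]; congr 1; ring
      calc (T.card : ℝ) * (x ^ u) ^ (1 / 3 : ℝ)
          ≤ A * (x ^ ((1 - u) / 3) * (p + q)) * (x ^ u) ^ (1 / 3 : ℝ) := by gcongr
        _ = A * (x ^ ((1 - u) / 3) * (x ^ u) ^ (1 / 3 : ℝ)) * (p + q) := by ring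
        _ = A * x ^ (1 / 3 : ℝ) * (p + q) := by rw [e1]
        _ ≤ _ := by gcongr
  have hpw : ∀ u t e : ℝ, (x ^ u / x ^ t) ^ e = x ^ ((u - t) * e) := by
    intro u t e
    rw [← Real.rpow_sub hx0, ← Real.rpow_mul hx0.le]
  have hmono : ∀ {s t : ℝ}, s ≤ t → x ^ s ≤ x ^ t := fun h =>
    Real.rpow_le_rpow_of_exponent_le hx.le h
  set b₃ := (8 : ℝ) ^ (-(1 / 2) : ℝ) * x ^ (2 / 5 : ℝ) with hb₃
  have hb₃0 : 0 < b₃ := by positivity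
  have hdiv3 : ∀ u : ℝ, x ^ u / b₃ = 8 ^ (1 / 2 : ℝ) * x ^ (u - 2 / 5) := by
    intro u
    rw [hb₃, Real.rpow_sub hx0, Real.rpow_neg h80.le]
    field_simp
  -- The only use of the size of x: 8^(1/2) ≤ x^(3/70), with 3/70 = 2/5 - 5/14.
  have hb23 : x ^ (5 / 14 : ℝ) ≤ b₃ := by
    have h3 : (8 : ℝ) ^ (1 / 2 : ℝ) ≤ x ^ (3 / 70 : ℝ) :=
      calc (8 : ℝ) ^ (1 / 2 : ℝ) ≤ 8 ^ ((12 : ℕ) * (3 / 70) : ℝ) :=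
            Real.rpow_le_rpow_of_exponent_le (by norm_num) (by norm_num)
        _ = ((8 : ℝ) ^ 12) ^ (3 / 70 : ℝ) := by
            rw [Real.rpow_mul h80.le, Real.rpow_natCast]
        _ ≤ _ := Real.rpow_le_rpow (by positivity) hx8 (by norm_num)
    rw [hb₃, Real.rpow_neg h80.le, ← div_eq_inv_mul, le_div_iff₀ (by positivity)]
    calc x ^ (5 / 14 : ℝ) * 8 ^ (1 / 2 : ℝ) ≤ x ^ (5 / 14 : ℝ) * x ^ (3 / 70 : ℝ) := by gcongr
      _ = x ^ (2 / 5 : ℝ) := by rw [← Real.rpow_add hx0]; norm_num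
  have hb3up : b₃ ≤ x ^ (1 / 2 : ℝ) := by
    calc b₃ ≤ x ^ (2 / 5 : ℝ) := mul_le_of_le_one_left (by positivity)
          (Real.rpow_le_one_of_one_le_of_nonpos (by norm_num) (by norm_num))
      _ ≤ _ := hmono (by norm_num)
  have r1 := hrange (x ^ (1 / 4 : ℝ)) (x ^ (4 / 13 : ℝ)) A₁ (by positivity) (hmono (by norm_num))
    hA₁.le (fun u T hu1 hu2 hT hTD => by
      rw [Real.rpow_le_rpow_left_iff hx] at hu1 hu2
      refine ⟨x ^ ((13 * u - 4) / 39), x ^ (-((4 * u - 1) / 39)), ?_, ?_, ?_⟩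
      · rw [add_comm (x ^ ((13 * u - 4) / 39))]
        exact (h₁ x u T hx hu1 (by linarith) hT hTD).2
      · rw [hpw]; exact hmono (by linarith)
      · rw [hpw]; exact hmono (by linarith))
  have r2 := hrange (x ^ (4 / 13 : ℝ)) (x ^ (1 / 3 : ℝ)) A₁ (by positivity) (hmono (by norm_num))
    hA₁.le (fun u T hu1 hu2 hT hTD => by
      rw [Real.rpow_le_rpow_left_iff hx] at hu1 hu2
      refine ⟨_, _, (h₁ x u T hx (by linarith) hu2 hT hTD).1, ?_, ?_⟩
      · rw [hpw]; exact hmono (by linarith)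
      · rw [hpw]; exact hmono (by linarith))
  have r3 := hrange (x ^ (1 / 3 : ℝ)) (x ^ (5 / 14 : ℝ)) A₂ (by positivity) (hmono (by norm_num))
    hA₂.le (fun u T hu1 hu2 hT hTD => by
      have hu3 : 8 ^ (1 / 2 : ℝ) * x ^ (u - 2 / 5) ≤ 1 := by
        rw [← hdiv3, div_le_one hb₃0]; exact hu2.trans hb23
      rw [Real.rpow_le_rpow_left_iff hx] at hu1 hu2
      refine ⟨x ^ ((14 * u - 5) / 120), x ^ (-((3 * u - 1) / 40)), ?_, ?_, ?_⟩
      · rw [add_comm (x ^ ((14 * u - 5) / 120))]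
        exact (h₂ x u T hx hu1 hu3 hT hTD).1
      · rw [hpw]; exact hmono (by linarith)
      · rw [hpw]; exact hmono (by linarith))
  have r4 := hrange (x ^ (5 / 14 : ℝ)) b₃ A₂ (by positivity) hb23
    hA₂.le (fun u T hu1 hu2 hT hTD => by
      have hu3 : 8 ^ (1 / 2 : ℝ) * x ^ (u - 2 / 5) ≤ 1 := by
        rw [← hdiv3, div_le_one hb₃0]; exact hu2
      rw [Real.rpow_le_rpow_left_iff hx] at hu1
      refine ⟨_, _, (h₂ x u T hx (by linarith) hu3 hT hTD).2, ?_, ?_⟩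
      · rw [hdiv3]
        exact Real.rpow_le_rpow_of_exponent_ge (by positivity) hu3 (by norm_num)
      · rw [hpw]; exact hmono (by linarith))
  have r5 := hrange b₃ (x ^ (1 / 2 : ℝ)) (8 ^ (5 / 6 : ℝ)) hb₃0 hb3up
    (by positivity) (fun u T hu1 hu2 hT hTD => by
      refine ⟨0, _, ?_, by positivity, le_rfl⟩
      have h3 := card_hits_le_div le_rfl hx0.le (by positivity) hT hTD
      have h4 : 1 ≤ x ^ u / b₃ := by rwa [le_div_iff₀ hb₃0, one_mul]
      have e1 : x / (x ^ u) ^ 2 = x ^ ((1 - u) / 3) * x ^ ((2 - 5 * u) / 3) := by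
        rw [← Real.rpow_add hx0, ← Real.rpow_natCast, ← Real.rpow_mul hx0.le]
        nth_rewrite 1 [← Real.rpow_one x]
        rw [← Real.rpow_sub hx0]
        congr 1; push_cast; ring
      have e2 : x ^ ((2 - 5 * u) / 3) = 8 ^ (5 / 6 : ℝ) * (x ^ u / b₃) ^ (-(5 / 3) : ℝ) := by
        rw [hdiv3, Real.mul_rpow (by positivity) (by positivity), ← Real.rpow_mul h80.le,
          ← Real.rpow_mul hx0.le, ← mul_assoc, ← Real.rpow_add h80]
        have e3 : (5 / 6 + 1 / 2 * -(5 / 3) : ℝ) = 0 := by norm_num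
        rw [e3, Real.rpow_zero, one_mul]
        congr 1; ring
      rw [e1, e2] at h3
      calc (T.card : ℝ) ≤ x ^ ((1 - u) / 3) * (8 ^ (5 / 6 : ℝ) * (x ^ u / b₃) ^ (-(5 / 3) : ℝ)) := h3
        _ ≤ x ^ ((1 - u) / 3) * (8 ^ (5 / 6 : ℝ) * (x ^ u / b₃) ^ (-(1 / 40) : ℝ)) := by
            gcongr ?_ * (?_ * ?_)
            exact Real.rpow_le_rpow_of_exponent_le h4 (by norm_num)
        _ = _ := by ring)
  have hlast : ∑ d ∈ (hits 2 x).filter (fun d : ℕ => x ^ (1 / 2 : ℝ) < d), (d : ℝ) ^ (1 / 3 : ℝ) = 0 := by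
    refine Finset.sum_eq_zero fun d hd => ?_
    rw [Finset.mem_filter] at hd
    have := hits_le_rpow (r := 2) (by norm_num) hd.1
    push_cast at this
    linarith [hd.2]
  have hg : ∀ d : ℕ, 0 ≤ (d : ℝ) ^ (1 / 3 : ℝ) := fun d => by positivity
  have s1 := sum_filter_lt_le (hits 2 x) hg (x ^ (1 / 4 : ℝ)) (x ^ (4 / 13 : ℝ))
  have s2 := sum_filter_lt_le (hits 2 x) hg (x ^ (4 / 13 : ℝ)) (x ^ (1 / 3 : ℝ))
  have s3 := sum_filter_lt_le (hits 2 x) hg (x ^ (1 / 3 : ℝ)) (x ^ (5 / 14 : ℝ))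
  have s4 := sum_filter_lt_le (hits 2 x) hg (x ^ (5 / 14 : ℝ)) b₃
  have s5 := sum_filter_lt_le (hits 2 x) hg b₃ (x ^ (1 / 2 : ℝ))
  linarith

/-! ### Asymptotic formulas -/

/-- Reduces every smaller weight to a critical one: above y, lowering the exponent from α' to α
gains the factor y^(α-α'). -/
theorem sum_rpow_le_of_lt {P : Finset ℕ} {y α α' : ℝ} (hy : 0 < y) (hα : α ≤ α')
    (hP : ∀ d ∈ P, y < d) :
    ∑ d ∈ P, (d : ℝ) ^ α ≤ y ^ (α - α') * ∑ d ∈ P, (d : ℝ) ^ α' := by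
  rw [Finset.mul_sum]
  refine Finset.sum_le_sum fun d hd => ?_
  have hd0 : (0 : ℝ) < d := hy.trans (hP d hd)
  have : (d : ℝ) ^ α = (d : ℝ) ^ (α - α') * (d : ℝ) ^ α' := by
    rw [← Real.rpow_add hd0]; congr 1; ring
  rw [this]
  exact mul_le_mul_of_nonneg_right
    (Real.rpow_le_rpow_of_nonpos hy (hP d hd).le (by linarith)) (by positivity)

/-- A bound for the sum over large `d` gives the asymptotic formula. -/
theorem hasAsymptotic_of_sum_le {r : ℕ} (hr : 2 ≤ r) {α θ : ℝ} (hα : 0 ≤ α) (hα1 : α ≤ 1)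
    (hθ : 1 ≤ 2 * r * θ) (hθ1 : θ ≤ 1) {h f : ℕ → ℂ} (hf : IsPowerSupported r h f)
    (hh : h =O[atTop] fun d : ℕ => (d : ℝ) ^ α) {e A : ℝ} (hA : 0 ≤ A) (he : θ * (1 + α) ≤ e)
    (hsum : ∀ᶠ x : ℝ in atTop,
      ∑ d ∈ (hits r x).filter (fun d : ℕ => x ^ θ < d), (d : ℝ) ^ α ≤ A * x ^ e)
    {E : ℝ → ℝ} (hE : ∀ᶠ x : ℝ in atTop, x ^ e ≤ E x) : HasAsymptotic f E := by
  obtain ⟨hs, H, hH, hbd⟩ := exists_error_bound hr hα hα1 hθ hθ1 hf hh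
  refine ⟨hs, IsBigO.of_bound (H * (1 + A)) ?_⟩
  filter_upwards [hsum, hE, eventually_ge_atTop (1 : ℝ)] with x h1 h2 hx
  have hx0 : 0 ≤ x ^ e := by positivity
  rw [Real.norm_of_nonneg (hx0.trans h2)]
  calc ‖S f x - C f * (x : ℂ)‖ ≤ H * (x ^ (θ * (1 + α)) + A * x ^ e) := hbd x hx _ h1
    _ ≤ H * (x ^ e + A * x ^ e) := by
      gcongr
    _ = H * (1 + A) * x ^ e := by ring
    _ ≤ H * (1 + A) * E x := by gcongr

theorem one_le_logFactor (α : ℝ) : ∀ᶠ x : ℝ in atTop, 1 ≤ logFactor α x := by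
  filter_upwards [eventually_ge_atTop (Real.exp 1)] with x hx
  rw [logFactor]
  split_ifs
  · rwa [Real.le_log_iff_exp_le (lt_of_lt_of_le (Real.exp_pos 1) hx)]
  · exact le_rfl

theorem rpow_le_rpow_mul_logFactor (α : ℝ) {s e : ℝ} (hse : s ≤ e) :
    ∀ᶠ x : ℝ in atTop, x ^ s ≤ x ^ e * logFactor α x := by
  filter_upwards [one_le_logFactor α, eventually_ge_atTop (1 : ℝ)] with x h1 hx
  exact (Real.rpow_le_rpow_of_exponent_le hx hse).trans
    (le_mul_of_one_le_right (by positivity) h1)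

/-- From the critical weight 1/3 with y = x^(1/4) one gets the exponent 1/3 + (α - 1/3)/4 = (1+α)/4.
The error E is left free to serve both the two-term bound and the conjecture. -/
theorem hasAsymptotic_two {α : ℝ} (hα : 0 ≤ α) (hα1 : α ≤ 1 / 3) {h f : ℕ → ℂ}
    (hf : IsPowerSupported 2 h f) (hh : h =O[atTop] fun d : ℕ => (d : ℝ) ^ α) {E : ℝ → ℝ}
    (hE : ∀ᶠ x : ℝ in atTop, x ^ ((1 + α) / 4) ≤ E x) : HasAsymptotic f E := by
  obtain ⟨A, hA, hsum⟩ := sum_hits_two_le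
  refine hasAsymptotic_of_sum_le (θ := 1 / 4) (e := (1 + α) / 4) le_rfl hα (by linarith)
    (by norm_num) (by norm_num) hf hh hA.le (by linarith) ?_ hE
  filter_upwards [eventually_ge_atTop ((8 : ℝ) ^ 12)] with x hx
  have hx0 : 0 < x := lt_of_lt_of_le (by norm_num) hx
  refine (sum_rpow_le_of_lt (y := x ^ (1 / 4 : ℝ)) (by positivity) hα1
    fun d hd => (Finset.mem_filter.1 hd).2).trans ?_
  calc (x ^ (1 / 4 : ℝ)) ^ (α - 1 / 3) * _ ≤ (x ^ (1 / 4 : ℝ)) ^ (α - 1 / 3) * (A * x ^ (1 / 3 : ℝ)) := by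
        gcongr
        exact hsum x hx
    _ = A * ((x ^ (1 / 4 : ℝ)) ^ (α - 1 / 3) * x ^ (1 / 3 : ℝ)) := by ring
    _ = _ := by
      rw [← Real.rpow_mul hx0.le, ← Real.rpow_add hx0]
      congr 2; ring

/-- Up to x^(1/4) the weight is at most x^(α/4) and the count O(x^(11/64)); beyond, the weight 1/3
gives x^(α/4 + 1/6), which is smaller. No logarithm arises. -/
theorem hasAsymptotic_three {α : ℝ} (hα : 0 ≤ α) (hα1 : α ≤ 1 / 5) {h f : ℕ → ℂ}
    (hf : IsPowerSupported 3 h f) (hh : h =O[atTop] fun d : ℕ => (d : ℝ) ^ α) :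
    HasAsymptotic f fun x => x ^ (α / 4 + 11 / 64) * logFactor α x := by
  obtain ⟨A, hA, hsum⟩ := sum_hits_three_le
  obtain ⟨A', hA', hsum'⟩ := card_hits_three_le
  refine hasAsymptotic_of_sum_le (θ := 11 / 64) (e := α / 4 + 11 / 64) (A := A' + A) (by norm_num) hα
    (by linarith) (by norm_num) (by norm_num) hf hh (by positivity) (by linarith) ?_
    (rpow_le_rpow_mul_logFactor α le_rfl)
  filter_upwards [eventually_gt_atTop (1 : ℝ)] with x hx
  have hx0 : 0 < x := by linarith
  refine (sum_filter_lt_le (hits 3 x) (fun d => by positivity) _ (x ^ (1 / 4 : ℝ))).trans ?_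
  rw [add_mul]
  refine add_le_add ?_ ?_
  · calc ∑ d ∈ (hits 3 x).filter (fun d : ℕ => x ^ (11 / 64 : ℝ) < d ∧ (d : ℝ) ≤ x ^ (1 / 4 : ℝ)),
          (d : ℝ) ^ α ≤ ∑ d ∈ (hits 3 x).filter
            (fun d : ℕ => x ^ (11 / 64 : ℝ) < d ∧ (d : ℝ) ≤ x ^ (1 / 4 : ℝ)),
          x ^ (α / 4) * (d : ℝ) ^ (0 : ℝ) := by
          refine Finset.sum_le_sum fun d hd => ?_
          rw [Real.rpow_zero, mul_one]
          calc (d : ℝ) ^ α ≤ (x ^ (1 / 4 : ℝ)) ^ α :=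
                Real.rpow_le_rpow (Nat.cast_nonneg d) (Finset.mem_filter.1 hd).2.2 hα
            _ = x ^ (α / 4) := by rw [← Real.rpow_mul hx0.le]; congr 1; ring
      _ ≤ x ^ (α / 4) * (A' * x ^ (11 / 64 : ℝ)) := by
          rw [← Finset.mul_sum]
          gcongr
          exact hsum' x hx
      _ = _ := by rw [Real.rpow_add hx0]; ring
  · refine (sum_rpow_le_of_lt (y := x ^ (1 / 4 : ℝ)) (α' := 1 / 3) (by positivity) (by linarith)
      fun d hd => (Finset.mem_filter.1 hd).2).trans ?_
    calc (x ^ (1 / 4 : ℝ)) ^ (α - 1 / 3) * _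
        ≤ (x ^ (1 / 4 : ℝ)) ^ (α - 1 / 3) * (A * x ^ (1 / 4 : ℝ)) := by
          gcongr
          exact hsum x hx
      _ = A * x ^ (α / 4 + 1 / 6) := by
          rw [← Real.rpow_mul hx0.le, mul_left_comm, ← Real.rpow_add hx0]
          congr 2; ring
      _ ≤ _ := mul_le_mul_of_nonneg_left
          (Real.rpow_le_rpow_of_exponent_le hx.le (by linarith)) hA.le

/-- The proof yields the stronger error x^((1+α)/7), from the weight 1/7 with y = x^(1/7). -/
theorem hasAsymptotic_four {α : ℝ} (hα : 0 ≤ α) (hα1 : α ≤ 1 / 7) {h f : ℕ → ℂ}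
    (hf : IsPowerSupported 4 h f) (hh : h =O[atTop] fun d : ℕ => (d : ℝ) ^ α) :
    HasAsymptotic f fun x => x ^ (α / 5 + 1 / 7) * logFactor α x := by
  obtain ⟨A, hA, hsum⟩ := sum_hits_four_le
  refine hasAsymptotic_of_sum_le (θ := 1 / 7) (e := (1 + α) / 7) (by norm_num) hα (by linarith)
    (by norm_num) (by norm_num) hf hh hA.le (by linarith) ?_
    (rpow_le_rpow_mul_logFactor α (by linarith))
  filter_upwards [eventually_gt_atTop (1 : ℝ)] with x hx
  have hx0 : 0 < x := by linarith
  refine (sum_rpow_le_of_lt (y := x ^ (1 / 7 : ℝ)) (by positivity) hα1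
    fun d hd => (Finset.mem_filter.1 hd).2).trans ?_
  calc (x ^ (1 / 7 : ℝ)) ^ (α - 1 / 7) * _ ≤ (x ^ (1 / 7 : ℝ)) ^ (α - 1 / 7) * (A * x ^ (8 / 49 : ℝ)) := by
        gcongr
        exact hsum x hx
    _ = A * ((x ^ (1 / 7 : ℝ)) ^ (α - 1 / 7) * x ^ (8 / 49 : ℝ)) := by ring
    _ = _ := by
      rw [← Real.rpow_mul hx0.le, ← Real.rpow_add hx0]
      congr 2; ring

end FloorSum

theorem corollary1 :
    (∀ (α : ℝ) (h f : ℕ → ℂ), 0 ≤ α → α ≤ 1 / 3 →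
      FloorSum.IsPowerSupported 2 h f → (h =O[atTop] fun d : ℕ => (d : ℝ) ^ α) →
      FloorSum.HasAsymptotic f fun x =>
        x ^ (α / 3 + 2 / 9) * FloorSum.logFactor α x + x ^ ((1 + α) / 4)) ∧
    (∀ (α : ℝ) (h f : ℕ → ℂ), 0 ≤ α → α ≤ 1 / 5 →
      FloorSum.IsPowerSupported 3 h f → (h =O[atTop] fun d : ℕ => (d : ℝ) ^ α) →
      FloorSum.HasAsymptotic f fun x =>
        x ^ (α / 4 + 11 / 64) * FloorSum.logFactor α x) ∧
    (∀ (α : ℝ) (h f : ℕ → ℂ), 0 ≤ α → α ≤ 1 / 7 →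
      FloorSum.IsPowerSupported 4 h f → (h =O[atTop] fun d : ℕ => (d : ℝ) ^ α) →
      FloorSum.HasAsymptotic f fun x =>
        x ^ (α / 5 + 1 / 7) * FloorSum.logFactor α x) ∧
    FloorSum.PowerConjecture 2 := by
  -- For r = 2 the term x^((1+α)/4) alone suffices; of the other summand only its eventual
  -- nonnegativity is needed.
  refine ⟨fun α h f hα hα1 hf hh => FloorSum.hasAsymptotic_two hα hα1 hf hh ?_,
    fun α h f hα hα1 hf hh => FloorSum.hasAsymptotic_three hα hα1 hf hh,
    fun α h f hα hα1 hf hh => FloorSum.hasAsymptotic_four hα hα1 hf hh,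
    fun α h f hα hα1 hf hh => FloorSum.hasAsymptotic_two hα (hα1.trans ?_) hf hh ?_⟩
  · filter_upwards [FloorSum.one_le_logFactor α, eventually_ge_atTop (0 : ℝ)] with x h1 hx
    have : 0 ≤ x ^ (α / 3 + 2 / 9) * FloorSum.logFactor α x :=
      mul_nonneg (by positivity) (by linarith)
    linarith
  · norm_num
  · refine Eventually.of_forall fun x => le_of_eq ?_
    congr 1
    push_cast
    ring
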